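/- Fix $\tau\in\mathbb{C}$ with $\operatorname{Im}\tau>0$. Let $\theta_\tau(z)=\sum_{n\in\mathbb{Z}}(-1)^n e^{2\pi i\tau\cdot\frac12(n+\frac12)^2}e^{2\pi i z(n+\frac12)}$, let $F_\tau(\alpha;z)=\dfrac{\theta_\tau(z+\alpha)\,\theta_\tau'(0)}{\theta_\tau(z)\,\theta_\tau(\alpha)}$ be the Eisenstein--Kronecker series, and define $f_\tau^{(n)}(z)$, $n\ge 0$, by the Laurent expansion $F_\tau(\alpha;z)=\sum_{n\ge0}f_\tau^{(n)}(z)\,\alpha^{n-1}$ at $\alpha=0$. If a function $f(\epsilon)$ satisfies $f(\epsilon)=\sum_{n=0}^{N}c_n(\log(-2\pi i\epsilon))^n+O(\epsilon^\delta)$ as $\epsilon\to0^+$, for some $N\ge0$, $\delta>0$, $c_n\in\mathbb{C}$ (with $\log(-i)=-\pi i/2$), put $\mathrm{Reg}_{\epsilon\to0}f(\epsilon):=c_0$. For $\boldsymbol{k}=(k_1,\dots,k_r)\in\mathbb{Z}_{\ge0}^r$, $r\ge0$, the (regularized) elliptic multiple zeta value is $$I^A(\boldsymbol{k})=\mathrm{Reg}_{\epsilon\to0}\int_{\epsilon<z_1<\cdots<z_r<1-\epsilon}f_\tau^{(k_1)}(z_1)\,dz_1\cdots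 f_\tau^{(k_r)}(z_r)\,dz_r,\qquad I^A(\emptyset)=1 .$$ For $\boldsymbol{l}\in\mathbb{Z}_{\ge0}^r$, $r\ge1$, let $P_{\boldsymbol{l}}(u_1,\dots,u_r)\in\mathbb{Q}(u_1,\dots,u_r)$ be $$P_{\boldsymbol{l}}=\sum_{i=0}^{r-1}u_1^{l_1-1}\cdots u_{i-1}^{l_{i-1}-1}(u_i+\cdots+u_r)^{l_i-1}(-u_{i+1}-\cdots-u_r)^{l_{i+1}-1}u_{i+1}^{l_{i+2}-1}\cdots u_{r-1}^{l_r-1},$$ where the term $i=0$ is $(-u_1-\cdots-u_r)^{l_1-1}u_1^{l_2-1}\cdots u_{r-1}^{l_r-1}$. Then $u_1\cdots u_rP_{\boldsymbol{l}}\in\mathbb{Z}[u_1,\dots,u_r]$; let $c\langle\boldsymbol{l}\mid\boldsymbol{k}\rangle$ denote the coefficient of $u_1^{k_1}\cdots u_r^{k_r}$ in this polynomial. **Theorem (Fay relations).** All the regularized values $I^A(\boldsymbol{l})$ exist. For every $\boldsymbol{k}=(k_1,\dots,k_r)\in\mathbb{Z}_{\ge0}^r$ with $r=1$, or with $r>1$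 and $k_r\ne1$, only finitely many $\boldsymbol{l}\in\mathbb{Z}_{\ge0}^r$ satisfy $c\langle\boldsymbol{l}\mid\boldsymbol{k}\rangle\ne0$, and $$I^A(\boldsymbol{k})=\sum_{i=2}^{r}(-1)^i\,\delta_{1,k_1}\cdots\delta_{1,k_{i-1}}\,\delta_{1,k_r}\,\zeta(i)\,I^A(k_i,\dots,k_{r-1})-\sum_{\boldsymbol{l}\in\mathbb{Z}_{\ge0}^r}c\langle\boldsymbol{l}\mid\boldsymbol{k}\rangle\,I^A(\boldsymbol{l}).$$ -/

import Mathlib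

open Filter Topology

noncomputable section

namespace EMZV

/-! ### The Eisenstein-Kronecker series -/

/-- The odd Jacobi theta function
`θ_τ(z) = ∑_{n ∈ ℤ} (-1)^n q^{(n + 1/2)^2 / 2} w^{n + 1/2}`, `q = e^{2πiτ}`, `w = e^{2πiz}`,
where `q^s` means `e^{2πiτs}` and `w^s` means `e^{2πizs}`. -/
def theta (τ z : ℂ) : ℂ :=
  ∑' n : ℤ, (-1 : ℂ) ^ n *
    Complex.exp (2 * Real.pi * Complex.I * τ * (((n : ℂ) + 1 / 2) ^ 2 / 2)) *
    Complex.exp (2 * Real.pi * Complex.I * z * ((n : ℂ) + 1 / 2))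

/-- The Eisenstein-Kronecker series `F_τ(α; z) = θ(z + α) θ'(0) / (θ(z) θ(α))`. -/
def kroneckerF (τ α z : ℂ) : ℂ :=
  theta τ (z + α) * deriv (theta τ) 0 / (theta τ z * theta τ α)

/-- The function `α ↦ α * F_τ(α; z)`, extended to `α = 0` by its limit (`F_τ(α; z)` has a simple
pole at `α = 0`). -/
def kroneckerReg (τ z : ℂ) : ℂ → ℂ :=
  Function.update (fun α => α * kroneckerF τ α z) 0
    (limUnder (𝓝[≠] (0 : ℂ)) (fun α => α * kroneckerF τ α z))

/-- The Laurent coefficients in `F_τ(α; z) = ∑_{n ≥ 0} f^{(n)}_τ(z) α^{n - 1}` at `α = 0`, that is,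
the Taylor coefficients of `α * F_τ(α; z)`. -/
def kernelF (τ : ℂ) (n : ℕ) (z : ℂ) : ℂ :=
  iteratedDeriv n (kroneckerReg τ z) 0 / (n.factorial : ℂ)

/-! ### Regularized elliptic multiple zeta values -/

/-- The iterated integral
`∫_{a < z_1 < ⋯ < z_r < x} f^{(k_1)}(z_1) dz_1 ⋯ f^{(k_r)}(z_r) dz_r`, whose outermost integration
variable is `z_r`; it is `1` for `r = 0`. -/
def iterInt (τ : ℂ) (a : ℝ) : (r : ℕ) → (Fin r → ℕ) → ℝ → ℂ
  | 0, _, _ => 1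
  | r + 1, k, x =>
      ∫ t in a..x, iterInt τ a r (Fin.init k) t * kernelF τ (k (Fin.last r)) (t : ℂ)

/-- `HasReg f c` says that `f(ε) = ∑_{n = 0}^N c_n (log (-2πiε))^n + O(ε^δ)` as `ε → 0+`, for some
`N`, some `δ > 0` and some constants `c_n` with `c_0 = c`. The principal branch of the logarithm has
`log (-i) = -πi/2`. -/
def HasReg (f : ℝ → ℂ) (c : ℂ) : Prop :=
  ∃ (N : ℕ) (coef : ℕ → ℂ) (δ : ℝ), 0 < δ ∧ coef 0 = c ∧
    (fun ε : ℝ => f ε - ∑ n ∈ Finset.range (N + 1),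
        coef n * Complex.log (-2 * Real.pi * Complex.I * (ε : ℂ)) ^ n)
      =O[𝓝[>] (0 : ℝ)] (fun ε : ℝ => ε ^ δ)

open Classical in
/-- The regularized value `Reg_{ε → 0}^{-2πi} f(ε)`. -/
def Reg (f : ℝ → ℂ) : ℂ :=
  if h : ∃ c, HasReg f c then h.choose else 0

/-- The truncated integral
`∫_{ε < z_1 < ⋯ < z_r < 1 - ε} f^{(k_1)}(z_1) dz_1 ⋯ f^{(k_r)}(z_r) dz_r`. -/
def truncInt (τ : ℂ) {r : ℕ} (k : Fin r → ℕ) (ε : ℝ) : ℂ :=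
  iterInt τ ε r k (1 - ε)

/-- The (regularized) elliptic multiple zeta value `I^A(k_1, …, k_r; τ)`. -/
def IA (τ : UpperHalfPlane) {r : ℕ} (k : Fin r → ℕ) : ℂ :=
  Reg (truncInt (τ : ℂ) k)

/-! ### The coefficients `c⟨l | k⟩` -/

section Fay

variable {K : Type*} [Field K] {r : ℕ}

/-- For `0 ≤ i < r`, the entries of the tuple
`(u_1, …, u_{i-1}, u_i + ⋯ + u_r, -u_{i+1} - ⋯ - u_r, u_{i+1}, …, u_{r-1})`
(for `i = 0` this is `(-u_1 - ⋯ - u_r, u_1, …, u_{r-1})`).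
The position `j : Fin r` stands for the position `j + 1` of the tuple, and `u j` for `u_{j+1}`. -/
def fayArg (u : Fin r → K) (i j : Fin r) : K :=
  if (j : ℕ) + 1 < i then u j
  else if (j : ℕ) + 1 = i then ∑ m ∈ Finset.Ici j, u m
  else if j = i then -∑ m ∈ Finset.Ici j, u m
  else u ⟨(j : ℕ) - 1, by omega⟩

/-- The rational function
`P_l(u_1, …, u_r) = ∑_{i=0}^{r-1} u_1^{l_1-1} ⋯ u_{i-1}^{l_{i-1}-1} (u_i + ⋯ + u_r)^{l_i-1}
(-u_{i+1} - ⋯ - u_r)^{l_{i+1}-1} u_{i+1}^{l_{i+2}-1} ⋯ u_{r-1}^{l_r-1}`. -/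
def fayP (l : Fin r → ℕ) (u : Fin r → K) : K :=
  ∑ i : Fin r, ∏ j : Fin r, fayArg u i j ^ ((l j : ℤ) - 1)

end Fay

/-- The variables `u_1, …, u_r` as elements of `ℚ(u_1, …, u_r)`, the fraction field of
`ℤ[u_1, …, u_r]`. -/
def ratVar (r : ℕ) (j : Fin r) : FractionRing (MvPolynomial (Fin r) ℤ) :=
  algebraMap (MvPolynomial (Fin r) ℤ) _ (MvPolynomial.X j)

/-! The next facts show that `u_1 ⋯ u_r P_l(u_1, …, u_r)` is a polynomial with integer
coefficients. -/

section Integrality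

variable {K : Type*} [Field K]

/-- Auxiliary version of `fayArg` for sequences. -/
def argAux (n : ℕ) (u : ℕ → K) (i j : ℕ) : K :=
  if j + 1 < i then u j
  else if j + 1 = i then ∑ m ∈ Finset.Ico j n, u m
  else if j = i then -∑ m ∈ Finset.Ico j n, u m
  else u (j - 1)

theorem argAux_succ (n : ℕ) (u : ℕ → K) (i j : ℕ) (hi : 1 ≤ i) :
    argAux (n + 1) u (i + 1) (j + 1) = argAux n (fun m => u (m + 1)) i j := by
  unfold argAux
  have h : ∑ m ∈ Finset.Ico (j + 1) (n + 1), u m = ∑ m ∈ Finset.Ico j n, u (m + 1) := by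
    rw [Finset.sum_Ico_add']
  rw [h]
  by_cases h1 : j + 1 < i
  · simp [h1]
  by_cases h2 : j + 1 = i
  · simp [h2]
  by_cases h3 : j = i
  · simp [h3]
  have h4 : j - 1 + 1 = j := by omega
  simp [h1, h2, h3, h4]

theorem two_mem (S : Subring K) (x y : K) (hx : x ∈ S) (hy : y ∈ S) (a : ℕ) (hxy : x - y ≠ 0) :
    (x ^ a - y ^ a) / (x - y) ∈ S := by
  have h := (Commute.all x y).geom_sum₂_mul a
  rw [← h, mul_div_assoc, div_self hxy, mul_one]
  exact S.sum_mem fun i _ => S.mul_mem (S.pow_mem hx _) (S.pow_mem hy _)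

theorem bracket_mem (S : Subring K) (a b w : K) (ha : a ∈ S) (hb : b ∈ S) (hw : w ∈ S)
    (ha0 : a ≠ 0) (hb0 : b ≠ 0) (hab : a + b ≠ 0) (p q : ℕ) :
    a * w * (((a + b) ^ ((p : ℤ) - 1) - a ^ ((p : ℤ) - 1)) * (-b) ^ ((q : ℤ) - 1)
      + (-(a + b)) ^ ((p : ℤ) - 1) * a ^ ((q : ℤ) - 1)) ∈ S := by
  have hs : a + b ∈ S := S.add_mem ha hb
  have hnb : -b ∈ S := S.neg_mem hb
  have hns : -(a + b) ∈ S := S.neg_mem hs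
  have haw : a * w ∈ S := S.mul_mem ha hw
  rcases p with _ | p <;> rcases q with _ | q
  · have : a * w * (((a + b) ^ (((0 : ℕ) : ℤ) - 1) - a ^ (((0 : ℕ) : ℤ) - 1)) *
        (-b) ^ (((0 : ℕ) : ℤ) - 1) + (-(a + b)) ^ (((0 : ℕ) : ℤ) - 1) *
        a ^ (((0 : ℕ) : ℤ) - 1)) = 0 := by
      simp only [Nat.cast_zero, zero_sub, zpow_neg, zpow_one, inv_neg]
      field_simp
      ring
    rw [this]; exact S.zero_mem
  · have : a * w * (((a + b) ^ (((0 : ℕ) : ℤ) - 1) - a ^ (((0 : ℕ) : ℤ) - 1)) *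
        (-b) ^ (((q + 1 : ℕ) : ℤ) - 1) + (-(a + b)) ^ (((0 : ℕ) : ℤ) - 1) *
        a ^ (((q + 1 : ℕ) : ℤ) - 1))
        = -(a * w) * ((a ^ q - (-b) ^ q) / (a - -b)) - w * (-b) ^ q := by
      simp only [Nat.cast_zero, zero_sub, zpow_neg, zpow_one, inv_neg, Nat.cast_add, Nat.cast_one,
        add_sub_cancel_right, zpow_natCast, sub_neg_eq_add]
      field_simp
      ring
    rw [this]
    exact S.sub_mem (S.mul_mem (S.neg_mem haw) (two_mem S a (-b) ha hnb q (by simpa using hab)))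
      (S.mul_mem hw (S.pow_mem hnb _))
  · have : a * w * (((a + b) ^ (((p + 1 : ℕ) : ℤ) - 1) - a ^ (((p + 1 : ℕ) : ℤ) - 1)) *
        (-b) ^ (((0 : ℕ) : ℤ) - 1) + (-(a + b)) ^ (((p + 1 : ℕ) : ℤ) - 1) *
        a ^ (((0 : ℕ) : ℤ) - 1))
        = -(a * w) * (((a + b) ^ p - a ^ p) / (a + b - a)) + w * (-(a + b)) ^ p := by
      simp only [Nat.cast_zero, zero_sub, zpow_neg, zpow_one, inv_neg, Nat.cast_add, Nat.cast_one,
        add_sub_cancel_right, zpow_natCast, add_sub_cancel_left]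
      field_simp
    rw [this]
    exact S.add_mem (S.mul_mem (S.neg_mem haw) (two_mem S (a + b) a hs ha p (by simpa using hb0)))
      (S.mul_mem hw (S.pow_mem hns _))
  · simp only [Nat.cast_add, Nat.cast_one, add_sub_cancel_right, zpow_natCast]
    exact S.mul_mem haw (S.add_mem (S.mul_mem (S.sub_mem (S.pow_mem hs _) (S.pow_mem ha _))
      (S.pow_mem hnb _)) (S.mul_mem (S.pow_mem hns _) (S.pow_mem ha _)))

theorem aux_mem (S : Subring K) (n : ℕ) : ∀ (u : ℕ → K) (l : ℕ → ℕ), (∀ m, u m ∈ S) →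
    (∀ m ≤ n, u m ≠ 0) → (∀ j ≤ n, ∑ m ∈ Finset.Ico j (n + 1), u m ≠ 0) →
    (∏ j ∈ Finset.range (n + 1), u j) * ∑ i ∈ Finset.range (n + 1),
      ∏ j ∈ Finset.range (n + 1), argAux (n + 1) u i j ^ ((l j : ℤ) - 1) ∈ S := by
  induction n with
  | zero =>
    intro u l hu h0 _
    have h := h0 0 le_rfl
    simp only [zero_add, Finset.range_one, Finset.prod_singleton, Finset.sum_singleton, argAux]
    simp only [Nat.not_lt_zero, if_false, Nat.succ_ne_zero, if_true, Nat.Ico_succ_singleton,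
      Finset.sum_singleton]
    rcases hl : l 0 with _ | p
    · simp [h, S.neg_mem S.one_mem, inv_neg]
    · simp only [Nat.cast_add, Nat.cast_one, add_sub_cancel_right, zpow_natCast]
      exact S.mul_mem (hu 0) (S.pow_mem (S.neg_mem (hu 0)) _)
  | succ n ih =>
    intro u l hu h0 hU
    have ih' := ih (fun m => u (m + 1)) (fun m => l (m + 1)) (fun m => hu _)
      (fun m hm => h0 _ (by omega)) (fun j hj => by
        rw [Finset.sum_Ico_add' u j (n + 1) 1]; exact hU _ (by omega))
    set A : K := u 0 with hA
    set B : K := ∑ m ∈ Finset.Ico 1 (n + 2), u m with hB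
    have hAB : ∑ m ∈ Finset.Ico 0 (n + 2), u m = A + B := by
      rw [Finset.sum_eq_sum_Ico_succ_bot (by omega)]
    set R : K := ∏ j ∈ Finset.range n, u (j + 1) ^ ((l (j + 2) : ℤ) - 1) with hR
    -- the terms of the sum
    have t0 : ∏ j ∈ Finset.range (n + 2), argAux (n + 2) u 0 j ^ ((l j : ℤ) - 1)
        = (-(A + B)) ^ ((l 0 : ℤ) - 1) * (A ^ ((l 1 : ℤ) - 1) * R) := by
      rw [Finset.prod_range_succ', Finset.prod_range_succ', mul_comm]
      have e0 : argAux (n + 2) u 0 0 = -(A + B) := by simp [argAux, ← hAB]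
      have e1 : argAux (n + 2) u 0 (0 + 1) = A := by simp [argAux, hA]
      rw [e0, e1, mul_comm (∏ _ ∈ _, _)]
      congr 2
    have t1 : ∏ j ∈ Finset.range (n + 2), argAux (n + 2) u 1 j ^ ((l j : ℤ) - 1)
        = (A + B) ^ ((l 0 : ℤ) - 1) * ((-B) ^ ((l 1 : ℤ) - 1) * R) := by
      rw [Finset.prod_range_succ', Finset.prod_range_succ', mul_comm]
      have e0 : argAux (n + 2) u 1 0 = A + B := by simp [argAux, ← hAB]
      have e1 : argAux (n + 2) u 1 (0 + 1) = -B := by simp [argAux, hB]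
      rw [e0, e1, mul_comm (∏ _ ∈ _, _)]
      congr 2
    have t2 : ∀ i, ∏ j ∈ Finset.range (n + 2), argAux (n + 2) u (i + 1 + 1) j ^ ((l j : ℤ) - 1)
        = A ^ ((l 0 : ℤ) - 1) * ∏ j ∈ Finset.range (n + 1),
          argAux (n + 1) (fun m => u (m + 1)) (i + 1) j ^ ((l (j + 1) : ℤ) - 1) := by
      intro i
      rw [Finset.prod_range_succ', mul_comm]
      have e0 : argAux (n + 2) u (i + 1 + 1) 0 = A := by simp [argAux, hA]
      rw [e0]
      congr 1
      exact Finset.prod_congr rfl fun j _ => by rw [argAux_succ _ _ _ _ (by omega)]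
    have s0 : ∏ j ∈ Finset.range (n + 1),
        argAux (n + 1) (fun m => u (m + 1)) 0 j ^ ((l (j + 1) : ℤ) - 1)
        = (-B) ^ ((l 1 : ℤ) - 1) * R := by
      rw [Finset.prod_range_succ', mul_comm]
      have e0 : argAux (n + 1) (fun m => u (m + 1)) 0 0 = -B := by
        simp only [argAux, Nat.not_lt_zero, if_false, Nat.succ_ne_zero, if_true]
        rw [Finset.sum_Ico_add' u 0 (n + 1) 1]
      rw [e0]
      congr 1
    set T : K := ∑ i ∈ Finset.range n, ∏ j ∈ Finset.range (n + 1),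
          argAux (n + 1) (fun m => u (m + 1)) (i + 1) j ^ ((l (j + 1) : ℤ) - 1) with hS
    set W : K := ∏ j ∈ Finset.range (n + 1), u (j + 1) with hW
    have hP : ∏ j ∈ Finset.range (n + 2), u j = A * W := by
      rw [Finset.prod_range_succ', mul_comm]
    rw [Finset.sum_range_succ', s0] at ih'
    change W * (T + _) ∈ S at ih'
    have hsum : ∑ i ∈ Finset.range (n + 2), ∏ j ∈ Finset.range (n + 2),
        argAux (n + 2) u i j ^ ((l j : ℤ) - 1)
        = A ^ ((l 0 : ℤ) - 1) * T + (A + B) ^ ((l 0 : ℤ) - 1) * ((-B) ^ ((l 1 : ℤ) - 1) * R)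
          + (-(A + B)) ^ ((l 0 : ℤ) - 1) * (A ^ ((l 1 : ℤ) - 1) * R) := by
      rw [Finset.sum_range_succ', Finset.sum_range_succ', t0, zero_add, t1,
        Finset.sum_congr rfl fun i _ => t2 i, ← Finset.mul_sum]
    rw [hP, hsum]
    have hWR : W * R = u (n + 1) * ∏ j ∈ Finset.range n, u (j + 1) ^ l (j + 2) := by
      rw [hW, hR, Finset.prod_range_succ, mul_comm _ (u (n + 1)), mul_assoc,
        ← Finset.prod_mul_distrib]
      congr 1
      refine Finset.prod_congr rfl fun j hj => ?_
      have hj0 : u (j + 1) ≠ 0 := h0 _ (by have := Finset.mem_range.1 hj; omega)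
      rw [← zpow_one_add₀ hj0]
      simp
    have hWRS : W * R ∈ S := by
      rw [hWR]
      exact S.mul_mem (hu _) (S.prod_mem fun j _ => S.pow_mem (hu _) _)
    have hA0 : A ≠ 0 := h0 0 (by omega)
    have hB0 : B ≠ 0 := hU 1 (by omega)
    have hAB0 : A + B ≠ 0 := hAB ▸ hU 0 (by omega)
    have hBS : B ∈ S := S.sum_mem fun m _ => hu m
    have hbr := bracket_mem S A B (W * R) (hu 0) hBS hWRS hA0 hB0 hAB0 (l 0) (l 1)
    have hApow : A * A ^ ((l 0 : ℤ) - 1) = A ^ l 0 := by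
      rw [← zpow_one_add₀ hA0]; simp
    have hkey : A * W * (A ^ ((l 0 : ℤ) - 1) * T
          + (A + B) ^ ((l 0 : ℤ) - 1) * ((-B) ^ ((l 1 : ℤ) - 1) * R)
          + (-(A + B)) ^ ((l 0 : ℤ) - 1) * (A ^ ((l 1 : ℤ) - 1) * R))
        = (A * A ^ ((l 0 : ℤ) - 1)) * (W * (T + (-B) ^ ((l 1 : ℤ) - 1) * R))
          + A * (W * R) * (((A + B) ^ ((l 0 : ℤ) - 1) - A ^ ((l 0 : ℤ) - 1)) *
            (-B) ^ ((l 1 : ℤ) - 1) + (-(A + B)) ^ ((l 0 : ℤ) - 1) * A ^ ((l 1 : ℤ) - 1)) := by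
      ring
    rw [hkey, hApow]
    exact S.add_mem (S.mul_mem (S.pow_mem (hu 0) _) ih') hbr

end Integrality

theorem exists_fayPoly {r : ℕ} (l : Fin r → ℕ) :
    ∃ p : MvPolynomial (Fin r) ℤ,
      algebraMap (MvPolynomial (Fin r) ℤ) (FractionRing (MvPolynomial (Fin r) ℤ)) p
        = (∏ j : Fin r, ratVar r j) * fayP l (ratVar r) := by
  classical
  rcases r with _ | n
  · exact ⟨0, by simp [fayP]⟩
  set S : Subring (FractionRing (MvPolynomial (Fin (n + 1)) ℤ)) :=
    (algebraMap (MvPolynomial (Fin (n + 1)) ℤ) _).range with hS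
  set u : ℕ → FractionRing (MvPolynomial (Fin (n + 1)) ℤ) :=
    fun m => if h : m < n + 1 then ratVar (n + 1) ⟨m, h⟩ else 0 with hu
  set l' : ℕ → ℕ := fun m => if h : m < n + 1 then l ⟨m, h⟩ else 0 with hl'
  have huv : ∀ j : Fin (n + 1), u j = ratVar (n + 1) j := fun j => dif_pos j.2
  have hlv : ∀ j : Fin (n + 1), l' j = l j := fun j => dif_pos j.2
  have hUv : ∀ j : Fin (n + 1), ∑ m ∈ Finset.Ico (j : ℕ) (n + 1), u m
      = ∑ m ∈ Finset.Ici j, ratVar (n + 1) m := by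
    intro j
    symm
    refine Finset.sum_bij (fun m _ => (m : ℕ)) ?_ ?_ ?_ ?_
    · intro m hm
      have : j ≤ m := Finset.mem_Ici.1 hm
      exact Finset.mem_Ico.2 ⟨this, m.2⟩
    · intro a _ b _ h
      exact Fin.ext h
    · intro b hb
      have := Finset.mem_Ico.1 hb
      exact ⟨⟨b, this.2⟩, Finset.mem_Ici.2 this.1, rfl⟩
    · intro m _
      exact (huv m).symm
  have hmem : ∀ m, u m ∈ S := by
    intro m
    by_cases h : m < n + 1
    · simp only [hu, h, dif_pos]; exact ⟨_, rfl⟩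
    · simp only [hu, h, dif_neg, not_false_eq_true]; exact S.zero_mem
  have inj : Function.Injective (algebraMap (MvPolynomial (Fin (n + 1)) ℤ)
      (FractionRing (MvPolynomial (Fin (n + 1)) ℤ))) := IsFractionRing.injective _ _
  have hne : ∀ m ≤ n, u m ≠ 0 := by
    intro m hm
    have h : m < n + 1 := by omega
    simp only [hu, h, dif_pos, ratVar]
    intro h0
    rw [← map_zero (algebraMap (MvPolynomial (Fin (n + 1)) ℤ) _)] at h0
    exact MvPolynomial.X_ne_zero _ (inj h0)
  have hUne : ∀ j ≤ n, ∑ m ∈ Finset.Ico j (n + 1), u m ≠ 0 := by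
    intro j hj h0
    have hj' : j < n + 1 := by omega
    have h1 := hUv ⟨j, hj'⟩
    simp only at h1
    rw [h0] at h1
    simp only [ratVar] at h1
    rw [← map_sum, ← map_zero (algebraMap (MvPolynomial (Fin (n + 1)) ℤ) _)] at h1
    have h2 := congrArg (MvPolynomial.eval (fun m : Fin (n + 1) => if m = ⟨j, hj'⟩ then (1 : ℤ)
      else 0)) (inj h1)
    simp at h2
  have key := aux_mem S n u l' hmem hne hUne
  obtain ⟨p, hp⟩ := key
  refine ⟨p, hp.trans ?_⟩
  rw [Finset.prod_range, Finset.sum_range, fayP]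
  congr 1
  · exact Finset.prod_congr rfl fun j _ => huv j
  · refine Finset.sum_congr rfl fun i _ => ?_
    rw [Finset.prod_range]
    refine Finset.prod_congr rfl fun j _ => ?_
    rw [hlv]
    congr 1
    unfold argAux fayArg
    rw [hUv, huv]
    have h4 : ¬ ((j : ℕ) + 1 < i) → ¬ ((j : ℕ) + 1 = i) → ¬ (j = i) →
        u ((j : ℕ) - 1) = ratVar (n + 1) ⟨(j : ℕ) - 1, by omega⟩ := fun _ _ _ =>
      huv ⟨(j : ℕ) - 1, by omega⟩
    split_ifs <;> first | rfl | simp_all [Fin.ext_iff]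

/-- The polynomial `u_1 ⋯ u_r P_l(u_1, …, u_r) ∈ ℤ[u_1, …, u_r]`. -/
def fayPoly {r : ℕ} (l : Fin r → ℕ) : MvPolynomial (Fin r) ℤ :=
  (exists_fayPoly l).choose

theorem algebraMap_fayPoly {r : ℕ} (l : Fin r → ℕ) :
    algebraMap (MvPolynomial (Fin r) ℤ) (FractionRing (MvPolynomial (Fin r) ℤ)) (fayPoly l)
      = (∏ j : Fin r, ratVar r j) * fayP l (ratVar r) :=
  (exists_fayPoly l).choose_spec

/-- The coefficient `c⟨l | k⟩` of `u_1^{k_1} ⋯ u_r^{k_r}` in `u_1 ⋯ u_r P_l(u_1, …, u_r)`. -/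
def fayCoeff {r : ℕ} (l k : Fin r → ℕ) : ℤ :=
  MvPolynomial.coeff (Finsupp.equivFunOnFinite.symm k) (fayPoly l)

end EMZV

end

/-!
The relations come from Fay's trisecant identity for `θ`, in the generating series `X F_τ(u X; z) =
∑ f^{(n)}(z) u^{n-1} X^n` of the kernels (`kernelSeries`). Numbers `I(l)` of weight `d` are read off
from the coefficient of `X^d` in the iterated integrals of products `∏ X F_τ(v_j X; z_j)` (`genInt`,
`coeff_genInt`).

**Fay's identity.** The product `θ(x + y) θ(x - y)` is a two-term bilinear expression in the parts
of the theta series with even and odd frequencies, at `x` and at `y` (`theta_add_mul_theta_sub`), so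
the three products in the trisecant identity are related by the Plücker relation for `2 × 2` minors
(`theta_fay`). Dividing by theta functions gives the identity for `F` (`kernelSeries_fay`).

**The truncated relation.** The sum `P_l` over `i` corresponds to inserting a new variable, one
position at a time, into the simplex `ε < z_1 < ⋯ < z_{r-1} < 1 - ε` (`fayInt`). The identity for
`F` makes the sum over the positions telescope, with convolutions over triangles (`psInt_conv`)
producing the terms of the next depth. The terms with poles at coinciding arguments disappear on
taking the difference of two values `u_r`, `u_r'` of the last variable, since the polar part of `X
F_τ(u X; z)` at the integers does not depend on `u` (`kernelDiff`). In this difference everything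
cancels except for increments of smooth functions over intervals of length `ε`, integrated against
kernels with simple poles; this is `O(ε^{1/2})` (`isBigO_fayInt_add_genInt_sub`). So the regularized
sum of `(P_l(u) + u^{l-1}) I(l)` over the `l` of weight `d` (`fayGen`) does not depend on `u_r`
(`fayGen_eq_of_eq_init`), and for `r = 1` it vanishes because `F` is odd and periodic
(`fayGen_depth_one`).

**Coefficients.** Multiplied by `u_1 ⋯ u_r`, the sum becomes a polynomial, and it is doubled when
`u_r` is; hence only monomials with `k_r = 1` occur in it (`coeff_eq_zero_of_rescale`). The
coefficient of `u^k` is `I(k) + ∑ c⟨l | k⟩ I(l)`, so this vanishes for `k_r ≠ 1`. Similarly,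
rescaling all variables by `2` shows that `c⟨l | k⟩ = 0` unless `l` and `k` have the same weight,
which gives the finiteness. The terms with zeta values all contain `δ_{1, k_r}`,
so they vanish for `r > 1`; for `r = 1` there are none.

**Existence of the regularized values.** The path from `ε` to `1 - ε` is composed of paths meeting
at `1/2` (`chenInt_comp`). Functions of the form `P(log ε) + O(ε^δ)` (`LogAsymp`) are stable under
products and under integration against forms with a simple pole at `0`, so that all truncated
integrals have the required expansion (`hasReg_truncInt`).
-/

open Filter Topology

noncomputable section

namespace EMZV

/-! ### The odd theta function -/

open Complex in
theorem theta_term_eq (τ z : ℂ) (n : ℤ) :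
    (-1 : ℂ) ^ n * cexp (2 * Real.pi * I * τ * (((n : ℂ) + 1 / 2) ^ 2 / 2)) *
      cexp (2 * Real.pi * I * z * ((n : ℂ) + 1 / 2))
    = cexp (Real.pi * I * τ / 4 + Real.pi * I * z) *
        jacobiTheta₂_term n (z + τ / 2 + 1 / 2) τ := by
  have h1 : (-1 : ℂ) ^ n = cexp (n * (Real.pi * I)) := by
    rw [exp_int_mul, exp_pi_mul_I]
  rw [h1, jacobiTheta₂_term, ← exp_add, ← exp_add, ← exp_add]
  congr 1
  ring

open Complex in
theorem theta_eq_jacobiTheta₂ (τ z : ℂ) :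
    theta τ z = cexp (Real.pi * I * τ / 4 + Real.pi * I * z) *
      jacobiTheta₂ (z + τ / 2 + 1 / 2) τ := by
  rw [theta, jacobiTheta₂, ← tsum_mul_left]
  exact tsum_congr fun n => theta_term_eq τ z n

theorem differentiable_theta {τ : ℂ} (hτ : 0 < τ.im) : Differentiable ℂ (theta τ) := by
  have : theta τ = fun z => Complex.exp (Real.pi * Complex.I * τ / 4 + Real.pi * Complex.I * z) *
      jacobiTheta₂ (z + τ / 2 + 1 / 2) τ := funext fun z => theta_eq_jacobiTheta₂ τ z
  rw [this]
  intro z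
  refine DifferentiableAt.mul (by fun_prop) ?_
  exact (differentiableAt_jacobiTheta₂_fst (z + τ / 2 + 1 / 2) hτ).comp z
    (f := fun z => z + τ / 2 + 1 / 2) (by fun_prop)

open Complex in
theorem theta_add_one (τ z : ℂ) : theta τ (z + 1) = -theta τ z := by
  rw [theta_eq_jacobiTheta₂, theta_eq_jacobiTheta₂,
    show z + 1 + τ / 2 + 1 / 2 = z + τ / 2 + 1 / 2 + 1 by ring, jacobiTheta₂_add_left,
    show Real.pi * I * τ / 4 + Real.pi * I * (z + 1)
      = Real.pi * I * τ / 4 + Real.pi * I * z + Real.pi * I by ring, exp_add _ (Real.pi * I),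
    exp_pi_mul_I]
  ring

open Complex in
theorem theta_add_tau (τ z : ℂ) :
    theta τ (z + τ) = -cexp (-(Real.pi * I * τ) - 2 * Real.pi * I * z) * theta τ z := by
  have h2 : -cexp (-(Real.pi * I * τ) - 2 * Real.pi * I * z)
      = cexp (-(Real.pi * I * τ) - 2 * Real.pi * I * z - Real.pi * I) := by
    rw [exp_sub _ (Real.pi * I), exp_pi_mul_I]; ring
  rw [theta_eq_jacobiTheta₂, theta_eq_jacobiTheta₂, h2,
    show z + τ + τ / 2 + 1 / 2 = z + τ / 2 + 1 / 2 + τ by ring, jacobiTheta₂_add_left',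
    ← mul_assoc, ← mul_assoc, ← exp_add, ← exp_add]
  congr 2
  ring

open Complex in
theorem theta_neg (τ z : ℂ) : theta τ (-z) = -theta τ z := by
  have h := jacobiTheta₂_neg_left (z - τ / 2 + 1 / 2) τ
  have h' := jacobiTheta₂_add_left' (z - τ / 2 + 1 / 2) τ
  rw [show z - τ / 2 + 1 / 2 + τ = z + τ / 2 + 1 / 2 by ring] at h'
  have h'' := jacobiTheta₂_add_left (-(z - τ / 2 + 1 / 2)) τ
  rw [theta_eq_jacobiTheta₂, theta_eq_jacobiTheta₂, h',
    show -z + τ / 2 + 1 / 2 = -(z - τ / 2 + 1 / 2) + 1 by ring, h'', h]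
  have h2 : ∀ w, -(cexp w) = cexp (w + Real.pi * I) := fun w => by
    rw [exp_add _ (Real.pi * I), exp_pi_mul_I]; ring
  rw [← mul_assoc, ← exp_add, ← neg_mul, h2]
  congr 2
  ring

theorem theta_zero (τ : ℂ) : theta τ 0 = 0 := by
  have := theta_neg τ 0
  rw [neg_zero] at this
  linear_combination (1 / 2) * this

/-- The part of the theta series at `2τ` with even frequencies,
`∑_{s even} q^{s² / 4} e^{2πisx}`. -/
def thetaEven (τ x : ℂ) : ℂ := jacobiTheta₂ (2 * x) (2 * τ)

/-- The part of the theta series at `2τ` with odd frequencies,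
`∑_{s odd} q^{s² / 4} e^{2πisx}`. -/
def thetaOdd (τ x : ℂ) : ℂ :=
  Complex.exp (Real.pi * Complex.I * τ / 2 + 2 * Real.pi * Complex.I * x) *
    jacobiTheta₂ (2 * x + τ) (2 * τ)

/-- Substituting `s = m + n + 1` and `d = m - n` in the double series of `θ(x + y) θ(x - y)`
decouples `x` from `y`; as `s` and `d` have opposite parity, this leaves two products. -/
theorem theta_add_mul_theta_sub {τ : ℂ} (hτ : 0 < τ.im) (x y : ℂ) :
    theta τ (x + y) * theta τ (x - y)
      = thetaOdd τ x * thetaEven τ y - thetaEven τ x * thetaOdd τ y := by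
  have h2τ : 0 < (2 * τ).im := by simpa using hτ
  set a : ℂ → ℤ → ℂ := fun z n =>
    Complex.exp (Real.pi * Complex.I * τ / 4 + Real.pi * Complex.I * z)
      * jacobiTheta₂_term n (z + τ / 2 + 1 / 2) τ with ha
  set e : ℂ → ℤ → ℂ := fun z n => jacobiTheta₂_term n (2 * z) (2 * τ) with he
  set o : ℂ → ℤ → ℂ := fun z n =>
    Complex.exp (Real.pi * Complex.I * τ / 2 + 2 * Real.pi * Complex.I * z)
      * jacobiTheta₂_term n (2 * z + τ) (2 * τ) with ho
  have sa : ∀ z, HasSum (a z) (theta τ z) := fun z => by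
    rw [theta_eq_jacobiTheta₂]
    exact (hasSum_jacobiTheta₂_term _ hτ).mul_left _
  have se : ∀ z, HasSum (e z) (thetaEven τ z) := fun z => hasSum_jacobiTheta₂_term _ h2τ
  have so : ∀ z, HasSum (o z) (thetaOdd τ z) := fun z =>
    (hasSum_jacobiTheta₂_term _ h2τ).mul_left _
  have prod : ∀ {f g : ℤ → ℂ} {s t : ℂ}, HasSum f s → HasSum g t →
      HasSum (fun p : ℤ × ℤ => f p.1 * g p.2) (s * t) := fun hf hg =>
    hf.mul hg (summable_mul_of_summable_norm hf.summable.norm hg.summable.norm)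
  have h1 := prod (so x) (se y)
  have h2 := (prod (se x) (so y)).neg
  have h0 := prod (sa (x + y)) (sa (x - y))
  set e1 : ℤ × ℤ → ℤ × ℤ := fun p => (p.1 + p.2, p.1 - p.2) with he1
  set e2 : ℤ × ℤ → ℤ × ℤ := fun p => (p.1 + p.2, p.1 - p.2 - 1) with he2
  have i1 : Function.Injective e1 := by
    intro p q h
    simp only [he1, Prod.mk.injEq] at h
    ext <;> omega
  have i2 : Function.Injective e2 := by
    intro p q h
    simp only [he2, Prod.mk.injEq] at h
    ext <;> omega
  have hc : IsCompl (Set.range e1) (Set.range e2) := by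
    constructor
    · rw [Set.disjoint_left]
      rintro _ ⟨p, rfl⟩ ⟨q, hq⟩
      simp only [he1, he2, Prod.mk.injEq] at hq
      omega
    · rw [codisjoint_iff_le_sup]
      rintro ⟨m, n⟩ _
      rcases Int.even_or_odd (m - n) with ⟨j, hj⟩ | ⟨j, hj⟩
      · exact Or.inl ⟨(n + j, j), by simp only [he1, Prod.mk.injEq]; omega⟩
      · exact Or.inr ⟨(n + j + 1, j), by simp only [he2, Prod.mk.injEq]; omega⟩
  have t1 : (fun p : ℤ × ℤ => o x p.1 * e y p.2)
      = (fun p : ℤ × ℤ => a (x + y) p.1 * a (x - y) p.2) ∘ e1 := by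
    funext p
    simp only [ha, he, ho, he1, Function.comp, jacobiTheta₂_term, ← Complex.exp_add]
    rw [Complex.exp_eq_exp_iff_exists_int]
    refine ⟨-p.1, ?_⟩
    push_cast
    ring
  have t2 : (fun p : ℤ × ℤ => -(e x p.1 * o y p.2))
      = (fun p : ℤ × ℤ => a (x + y) p.1 * a (x - y) p.2) ∘ e2 := by
    funext p
    have hneg : ∀ w : ℂ, -Complex.exp w = Complex.exp (w + Real.pi * Complex.I) := fun w => by
      rw [Complex.exp_add, Complex.exp_pi_mul_I]; ring
    simp only [ha, he, ho, he2, Function.comp, jacobiTheta₂_term, ← Complex.exp_add, hneg]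
    rw [Complex.exp_eq_exp_iff_exists_int]
    refine ⟨1 - p.1, ?_⟩
    push_cast
    ring
  rw [t1] at h1
  rw [t2] at h2
  have h3 := HasSum.add_isCompl (f := fun p : ℤ × ℤ => a (x + y) p.1 * a (x - y) p.2) hc
    (i1.hasSum_range_iff.2 h1) (i2.hasSum_range_iff.2 h2)
  rw [sub_eq_add_neg]
  exact h0.unique h3

/-- Fay's trisecant identity for `θ`: by `theta_add_mul_theta_sub` the product `θ(x + y) θ(x - y)`
is a `2 × 2` determinant in `x` and `y`, so this is a Plücker relation. -/
theorem theta_fay {τ : ℂ} (hτ : 0 < τ.im) (x y a b : ℂ) :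
    theta τ (x + a) * theta τ (y + b) * theta τ (x - y) * theta τ (a + b)
      = theta τ (x - y + a) * theta τ (y + (a + b)) * theta τ x * theta τ b
        - theta τ (y - x + b) * theta τ (x + (a + b)) * theta τ y * theta τ a := by
  have hb := theta_add_mul_theta_sub hτ
  -- the four points at which the six minors of the Plücker relation are taken
  set X := (x + y + a + b) / 2 with hX
  set Y := (x - y + a - b) / 2 with hY
  set U := (x - y + a + b) / 2 with hU
  set V := (x - y - a - b) / 2 with hV
  have h1 := hb X Y
  have h2 := hb U V
  have h3 := hb X U
  have h4 := hb Y V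
  have h5 := hb X V
  have h6 := hb Y U
  rw [show X + Y = x + a by rw [hX, hY]; ring, show X - Y = y + b by rw [hX, hY]; ring] at h1
  rw [show U + V = x - y by rw [hU, hV]; ring, show U - V = a + b by rw [hU, hV]; ring] at h2
  rw [show X + U = x + (a + b) by rw [hX, hU]; ring, show X - U = y by rw [hX, hU]; ring] at h3
  rw [show Y + V = -(y - x + b) by rw [hY, hV]; ring, show Y - V = a by rw [hY, hV]; ring,
    theta_neg] at h4
  rw [show X + V = x by rw [hX, hV]; ring, show X - V = y + (a + b) by rw [hX, hV]; ring] at h5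
  rw [show Y + U = x - y + a by rw [hY, hU]; ring, show Y - U = -b by rw [hY, hU]; ring,
    theta_neg] at h6
  have e1 : theta τ (x + a) * theta τ (y + b) * theta τ (x - y) * theta τ (a + b)
    = (theta τ (x + a) * theta τ (y + b)) * (theta τ (x - y) * theta τ (a + b)) := by ring
  have e2 : theta τ (x - y + a) * theta τ (y + (a + b)) * theta τ x * theta τ b
    = -((theta τ x * theta τ (y + (a + b))) * (theta τ (x - y + a) * -theta τ b)) := by ring
  have e3 : theta τ (y - x + b) * theta τ (x + (a + b)) * theta τ y * theta τ a
    = -((theta τ (x + (a + b)) * theta τ y) * (-theta τ (y - x + b) * theta τ a)) := by ring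
  rw [e1, e2, e3, h1, h2, h3, h4, h5, h6]
  ring

/-! ### Real zeros of the theta function -/

/-- The constant Fourier coefficient of the theta series is `1`. -/
theorem exists_jacobiTheta₂_ne_zero {τ : ℂ} (hτ : 0 < τ.im) : ∃ z, jacobiTheta₂ z τ ≠ 0 := by
  by_contra! hz
  set c : ℤ → ℂ := fun n => Complex.exp (Real.pi * Complex.I * n ^ 2 * τ) with hc
  set f : ℤ → C(ℝ, ℂ) := fun n =>
    ⟨fun x => c n * Complex.exp (2 * Real.pi * Complex.I * n * x), by fun_prop⟩ with hf
  have hterm : ∀ n (x : ℝ), f n x = jacobiTheta₂_term n x τ := fun n x => by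
    simp only [hf, hc, ContinuousMap.coe_mk, jacobiTheta₂_term, ← Complex.exp_add]
    congr 1
    ring
  have hnorm : ∀ n (x : ℝ), ‖f n x‖ = ‖jacobiTheta₂_term n 0 τ‖ := fun n x => by
    rw [hterm, norm_jacobiTheta₂_term, norm_jacobiTheta₂_term]
    simp
  have hs : Summable fun n => ‖jacobiTheta₂_term n 0 τ‖ :=
    (hasSum_jacobiTheta₂_term 0 hτ).summable.norm
  have hsum : Summable fun n => ‖(f n).restrict (⟨Set.uIcc 0 1, isCompact_uIcc⟩ :
      TopologicalSpace.Compacts ℝ)‖ := by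
    refine Summable.of_nonneg_of_le (fun _ => norm_nonneg _) (fun n => ?_) hs
    rw [ContinuousMap.norm_le _ (norm_nonneg _)]
    intro x
    exact (hnorm n x).le
  have key := intervalIntegral.hasSum_intervalIntegral_of_summable_norm hsum
  have hzero : ∀ x : ℝ, ∑' n, f n x = 0 := fun x => by
    rw [← hz x, jacobiTheta₂]
    exact tsum_congr fun n => hterm n x
  simp only [hzero, intervalIntegral.integral_zero] at key
  have hint : ∀ n : ℤ, n ≠ 0 → ∫ x in (0 : ℝ)..1, f n x = 0 := by
    intro n hn
    have hne : (2 * Real.pi * Complex.I * n : ℂ) ≠ 0 := by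
      simp [hn, Real.pi_ne_zero]
    simp only [hf, ContinuousMap.coe_mk]
    rw [intervalIntegral.integral_const_mul, integral_exp_mul_complex hne]
    have : Complex.exp (2 * Real.pi * Complex.I * n * (1 : ℝ)) = 1 :=
      Complex.exp_eq_one_iff.2 ⟨n, by push_cast; ring⟩
    rw [this]
    simp
  have h1 := hasSum_single (f := fun n => ∫ x in (0 : ℝ)..1, f n x) 0 hint
  have h2 := key.unique h1
  simp [hf, hc] at h2

theorem exists_theta_ne_zero {τ : ℂ} (hτ : 0 < τ.im) : ∃ z, theta τ z ≠ 0 := by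
  obtain ⟨z, hz⟩ := exists_jacobiTheta₂_ne_zero hτ
  refine ⟨z - τ / 2 - 1 / 2, ?_⟩
  rw [theta_eq_jacobiTheta₂]
  exact mul_ne_zero (Complex.exp_ne_zero _) (by ring_nf; exact hz)

theorem eventually_ne_zero_of_differentiable {f : ℂ → ℂ} (hf : Differentiable ℂ f)
    (h : ∃ z, f z ≠ 0) (z₀ : ℂ) : ∀ᶠ z in 𝓝[≠] z₀, f z ≠ 0 := by
  have han : AnalyticOnNhd ℂ f Set.univ := fun z _ => hf.analyticAt z
  rcases (hf.analyticAt z₀).eventually_eq_zero_or_eventually_ne_zero with h0 | h0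
  · obtain ⟨z, hz⟩ := h
    exact absurd (han.eqOn_zero_of_preconnected_of_eventuallyEq_zero isPreconnected_univ
      (Set.mem_univ z₀) h0 (Set.mem_univ z)) hz
  · exact h0

/-- If two entire functions have vanishing Wronskian, then they are proportional. -/
theorem eq_const_mul_of_wronskian_eq_zero {f g : ℂ → ℂ} (hf : Differentiable ℂ f)
    (hg : Differentiable ℂ g) (h : ∀ z, deriv f z * g z = f z * deriv g z) (z₀ : ℂ)
    (hz₀ : g z₀ ≠ 0) (z : ℂ) : f z = f z₀ / g z₀ * g z := by
  have hU : IsOpen {z | g z ≠ 0} := isOpen_ne_fun hg.continuous continuous_const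
  obtain ⟨δ, hδ, hb⟩ := Metric.isOpen_iff.1 hU z₀ hz₀
  have hconst : ∀ w ∈ Metric.ball z₀ δ, f w / g w = f z₀ / g z₀ := by
    intro w hw
    refine (convex_ball z₀ δ).is_const_of_fderivWithin_eq_zero (𝕜 := ℂ) (f := fun w => f w / g w)
      (fun x hx => ((hf x).div (hg x) (hb hx)).differentiableWithinAt) (fun x hx => ?_) hw
      (Metric.mem_ball_self hδ)
    have hd : HasDerivAt (fun w => f w / g w) 0 x := by
      have := (hf x).hasDerivAt.div (hg x).hasDerivAt (hb hx)
      rw [h x, sub_self, zero_div] at this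
      exact this
    rw [fderivWithin_of_isOpen Metric.isOpen_ball hx, hd.hasFDerivAt.fderiv]
    ext
    simp
  have h1 : AnalyticOnNhd ℂ f Set.univ := fun z _ => hf.analyticAt z
  have h2 : AnalyticOnNhd ℂ (fun z => f z₀ / g z₀ * g z) Set.univ := fun z _ =>
    (hg.const_mul _).analyticAt z
  have := h1.eqOn_of_preconnected_of_eventuallyEq h2 isPreconnected_univ (Set.mem_univ z₀) (by
    filter_upwards [Metric.ball_mem_nhds z₀ hδ] with w hw
    rw [← hconst w hw, div_mul_cancel₀ _ (hb hw)])
  exact this (Set.mem_univ z)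

/-- If `θ'(0)` vanished, then differentiating `theta_add_mul_theta_sub` on the diagonal would show
that the even and the odd part have vanishing Wronskian; being proportional and of different parity
of frequencies, the odd part would be zero. -/
theorem deriv_theta_zero_ne_zero {τ : ℂ} (hτ : 0 < τ.im) : deriv (theta τ) 0 ≠ 0 := by
  intro h0
  have h2τ : 0 < (2 * τ).im := by simpa using hτ
  have hj : ∀ w, DifferentiableAt ℂ (fun z => jacobiTheta₂ z (2 * τ)) w := fun w =>
    differentiableAt_jacobiTheta₂_fst w h2τ
  have hE : Differentiable ℂ (thetaEven τ) := fun x =>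
    (hj (2 * x)).comp x (f := fun x => 2 * x) (by fun_prop)
  have hO : Differentiable ℂ (thetaOdd τ) := fun x =>
    DifferentiableAt.mul (by fun_prop)
      ((hj (2 * x + τ)).comp x (f := fun x => 2 * x + τ) (by fun_prop))
  have hth := differentiable_theta hτ
  have hw : ∀ x, deriv (thetaOdd τ) x * thetaEven τ x = thetaOdd τ x * deriv (thetaEven τ) x := by
    intro x
    have d1 : HasDerivAt (fun z => theta τ (z + x) * theta τ (z - x))
        (deriv (theta τ) (x + x) * theta τ (x - x) + theta τ (x + x) * deriv (theta τ) (x - x)) x :=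
      ((hth (x + x)).hasDerivAt.comp_add_const x x).mul
        ((hth (x - x)).hasDerivAt.comp_sub_const x x)
    have d2 : HasDerivAt (fun z => thetaOdd τ z * thetaEven τ x - thetaEven τ z * thetaOdd τ x)
        (deriv (thetaOdd τ) x * thetaEven τ x - deriv (thetaEven τ) x * thetaOdd τ x) x :=
      ((hO x).hasDerivAt.mul_const _).sub ((hE x).hasDerivAt.mul_const _)
    rw [← funext fun z => theta_add_mul_theta_sub hτ z x] at d2
    have := d1.unique d2
    rw [sub_self, theta_zero, h0] at this
    linear_combination -this
  obtain ⟨z, hz⟩ := exists_jacobiTheta₂_ne_zero h2τ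
  have hE0 : thetaEven τ (z / 2) ≠ 0 := by
    rw [thetaEven, mul_div_cancel₀ _ two_ne_zero]; exact hz
  have hprop := eq_const_mul_of_wronskian_eq_zero hO hE hw (z / 2) hE0
  set c := thetaOdd τ (z / 2) / thetaEven τ (z / 2)
  -- a translation by `1 / 2` fixes the even part and changes the sign of the odd part
  have hEp : ∀ x, thetaEven τ (x + 1 / 2) = thetaEven τ x := fun x => by
    rw [thetaEven, thetaEven, ← jacobiTheta₂_add_left (2 * x)]
    ring_nf
  have hOp : ∀ x, thetaOdd τ (x + 1 / 2) = -thetaOdd τ x := fun x => by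
    rw [thetaOdd, thetaOdd, ← jacobiTheta₂_add_left (2 * x + τ),
      show Real.pi * Complex.I * τ / 2 + 2 * Real.pi * Complex.I * (x + 1 / 2)
      = Real.pi * Complex.I * τ / 2 + 2 * Real.pi * Complex.I * x + Real.pi * Complex.I by ring,
      Complex.exp_add _ (Real.pi * Complex.I), Complex.exp_pi_mul_I]
    ring_nf
  have hO0 : ∀ x, thetaOdd τ x = 0 := fun x => by
    have h1 := hprop (x + 1 / 2)
    rw [hEp, hOp, ← hprop x] at h1
    linear_combination (-1 / 2 : ℂ) * h1
  have h1 := hO0 ((z - τ) / 2)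
  rw [thetaOdd, show 2 * ((z - τ) / 2) + τ = z by ring] at h1
  exact (mul_ne_zero (Complex.exp_ne_zero _) hz) h1

/-- If `θ(p) = 0`, then the trisecant identity makes the logarithmic derivative of
`θ(z + p) / θ(z)` constant, so `θ(z + p) = C e^{μz} θ(z)`; comparing the behaviour of both sides
under `z ↦ z + 1` and `z ↦ z + τ` leaves only integers among the real numbers `p`. -/
theorem theta_ofReal_eq_zero_iff {τ : ℂ} (hτ : 0 < τ.im) (p : ℝ) :
    theta τ p = 0 ↔ ∃ n : ℤ, p = n := by
  have hth := differentiable_theta hτ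
  constructor
  swap
  · rintro ⟨n, rfl⟩
    have hstep : ∀ z, theta τ (z + 1) = 0 ↔ theta τ z = 0 := fun z => by
      rw [theta_add_one, neg_eq_zero]
    induction n with
    | zero => simpa using theta_zero τ
    | succ n ih => push_cast at ih ⊢; rw [hstep]; exact ih
    | pred n ih =>
      push_cast at ih ⊢
      rw [← hstep]
      simpa using ih
  intro hp
  set k : ℂ → ℂ := fun z => theta τ (z + p) with hk
  have hkd : Differentiable ℂ k := hth.comp (differentiable_id.add_const _)
  have hkder : ∀ z, HasDerivAt k (deriv (theta τ) (z + p)) z := fun z =>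
    (hth (z + p)).hasDerivAt.comp_add_const z p
  obtain ⟨w, hw⟩ := exists_theta_ne_zero hτ
  have hkne : ∃ z, k z ≠ 0 := ⟨w - p, by simpa [hk] using hw⟩
  obtain ⟨z₀, h1, h2⟩ := ((eventually_ne_zero_of_differentiable hth ⟨w, hw⟩ 0).and
    (eventually_ne_zero_of_differentiable hkd hkne 0)).exists
  -- for `a = p` the last term of the trisecant identity vanishes
  have hfay : ∀ x b y, k x * k b * (theta τ (x - y) * theta τ (b + y))
      = theta τ x * theta τ b * (k (x - y) * k (b + y)) := by
    intro x b y
    have h := theta_fay hτ x y p b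
    rw [hp] at h
    have e1 : (p : ℂ) + b = b + p := add_comm _ _
    have e2 : y + (b + p : ℂ) = b + y + p := by ring
    rw [e1, e2, add_comm y b] at h
    simp only [hk]
    linear_combination h
  -- the derivative of `hfay` at `y = 0`
  have hW : ∀ x b, k x * k b * (theta τ x * deriv (theta τ) b - deriv (theta τ) x * theta τ b)
      = theta τ x * theta τ b * (k x * deriv k b - deriv k x * k b) := by
    intro x b
    have aux : ∀ f : ℂ → ℂ, Differentiable ℂ f →
        HasDerivAt (fun y => f (x - y) * f (b + y)) (f x * deriv f b - deriv f x * f b) 0 := by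
      intro f hf
      have d1 : HasDerivAt (fun y => f (x - y)) (-deriv f (x - 0)) 0 :=
        (hf (x - 0)).hasDerivAt.comp_const_sub x 0
      have d2 : HasDerivAt (fun y => f (b + y)) (deriv f (b + 0)) 0 :=
        (hf (b + 0)).hasDerivAt.comp_const_add b 0
      have := d1.mul d2
      simp only [sub_zero, add_zero] at this
      exact this.congr_deriv (by ring)
    have d1 := (aux _ hth).const_mul (k x * k b)
    have d2 := (aux _ hkd).const_mul (theta τ x * theta τ b)
    rw [← funext fun y => hfay x b y] at d2
    exact d1.unique d2
  set μ := (deriv k z₀ * theta τ z₀ - k z₀ * deriv (theta τ) z₀) / (k z₀ * theta τ z₀) with hμ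
  have hode : ∀ z, deriv k z * theta τ z - k z * deriv (theta τ) z = μ * (k z * theta τ z) := by
    intro z
    have := hW z z₀
    rw [hμ]
    field_simp
    linear_combination this
  set g : ℂ → ℂ := fun z => Complex.exp (μ * z) * theta τ z with hg
  have hexp : ∀ z, HasDerivAt (fun z => Complex.exp (μ * z)) (Complex.exp (μ * z) * μ) z := fun z =>
    by simpa using ((hasDerivAt_id z).const_mul μ).cexp
  have hgder : ∀ z, HasDerivAt g (Complex.exp (μ * z) * μ * theta τ z
      + Complex.exp (μ * z) * deriv (theta τ) z) z := fun z => (hexp z).mul (hth z).hasDerivAt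
  have hgd : Differentiable ℂ g := fun z => (hgder z).differentiableAt
  have hprop := eq_const_mul_of_wronskian_eq_zero hkd hgd (fun z => by
    rw [(hgder z).deriv]
    simp only [hg]
    linear_combination Complex.exp (μ * z) * hode z) z₀ (mul_ne_zero (Complex.exp_ne_zero _) h1)
  set C := k z₀ / g z₀ with hC
  have hper1 : Complex.exp μ = 1 := by
    have a1 := hprop (z₀ + 1)
    have a2 : k (z₀ + 1) = -k z₀ := by
      simp only [hk]
      rw [← theta_add_one]
      ring_nf
    have a3 : g (z₀ + 1) = -(Complex.exp μ * g z₀) := by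
      simp only [hg]
      rw [theta_add_one, mul_add, Complex.exp_add, mul_one]
      ring
    have a4 := hprop z₀
    rw [a2, a3] at a1
    have : k z₀ * (Complex.exp μ - 1) = 0 := by linear_combination a1 + Complex.exp μ * a4
    exact sub_eq_zero.1 ((mul_eq_zero.1 this).resolve_left h2)
  have hpert : Complex.exp (μ * τ) = Complex.exp (-(2 * Real.pi * Complex.I * p)) := by
    have a1 := hprop (z₀ + τ)
    set q := -Complex.exp (-(Real.pi * Complex.I * τ) - 2 * Real.pi * Complex.I * z₀) with hq
    have a2 : k (z₀ + τ) = Complex.exp (-(2 * Real.pi * Complex.I * p)) * (q * k z₀) := by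
      simp only [hk]
      rw [show z₀ + τ + p = z₀ + p + τ by ring, theta_add_tau, hq,
        show -(Real.pi * Complex.I * τ) - 2 * Real.pi * Complex.I * (z₀ + p)
        = -(2 * Real.pi * Complex.I * p) + (-(Real.pi * Complex.I * τ)
          - 2 * Real.pi * Complex.I * z₀) by ring, Complex.exp_add]
      ring
    have a3 : g (z₀ + τ) = Complex.exp (μ * τ) * (q * g z₀) := by
      simp only [hg]
      rw [theta_add_tau, mul_add, Complex.exp_add, hq]
      ring
    have a4 := hprop z₀
    have hq0 : q ≠ 0 := neg_ne_zero.2 (Complex.exp_ne_zero _)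
    rw [a2, a3] at a1
    have : q * k z₀ * (Complex.exp (μ * τ) - Complex.exp (-(2 * Real.pi * Complex.I * p))) = 0 := by
      linear_combination -a1 + Complex.exp (μ * τ) * q * a4
    exact sub_eq_zero.1 ((mul_eq_zero.1 this).resolve_left (mul_ne_zero hq0 h2))
  -- `μ = 2πiN`; as `p` is real, comparing absolute values in `hpert` gives `N = 0`
  obtain ⟨N, hN⟩ := Complex.exp_eq_one_iff.1 hper1
  have hN0 : N = 0 := by
    have := congrArg norm hpert
    rw [Complex.norm_exp, Complex.norm_exp, hN] at this
    simp at this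
    rcases this with h | h
    · exact h
    · exact absurd h hτ.ne'
  rw [hN, hN0] at hpert
  simp only [Int.cast_zero, zero_mul, Complex.exp_zero] at hpert
  obtain ⟨m, hm⟩ := Complex.exp_eq_one_iff.1 hpert.symm
  refine ⟨-m, ?_⟩
  have h2pi : (2 * Real.pi * Complex.I : ℂ) ≠ 0 := by simp [Real.pi_ne_zero]
  have : (p : ℂ) = -m := by
    apply mul_left_cancel₀ h2pi
    linear_combination -hm
  exact_mod_cast this

/-! ### Taylor series as formal power series -/

/-- The Taylor series at `0`, as a formal power series. -/
def taylorSeries (f : ℂ → ℂ) : PowerSeries ℂ :=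
  PowerSeries.mk fun n => iteratedDeriv n f 0 / (n.factorial : ℂ)

theorem coeff_taylorSeries (f : ℂ → ℂ) (n : ℕ) :
    PowerSeries.coeff n (taylorSeries f) = iteratedDeriv n f 0 / (n.factorial : ℂ) :=
  PowerSeries.coeff_mk _ _

theorem taylorSeries_congr {f g : ℂ → ℂ} (h : f =ᶠ[𝓝 0] g) : taylorSeries f = taylorSeries g := by
  ext n
  rw [coeff_taylorSeries, coeff_taylorSeries, h.iteratedDeriv_eq]

theorem taylorSeries_mul {f g : ℂ → ℂ} (hf : AnalyticAt ℂ f 0) (hg : AnalyticAt ℂ g 0) :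
    taylorSeries (fun z => f z * g z) = taylorSeries f * taylorSeries g := by
  ext n
  rw [coeff_taylorSeries, PowerSeries.coeff_mul, Finset.Nat.sum_antidiagonal_eq_sum_range_succ_mk,
    iteratedDeriv_fun_mul hf.contDiffAt hg.contDiffAt, Finset.sum_div]
  refine Finset.sum_congr rfl fun i hi => ?_
  have hi' : i ≤ n := Nat.lt_succ_iff.1 (Finset.mem_range.1 hi)
  simp only [coeff_taylorSeries]
  rw [Nat.cast_choose ℂ hi']
  have h1 : (n.factorial : ℂ) ≠ 0 := Nat.cast_ne_zero.2 n.factorial_ne_zero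
  field_simp

theorem taylorSeries_const_mul (c : ℂ) (f : ℂ → ℂ) :
    taylorSeries (fun z => c * f z) = PowerSeries.C c * taylorSeries f := by
  ext n
  rw [PowerSeries.coeff_C_mul, coeff_taylorSeries, coeff_taylorSeries,
    iteratedDeriv_const_mul_field, mul_div_assoc]

theorem taylorSeries_sub {f g : ℂ → ℂ} (hf : AnalyticAt ℂ f 0) (hg : AnalyticAt ℂ g 0) :
    taylorSeries (fun z => f z - g z) = taylorSeries f - taylorSeries g := by
  ext n
  rw [map_sub, coeff_taylorSeries, coeff_taylorSeries, coeff_taylorSeries,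
    iteratedDeriv_fun_sub hf.contDiffAt hg.contDiffAt, sub_div]

theorem taylorSeries_comp_mul_left {f : ℂ → ℂ} (hf : Differentiable ℂ f) (a : ℂ) :
    taylorSeries (fun z => f (a * z)) = PowerSeries.rescale a (taylorSeries f) := by
  ext n
  rw [PowerSeries.coeff_rescale, coeff_taylorSeries, coeff_taylorSeries,
    iteratedDeriv_comp_const_mul hf.contDiff]
  simp only [mul_zero, mul_div_assoc]

theorem taylorSeries_id : taylorSeries (fun z => z) = PowerSeries.X := by
  ext n
  rw [coeff_taylorSeries, iteratedDeriv_fun_id_zero, PowerSeries.coeff_X]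
  split_ifs with h
  · simp [h]
  · simp

/-! ### The Laurent coefficients of the Eisenstein-Kronecker series -/

/-- The function `α ↦ α θ'(0) / θ(α)`, which is analytic at `0`. -/
def thetaRecip (τ α : ℂ) : ℂ := deriv (theta τ) 0 / dslope (theta τ) 0 α

/-- The function `θ(z) f^{(n)}(z)`, which is entire in `z`. -/
def kernelNum (τ : ℂ) (n : ℕ) (z : ℂ) : ℂ :=
  PowerSeries.coeff n (taylorSeries (fun α => theta τ (z + α)) * taylorSeries (thetaRecip τ))

/-- The function `z f^{(n)}(z)`, extended to `z = 0`. -/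
def kernelRes (τ : ℂ) (n : ℕ) (z : ℂ) : ℂ := kernelNum τ n z / dslope (theta τ) 0 z

/-- The regular part of `f^{(n)}` at `0`. -/
def kernelReg (τ : ℂ) (n : ℕ) (z : ℂ) : ℂ := dslope (kernelRes τ n) 0 z

/-- The function `f^{(n)}`, extended by the value at `0` of its regular part to the zeros of `θ`.
For `n ≠ 1` this makes it analytic at the integers. -/
def kernelExt (τ : ℂ) (n : ℕ) (z : ℂ) : ℂ :=
  if theta τ z = 0 then kernelReg τ n 0 else kernelF τ n z

theorem dslope_theta_of_ne (τ : ℂ) {z : ℂ} (hz : z ≠ 0) :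
    dslope (theta τ) 0 z = theta τ z / z := by
  rw [dslope_of_ne _ hz, slope_def_field, theta_zero, sub_zero, sub_zero]

theorem mul_dslope_theta (τ z : ℂ) : z * dslope (theta τ) 0 z = theta τ z := by
  have := sub_smul_dslope (theta τ) 0 z
  simpa [theta_zero] using this

theorem dslope_theta_neg (τ z : ℂ) : dslope (theta τ) 0 (-z) = dslope (theta τ) 0 z := by
  rcases eq_or_ne z 0 with rfl | hz
  · rw [neg_zero]
  · rw [dslope_theta_of_ne τ hz, dslope_theta_of_ne τ (neg_ne_zero.2 hz), theta_neg, neg_div_neg_eq]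

theorem differentiable_dslope_theta {τ : ℂ} (hτ : 0 < τ.im) :
    Differentiable ℂ (dslope (theta τ) 0) :=
  differentiableOn_univ.1 ((Complex.differentiableOn_dslope univ_mem).2
    (differentiable_theta hτ).differentiableOn)

theorem dslope_theta_zero_ne_zero {τ : ℂ} (hτ : 0 < τ.im) : dslope (theta τ) 0 0 ≠ 0 := by
  rw [dslope_same]
  exact deriv_theta_zero_ne_zero hτ

theorem analyticAt_thetaRecip {τ : ℂ} (hτ : 0 < τ.im) : AnalyticAt ℂ (thetaRecip τ) 0 :=
  analyticAt_const.div ((differentiable_dslope_theta hτ).analyticAt 0)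
    (dslope_theta_zero_ne_zero hτ)

theorem analyticAt_theta_const_add {τ : ℂ} (hτ : 0 < τ.im) (z : ℂ) :
    AnalyticAt ℂ (fun α => theta τ (z + α)) 0 :=
  ((differentiable_theta hτ).comp ((differentiable_id).const_add z)).analyticAt 0

theorem taylorSeries_theta_mul_thetaRecip {τ : ℂ} (hτ : 0 < τ.im) :
    taylorSeries (fun α => theta τ (0 + α)) * taylorSeries (thetaRecip τ)
      = PowerSeries.C (deriv (theta τ) 0) * PowerSeries.X := by
  rw [← taylorSeries_mul (analyticAt_theta_const_add hτ 0) (analyticAt_thetaRecip hτ),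
    ← taylorSeries_id, ← taylorSeries_const_mul]
  refine taylorSeries_congr ?_
  filter_upwards [(differentiable_dslope_theta hτ).continuous.continuousAt.eventually_ne
    (dslope_theta_zero_ne_zero hτ)] with α hα
  rw [zero_add, thetaRecip, ← mul_dslope_theta]
  field_simp

theorem kernelNum_zero {τ : ℂ} (hτ : 0 < τ.im) (n : ℕ) :
    kernelNum τ n 0 = if n = 1 then deriv (theta τ) 0 else 0 := by
  rw [kernelNum, taylorSeries_theta_mul_thetaRecip hτ, PowerSeries.coeff_C_mul, PowerSeries.coeff_X]
  split_ifs <;> simp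

theorem differentiable_kernelNum {τ : ℂ} (hτ : 0 < τ.im) (n : ℕ) :
    Differentiable ℂ (kernelNum τ n) := by
  have h : kernelNum τ n = fun z => ∑ p ∈ Finset.HasAntidiagonal.antidiagonal n,
      iteratedDeriv p.1 (theta τ) z / (p.1.factorial : ℂ)
        * PowerSeries.coeff p.2 (taylorSeries (thetaRecip τ)) := by
    funext z
    rw [kernelNum, PowerSeries.coeff_mul]
    refine Finset.sum_congr rfl fun p _ => ?_
    rw [coeff_taylorSeries, iteratedDeriv_comp_const_add]
    simp only [add_zero]
  rw [h]
  have hd : ∀ i, Differentiable ℂ (iteratedDeriv i (theta τ)) := fun i =>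
    ((differentiable_theta hτ).contDiff (n := ⊤)).differentiable_iteratedDeriv i
      (by exact_mod_cast WithTop.coe_lt_top _)
  exact Differentiable.fun_sum fun p _ => ((hd p.1).div_const _).mul_const _

/-- Away from the zeros of `θ`, the function `α F_τ(α; z)` is `θ(z)⁻¹ θ(z + α) (α θ'(0) / θ(α))`,
also at `α = 0`. -/
theorem kroneckerReg_eq {τ : ℂ} (hτ : 0 < τ.im) {z : ℂ} (hz : theta τ z ≠ 0) :
    kroneckerReg τ z = fun α => (theta τ z)⁻¹ * (theta τ (z + α) * thetaRecip τ α) := by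
  have hne : ∀ α, α ≠ 0 → α * kroneckerF τ α z
      = (theta τ z)⁻¹ * (theta τ (z + α) * thetaRecip τ α) := by
    intro α hα
    rw [thetaRecip, dslope_theta_of_ne τ hα, kroneckerF, div_div_eq_mul_div]
    field_simp
  have hcont : ContinuousAt (fun α => (theta τ z)⁻¹ * (theta τ (z + α) * thetaRecip τ α)) 0 :=
    continuousAt_const.mul ((analyticAt_theta_const_add hτ z).continuousAt.mul
      (analyticAt_thetaRecip hτ).continuousAt)
  have hlim : Tendsto (fun α => α * kroneckerF τ α z) (𝓝[≠] (0 : ℂ))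
      (𝓝 ((theta τ z)⁻¹ * (theta τ (z + 0) * thetaRecip τ 0))) := by
    refine (hcont.tendsto.mono_left nhdsWithin_le_nhds).congr' ?_
    filter_upwards [self_mem_nhdsWithin] with α hα
    exact (hne α hα).symm
  funext α
  rcases eq_or_ne α 0 with rfl | hα
  · rw [kroneckerReg, Function.update_self, hlim.limUnder_eq]
  · rw [kroneckerReg, Function.update_of_ne hα, hne α hα]

theorem mk_kernelF {τ : ℂ} (hτ : 0 < τ.im) {z : ℂ} (hz : theta τ z ≠ 0) :
    PowerSeries.mk (fun n => kernelF τ n z)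
      = PowerSeries.C (theta τ z)⁻¹ *
        (taylorSeries (fun α => theta τ (z + α)) * taylorSeries (thetaRecip τ)) := by
  rw [← taylorSeries_mul (analyticAt_theta_const_add hτ z) (analyticAt_thetaRecip hτ),
    ← taylorSeries_const_mul, ← kroneckerReg_eq hτ hz]
  rfl

theorem kernelF_eq_div {τ : ℂ} (hτ : 0 < τ.im) {z : ℂ} (hz : theta τ z ≠ 0) (n : ℕ) :
    kernelF τ n z = kernelNum τ n z / theta τ z := by
  have := congrArg (PowerSeries.coeff n) (mk_kernelF hτ hz)
  rw [PowerSeries.coeff_mk, PowerSeries.coeff_C_mul] at this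
  rw [this, kernelNum, div_eq_inv_mul]

theorem kernelF_add_one (τ : ℂ) (n : ℕ) (z : ℂ) : kernelF τ n (z + 1) = kernelF τ n z := by
  have h : ∀ α, kroneckerF τ α (z + 1) = kroneckerF τ α z := fun α => by
    rw [kroneckerF, kroneckerF, add_right_comm, theta_add_one, theta_add_one, neg_mul, neg_mul,
      neg_div_neg_eq]
  simp only [kernelF, kroneckerReg, h]

theorem kernelF_neg {τ : ℂ} (hτ : 0 < τ.im) {z : ℂ} (hz : theta τ z ≠ 0) (n : ℕ) :
    kernelF τ n (-z) = (-1) ^ n * kernelF τ n z := by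
  have hz' : theta τ (-z) ≠ 0 := by rw [theta_neg]; exact neg_ne_zero.2 hz
  have h : kroneckerReg τ (-z) = fun α => kroneckerReg τ z (-α) := by
    rw [kroneckerReg_eq hτ hz, kroneckerReg_eq hτ hz']
    funext α
    simp only [thetaRecip, dslope_theta_neg]
    rw [show -z + α = -(z + -α) by ring, theta_neg,
      theta_neg, inv_neg]
    ring
  rw [kernelF, kernelF, h, iteratedDeriv_comp_neg, neg_zero, smul_eq_mul, mul_div_assoc]

/-! ### The kernels near the integers -/

theorem theta_ofReal_ne_zero {τ : ℂ} (hτ : 0 < τ.im) {x : ℝ} (h1 : -1 < x) (h2 : x < 1)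
    (h0 : x ≠ 0) : theta τ x ≠ 0 := by
  rw [Ne, theta_ofReal_eq_zero_iff hτ]
  rintro ⟨n, rfl⟩
  have a1 : -1 < n := by exact_mod_cast h1
  have a2 : n < 1 := by exact_mod_cast h2
  have : n = 0 := by omega
  simp [this] at h0

theorem isOpen_dslope_theta_ne_zero {τ : ℂ} (hτ : 0 < τ.im) :
    IsOpen {z | dslope (theta τ) 0 z ≠ 0} :=
  isOpen_ne_fun (differentiable_dslope_theta hτ).continuous continuous_const

theorem dslope_theta_ofReal_ne_zero {τ : ℂ} (hτ : 0 < τ.im) {x : ℝ} (h1 : -1 < x) (h2 : x < 1) :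
    dslope (theta τ) 0 (x : ℂ) ≠ 0 := by
  rcases eq_or_ne x 0 with rfl | h0
  · exact_mod_cast dslope_theta_zero_ne_zero hτ
  · have := theta_ofReal_ne_zero hτ h1 h2 h0
    rw [← mul_dslope_theta] at this
    exact right_ne_zero_of_mul this

theorem differentiableOn_kernelReg {τ : ℂ} (hτ : 0 < τ.im) (n : ℕ) :
    DifferentiableOn ℂ (kernelReg τ n) {z | dslope (theta τ) 0 z ≠ 0} := by
  refine (Complex.differentiableOn_dslope ((isOpen_dslope_theta_ne_zero hτ).mem_nhds
    (dslope_theta_zero_ne_zero hτ))).2 fun z hz => ?_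
  exact ((differentiable_kernelNum hτ n z).div (differentiable_dslope_theta hτ z)
    hz).differentiableWithinAt

/-- At `z = 0` the function `f^{(n)}` has the polar part `1 / z` for `n = 1`, and none for
`n ≠ 1`. -/
theorem kernelF_eq_pole_add_kernelReg {τ : ℂ} (hτ : 0 < τ.im) (n : ℕ) {z : ℂ}
    (hz : theta τ z ≠ 0) : kernelF τ n z = (if n = 1 then 1 else 0) / z + kernelReg τ n z := by
  have h0 : z ≠ 0 := by
    rintro rfl
    exact hz (theta_zero τ)
  have hd : dslope (theta τ) 0 z ≠ 0 := by
    rw [← mul_dslope_theta] at hz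
    exact right_ne_zero_of_mul hz
  have hres : kernelRes τ n 0 = if n = 1 then 1 else 0 := by
    rw [kernelRes, kernelNum_zero hτ, dslope_same]
    split_ifs
    · exact div_self (deriv_theta_zero_ne_zero hτ)
    · exact zero_div _
  rw [kernelF_eq_div hτ hz, kernelReg, dslope_of_ne _ h0, slope_def_field, hres, sub_zero,
    kernelRes, ← mul_dslope_theta]
  field_simp
  ring

theorem kernelExt_add_one (τ : ℂ) (n : ℕ) (z : ℂ) : kernelExt τ n (z + 1) = kernelExt τ n z := by
  rw [kernelExt, kernelExt, kernelF_add_one]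
  simp only [theta_add_one, neg_eq_zero]

theorem kernelExt_add_int (τ : ℂ) (n : ℕ) (z : ℂ) (m : ℤ) :
    kernelExt τ n (z + m) = kernelExt τ n z := by
  induction m with
  | zero => simp
  | succ m ih => push_cast at ih ⊢; rw [← add_assoc, kernelExt_add_one, ih]
  | pred m ih =>
    push_cast at ih ⊢
    rw [← ih, ← kernelExt_add_one]
    ring_nf

theorem analyticAt_kernelExt {τ : ℂ} (hτ : 0 < τ.im) {n : ℕ} (hn : n ≠ 1) (x : ℝ) :
    AnalyticAt ℂ (kernelExt τ n) x := by
  have hth := differentiable_theta hτ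
  by_cases hx : theta τ x = 0
  · obtain ⟨m, hm⟩ := (theta_ofReal_eq_zero_iff hτ x).1 hx
    have h0 : AnalyticAt ℂ (kernelExt τ n) 0 := by
      have h1 : AnalyticAt ℂ (kernelReg τ n) 0 :=
        (differentiableOn_kernelReg hτ n).analyticAt
          ((isOpen_dslope_theta_ne_zero hτ).mem_nhds (dslope_theta_zero_ne_zero hτ))
      refine h1.congr ?_
      have h2 := eventually_ne_zero_of_differentiable hth (exists_theta_ne_zero hτ) 0
      rw [eventually_nhdsWithin_iff] at h2
      filter_upwards [h2] with z hz
      rcases eq_or_ne z 0 with rfl | hz0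
      · rw [kernelExt, if_pos (theta_zero τ)]
      · rw [kernelExt, if_neg (hz hz0), kernelF_eq_pole_add_kernelReg hτ n (hz hz0), if_neg hn,
          zero_div, zero_add]
    have h3 : kernelExt τ n = fun z => kernelExt τ n (z - m) := by
      funext z
      conv_lhs => rw [← sub_add_cancel z (m : ℂ), kernelExt_add_int]
    rw [h3]
    refine AnalyticAt.fun_comp (g := kernelExt τ n) ?_ (by fun_prop)
    rw [hm]
    simpa using h0
  · have h1 : AnalyticAt ℂ (fun z => kernelNum τ n z / theta τ z) x :=
      ((differentiable_kernelNum hτ n).analyticAt _).div (hth.analyticAt _) hx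
    refine h1.congr ?_
    filter_upwards [hth.continuous.continuousAt.eventually_ne hx] with z hz
    rw [kernelExt, if_neg hz, kernelF_eq_div hτ hz]

theorem contDiff_kernelExt {τ : ℂ} (hτ : 0 < τ.im) {n : ℕ} (hn : n ≠ 1) :
    ContDiff ℝ 1 (fun x : ℝ => kernelExt τ n x) := by
  rw [contDiff_iff_contDiffAt]
  intro x
  have h1 : ContDiffAt ℝ 1 (kernelExt τ n) (x : ℂ) :=
    (analyticAt_kernelExt hτ hn x).contDiffAt.restrict_scalars ℝ
  exact h1.comp x Complex.ofRealCLM.contDiff.contDiffAt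

theorem continuousOn_kernelF {τ : ℂ} (hτ : 0 < τ.im) (n : ℕ) :
    ContinuousOn (fun x : ℝ => kernelF τ n x) (Set.Ioo 0 1) := by
  have hne : ∀ x ∈ Set.Ioo (0 : ℝ) 1, theta τ x ≠ 0 := fun x hx =>
    theta_ofReal_ne_zero hτ (by linarith [hx.1]) hx.2 hx.1.ne'
  have h : ContinuousOn (fun x : ℝ => kernelNum τ n x / theta τ x) (Set.Ioo 0 1) :=
    ((differentiable_kernelNum hτ n).continuous.comp Complex.continuous_ofReal).continuousOn.div
      ((differentiable_theta hτ).continuous.comp Complex.continuous_ofReal).continuousOn hne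
  exact h.congr fun x hx => kernelF_eq_div hτ (hne x hx) n

/-- The regular part of `f^{(n)}` is bounded on `[0, 1/2]`. -/
theorem exists_norm_kernelReg_le {τ : ℂ} (hτ : 0 < τ.im) (n : ℕ) :
    ∃ M : ℝ, ∀ x ∈ Set.Icc (0 : ℝ) (1 / 2), ‖kernelReg τ n x‖ ≤ M := by
  refine isCompact_Icc.exists_bound_of_continuousOn ?_
  refine (differentiableOn_kernelReg hτ n).continuousOn.comp
    Complex.continuous_ofReal.continuousOn fun x hx => ?_
  exact dslope_theta_ofReal_ne_zero hτ (by linarith [hx.1]) (by linarith [hx.2])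

theorem kernelF_one_sub {τ : ℂ} (hτ : 0 < τ.im) (n : ℕ) {x : ℝ} (hx : x ∈ Set.Ioo (0 : ℝ) 1) :
    kernelF τ n ((1 - x : ℝ) : ℂ) = (-1) ^ n * kernelF τ n x := by
  have hz := theta_ofReal_ne_zero hτ (by linarith [hx.1]) hx.2 hx.1.ne'
  rw [← kernelF_neg hτ hz n, ← kernelF_add_one τ n (-(x : ℂ))]
  congr 1
  push_cast
  ring

/-! ### Generating series of the kernels -/

/-- The generating series `∑ f^{(n)}(z) u^{n - 1} X^n`; this is `X F_τ(u X; z)`. -/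
def kernelSeries (τ u z : ℂ) : PowerSeries ℂ :=
  PowerSeries.mk fun n => kernelF τ n z * u ^ ((n : ℤ) - 1)

theorem coeff_kernelSeries (τ u z : ℂ) (n : ℕ) :
    PowerSeries.coeff n (kernelSeries τ u z) = kernelF τ n z * u ^ ((n : ℤ) - 1) :=
  PowerSeries.coeff_mk _ _

theorem kernelSeries_eq {τ : ℂ} (hτ : 0 < τ.im) {u z : ℂ} (hu : u ≠ 0) (hz : theta τ z ≠ 0) :
    kernelSeries τ u z = PowerSeries.C (u⁻¹ * (theta τ z)⁻¹) *
      (PowerSeries.rescale u (taylorSeries fun α => theta τ (z + α)) *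
        PowerSeries.rescale u (taylorSeries (thetaRecip τ))) := by
  have h : kernelSeries τ u z
      = PowerSeries.C u⁻¹ * PowerSeries.rescale u (PowerSeries.mk fun n => kernelF τ n z) := by
    ext n
    rw [coeff_kernelSeries, PowerSeries.coeff_C_mul, PowerSeries.coeff_rescale,
      PowerSeries.coeff_mk, zpow_sub_one₀ hu, zpow_natCast]
    ring
  have hC : ∀ c : ℂ, PowerSeries.rescale u (PowerSeries.C c) = PowerSeries.C c := fun c => by
    ext n
    rw [PowerSeries.coeff_rescale, PowerSeries.coeff_C]
    split_ifs with hn <;> simp [hn]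
  rw [h, mk_kernelF hτ hz, map_mul, map_mul, hC, map_mul, mul_assoc]

theorem kernelSeries_neg_neg {τ : ℂ} (hτ : 0 < τ.im) {u z : ℂ} (hu : u ≠ 0)
    (hz : theta τ z ≠ 0) : kernelSeries τ (-u) (-z) = -kernelSeries τ u z := by
  ext n
  rw [map_neg, coeff_kernelSeries, coeff_kernelSeries, kernelF_neg hτ hz, zpow_sub_one₀ hu,
    zpow_sub_one₀ (neg_ne_zero.2 hu), zpow_natCast, zpow_natCast, neg_pow u, inv_neg]
  have : ((-1 : ℂ) ^ n) * (-1) ^ n = 1 := by rw [← mul_pow]; simp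
  linear_combination (-kernelF τ n z * u ^ n * u⁻¹) * this

/-- Fay's identity
`F(a; z) F(b; w) = F(a; z - w) F(a + b; w) + F(b; w - z) F(a + b; z)` for the generating series. -/
theorem kernelSeries_fay {τ : ℂ} (hτ : 0 < τ.im) {a b z w : ℂ} (ha : a ≠ 0) (hb : b ≠ 0)
    (hab : a + b ≠ 0) (hz : theta τ z ≠ 0) (hw : theta τ w ≠ 0) (hzw : theta τ (z - w) ≠ 0) :
    kernelSeries τ a z * kernelSeries τ b w
      = kernelSeries τ a (z - w) * kernelSeries τ (a + b) w
        + kernelSeries τ b (w - z) * kernelSeries τ (a + b) z := by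
  have hth := differentiable_theta hτ
  have hwz' : theta τ (w - z) = -theta τ (z - w) := by rw [← theta_neg, neg_sub]
  have hwz : theta τ (w - z) ≠ 0 := by rw [hwz']; exact neg_ne_zero.2 hzw
  set L := deriv (theta τ) 0 with hL
  have hL0 : L ≠ 0 := deriv_theta_zero_ne_zero hτ
  set T : ℂ → ℂ → PowerSeries ℂ := fun u z =>
    PowerSeries.rescale u (taylorSeries fun α => theta τ (z + α)) with hT
  set R : ℂ → PowerSeries ℂ := fun u => PowerSeries.rescale u (taylorSeries (thetaRecip τ)) with hR
  have hTR : ∀ u, T u 0 * R u = PowerSeries.C (L * u) * PowerSeries.X := by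
    intro u
    simp only [hT, hR]
    rw [← map_mul, taylorSeries_theta_mul_thetaRecip hτ]
    ext n
    rw [PowerSeries.coeff_rescale, PowerSeries.coeff_C_mul, PowerSeries.coeff_C_mul,
      PowerSeries.coeff_X]
    split_ifs with hn
    · rw [hn]; ring
    · ring
  have hTs : ∀ u z, taylorSeries (fun α => theta τ (z + u * α)) = T u z := fun u z =>
    taylorSeries_comp_mul_left (f := fun α => theta τ (z + α))
      (hth.comp (differentiable_id.const_add z)) u
  have hTa : ∀ u z, AnalyticAt ℂ (fun α => theta τ (z + u * α)) 0 := fun u z =>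
    (hth.comp ((differentiable_id.const_mul u).const_add z)).analyticAt 0
  -- the trisecant identity, with all terms expanded in the scaling parameter of `a` and `b`
  have key : PowerSeries.C (theta τ (z - w)) * (T a z * T b w * T (a + b) 0)
      = PowerSeries.C (theta τ z) * (T a (z - w) * T (a + b) w * T b 0)
        - PowerSeries.C (theta τ w) * (T b (w - z) * T (a + b) z * T a 0) := by
    have m2 : ∀ {f g h : ℂ → ℂ}, AnalyticAt ℂ f 0 → AnalyticAt ℂ g 0 → AnalyticAt ℂ h 0 → ∀ c : ℂ,
        taylorSeries (fun α => c * (f α * g α * h α))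
          = PowerSeries.C c * (taylorSeries f * taylorSeries g * taylorSeries h) := by
      intro f g h hf hg hh c
      rw [taylorSeries_const_mul, taylorSeries_mul (f := fun α => f α * g α) (hf.mul hg) hh,
        taylorSeries_mul hf hg]
    have an : ∀ {f g h : ℂ → ℂ}, AnalyticAt ℂ f 0 → AnalyticAt ℂ g 0 → AnalyticAt ℂ h 0 → ∀ c : ℂ,
        AnalyticAt ℂ (fun α => c * (f α * g α * h α)) 0 := fun hf hg hh c =>
      analyticAt_const.mul ((hf.mul hg).mul hh)
    simp only [← hTs]
    rw [← m2 (hTa _ _) (hTa _ _) (hTa _ _), ← m2 (hTa _ _) (hTa _ _) (hTa _ _),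
      ← m2 (hTa _ _) (hTa _ _) (hTa _ _),
      ← taylorSeries_sub (an (hTa _ _) (hTa _ _) (hTa _ _) _)
        (an (hTa _ _) (hTa _ _) (hTa _ _) _)]
    refine taylorSeries_congr (Eventually.of_forall fun α => ?_)
    have := theta_fay hτ z w (a * α) (b * α)
    simp only [zero_add]
    rw [← add_mul] at this
    linear_combination this
  have hφ : ∀ {u z : ℂ}, u ≠ 0 → theta τ z ≠ 0 →
      PowerSeries.C (u * theta τ z) * kernelSeries τ u z = T u z * R u := by
    intro u z hu hz
    rw [kernelSeries_eq hτ hu hz, ← mul_assoc, ← map_mul]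
    rw [show u * theta τ z * (u⁻¹ * (theta τ z)⁻¹) = 1 by field_simp, map_one, one_mul]
  -- the common denominator
  have hne : PowerSeries.C (theta τ z * theta τ w * theta τ (z - w) * (a * b * (a + b)) * L)
      * PowerSeries.X ≠ 0 := by
    refine mul_ne_zero ?_ PowerSeries.X_ne_zero
    rw [Ne, map_eq_zero_iff _ PowerSeries.C_injective]
    exact mul_ne_zero (mul_ne_zero (mul_ne_zero (mul_ne_zero hz hw) hzw)
      (mul_ne_zero (mul_ne_zero ha hb) hab)) hL0
  apply mul_left_cancel₀ hne
  have p1 := hφ ha hz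
  have p2 := hφ hb hw
  have p3 := hφ ha hzw
  have p4 := hφ hab hw
  have p5 := hφ hb hwz
  have p6 := hφ hab hz
  have q1 := hTR (a + b)
  have q2 := hTR b
  have q3 := hTR a
  rw [hwz'] at p5
  simp only [map_mul, map_neg] at p1 p2 p3 p4 p5 p6 q1 q2 q3 ⊢
  generalize kernelSeries τ a z = φ1 at *
  generalize kernelSeries τ b w = φ2 at *
  generalize kernelSeries τ a (z - w) = φ3 at *
  generalize kernelSeries τ (a + b) w = φ4 at *
  generalize kernelSeries τ b (w - z) = φ5 at *
  generalize kernelSeries τ (a + b) z = φ6 at *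
  generalize PowerSeries.C (theta τ z) = tz at *
  generalize PowerSeries.C (theta τ w) = tw at *
  generalize PowerSeries.C (theta τ (z - w)) = tzw at *
  calc _ = tzw * (PowerSeries.C a * tz * φ1) * (PowerSeries.C b * tw * φ2)
        * (PowerSeries.C L * PowerSeries.C (a + b) * PowerSeries.X) := by ring
    _ = R a * R b * R (a + b) * (tzw * (T a z * T b w * T (a + b) 0)) := by
      rw [p1, p2, ← q1]; ring
    _ = tz * (T a (z - w) * R a) * (T (a + b) w * R (a + b)) * (T b 0 * R b)
        - tw * (T b (w - z) * R b) * (T (a + b) z * R (a + b)) * (T a 0 * R a) := by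
      rw [key]; ring
    _ = _ := by rw [← p3, ← p4, ← p5, ← p6, q2, q3]; ring

/-! ### Regularized limits -/

theorem hasReg_iff {f : ℝ → ℂ} {c : ℂ} : HasReg f c ↔ ∃ (P : Polynomial ℂ) (δ : ℝ), 0 < δ ∧
    P.coeff 0 = c ∧ (fun ε : ℝ => f ε - P.eval (Complex.log (-2 * Real.pi * Complex.I * (ε : ℂ))))
      =O[𝓝[>] (0 : ℝ)] (fun ε : ℝ => ε ^ δ) := by
  constructor
  · rintro ⟨N, coef, δ, hδ, hc, h⟩
    refine ⟨∑ n ∈ Finset.range (N + 1), Polynomial.C (coef n) * Polynomial.X ^ n, δ, hδ, ?_, ?_⟩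
    · simp [Polynomial.finsetSum_coeff, Polynomial.coeff_X_pow, hc]
    · simpa [Polynomial.eval_finsetSum] using h
  · rintro ⟨P, δ, hδ, hc, h⟩
    refine ⟨P.natDegree, P.coeff, δ, hδ, hc, ?_⟩
    simpa only [Polynomial.eval_eq_sum_range] using h

theorem log_eq_log_add {ε : ℝ} (hε : 0 < ε) :
    Complex.log (-2 * Real.pi * Complex.I * (ε : ℂ))
      = (Real.log ε : ℂ) + Complex.log (-2 * Real.pi * Complex.I) := by
  rw [mul_comm, Complex.log_ofReal_mul hε]
  simp [Real.pi_ne_zero]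

theorem isBigO_rpow_of_le {a b : ℝ} (h : a ≤ b) :
    (fun ε : ℝ => ε ^ b) =O[𝓝[>] (0 : ℝ)] (fun ε : ℝ => ε ^ a) := by
  refine Asymptotics.IsBigO.of_bound 1 ?_
  filter_upwards [Ioo_mem_nhdsGT (zero_lt_one' ℝ)] with ε hε
  rw [one_mul, Real.norm_of_nonneg (Real.rpow_nonneg hε.1.le _),
    Real.norm_of_nonneg (Real.rpow_nonneg hε.1.le _)]
  exact Real.rpow_le_rpow_of_exponent_ge hε.1 hε.2.le h

theorem HasReg.add {f g : ℝ → ℂ} {c d : ℂ} (hf : HasReg f c) (hg : HasReg g d) :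
    HasReg (fun ε => f ε + g ε) (c + d) := by
  obtain ⟨P, δ, hδ, hP, h1⟩ := hasReg_iff.1 hf
  obtain ⟨Q, η, hη, hQ, h2⟩ := hasReg_iff.1 hg
  refine hasReg_iff.2 ⟨P + Q, min δ η, lt_min hδ hη, by rw [Polynomial.coeff_add, hP, hQ], ?_⟩
  refine ((h1.trans (isBigO_rpow_of_le (min_le_left _ _))).add
    (h2.trans (isBigO_rpow_of_le (min_le_right _ _)))).congr_left fun ε => ?_
  rw [Polynomial.eval_add]
  ring

theorem HasReg.const_mul {f : ℝ → ℂ} {c : ℂ} (a : ℂ) (hf : HasReg f c) :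
    HasReg (fun ε => a * f ε) (a * c) := by
  obtain ⟨P, δ, hδ, hP, h1⟩ := hasReg_iff.1 hf
  refine hasReg_iff.2 ⟨Polynomial.C a * P, δ, hδ, by rw [Polynomial.coeff_C_mul, hP], ?_⟩
  refine (h1.const_mul_left a).congr_left fun ε => ?_
  rw [Polynomial.eval_mul, Polynomial.eval_C]
  ring

theorem hasReg_zero_of_isBigO {f : ℝ → ℂ} {δ : ℝ} (hδ : 0 < δ)
    (hf : f =O[𝓝[>] (0 : ℝ)] (fun ε : ℝ => ε ^ δ)) : HasReg f 0 :=
  hasReg_iff.2 ⟨0, δ, hδ, by simp, by simpa using hf⟩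

theorem HasReg.sum {ι : Type*} (s : Finset ι) {f : ι → ℝ → ℂ} {c : ι → ℂ}
    (h : ∀ i ∈ s, HasReg (f i) (c i)) : HasReg (fun ε => ∑ i ∈ s, f i ε) (∑ i ∈ s, c i) := by
  classical
  induction s using Finset.induction_on with
  | empty =>
    simp only [Finset.sum_empty]
    exact hasReg_zero_of_isBigO one_pos (Asymptotics.isBigO_zero _ _)
  | insert a s ha ih =>
    simp only [Finset.sum_insert ha]
    exact (h a (Finset.mem_insert_self _ _)).add
      (ih fun i hi => h i (Finset.mem_insert_of_mem hi))

/-- A polynomial in `log (-2πiε)` that tends to zero as `ε → 0` vanishes. -/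
theorem HasReg.unique {f : ℝ → ℂ} {c d : ℂ} (hc : HasReg f c) (hd : HasReg f d) : c = d := by
  obtain ⟨P, δ, hδ, hP, h1⟩ := hasReg_iff.1 hc
  obtain ⟨Q, η, hη, hQ, h2⟩ := hasReg_iff.1 hd
  have hlim : ∀ {a : ℝ}, 0 < a → Tendsto (fun ε : ℝ => ε ^ a) (𝓝[>] 0) (𝓝 0) := fun {a} ha => by
    have := (Real.continuousAt_rpow_const 0 a (Or.inr ha.le)).tendsto
    rw [Real.zero_rpow ha.ne'] at this
    exact this.mono_left nhdsWithin_le_nhds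
  have h3 : Tendsto (fun ε : ℝ => (P - Q).eval (Complex.log (-2 * Real.pi * Complex.I * (ε : ℂ))))
      (𝓝[>] 0) (𝓝 0) := by
    have := (h2.trans_tendsto (hlim hη)).sub (h1.trans_tendsto (hlim hδ))
    rw [sub_zero] at this
    refine this.congr fun ε => ?_
    rw [Polynomial.eval_sub]
    ring
  have hdeg : (P - Q).degree ≤ 0 := by
    by_contra! hdeg
    have hnorm : Tendsto (fun ε : ℝ => ‖Complex.log (-2 * Real.pi * Complex.I * (ε : ℂ))‖)
        (𝓝[>] 0) atTop := by
      have a1 : Tendsto (fun ε : ℝ => |Real.log ε + (Complex.log (-2 * Real.pi * Complex.I)).re|)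
          (𝓝[>] 0) atTop :=
        tendsto_abs_atBot_atTop.comp (tendsto_atBot_add_const_right _ _
          Real.tendsto_log_nhdsGT_zero)
      refine tendsto_atTop_mono' _ ?_ a1
      filter_upwards [self_mem_nhdsWithin] with ε hε
      rw [log_eq_log_add hε]
      refine le_trans (le_of_eq ?_) (Complex.abs_re_le_norm _)
      rw [Complex.add_re, Complex.ofReal_re]
    exact not_tendsto_nhds_of_tendsto_atTop ((P - Q).tendsto_norm_atTop hdeg hnorm) _ h3.norm
  rw [Polynomial.eq_C_of_degree_le_zero hdeg] at h3
  simp only [Polynomial.eval_C] at h3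
  have h4 := tendsto_nhds_unique h3 tendsto_const_nhds
  rw [Polynomial.coeff_sub, hP, hQ] at h4
  exact (sub_eq_zero.1 h4.symm)

theorem HasReg.congr {f g : ℝ → ℂ} {c : ℂ} (hf : HasReg f c) (h : f =ᶠ[𝓝[>] 0] g) :
    HasReg g c := by
  obtain ⟨N, coef, δ, hδ, hc, h'⟩ := hf
  refine ⟨N, coef, δ, hδ, hc, h'.congr' ?_ EventuallyEq.rfl⟩
  filter_upwards [h] with ε hε
  rw [hε]

/-! ### Functions with a logarithmic asymptotic expansion at zero -/

/-- Continuous functions on `(0, 1/2]` of the form `P (log ε) + O(ε^δ)` with a polynomial `P` and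
some `δ > 0`. -/
def LogAsymp (f : ℝ → ℂ) : Prop :=
  ContinuousOn f (Set.Ioc 0 (1 / 2)) ∧ ∃ (P : Polynomial ℂ) (δ C : ℝ), 0 < δ ∧
    ∀ ε ∈ Set.Ioc (0 : ℝ) (1 / 2), ‖f ε - P.eval (Real.log ε : ℂ)‖ ≤ C * ε ^ δ

theorem LogAsymp.exists_hasReg {f : ℝ → ℂ} (hf : LogAsymp f) : ∃ c, HasReg f c := by
  obtain ⟨-, P, δ, C, hδ, h⟩ := hf
  refine ⟨_, hasReg_iff.2 ⟨P.comp (Polynomial.X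
    - Polynomial.C (Complex.log (-2 * Real.pi * Complex.I))), δ, hδ, rfl, ?_⟩⟩
  refine Asymptotics.IsBigO.of_bound C ?_
  filter_upwards [Ioc_mem_nhdsGT (show (0 : ℝ) < 1 / 2 by norm_num)] with ε hε
  rw [Polynomial.eval_comp, Polynomial.eval_sub, Polynomial.eval_X, Polynomial.eval_C,
    log_eq_log_add hε.1, add_sub_cancel_right, Real.norm_of_nonneg (Real.rpow_nonneg hε.1.le _)]
  exact h ε hε

theorem rpow_le_rpow_of_mem {ε a b : ℝ} (hε : ε ∈ Set.Ioc (0 : ℝ) (1 / 2)) (h : a ≤ b) :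
    ε ^ b ≤ ε ^ a :=
  Real.rpow_le_rpow_of_exponent_ge hε.1 (by linarith [hε.2]) h

theorem exists_norm_eval_log_le (P : Polynomial ℂ) {s : ℝ} (hs : 0 < s) :
    ∃ C : ℝ, 0 ≤ C ∧ ∀ ε ∈ Set.Ioc (0 : ℝ) (1 / 2), ‖P.eval (Real.log ε : ℂ)‖ ≤ C * ε ^ (-s) := by
  induction P using Polynomial.induction_on' with
  | add p q hp hq =>
    obtain ⟨C, hC, h1⟩ := hp
    obtain ⟨D, hD, h2⟩ := hq
    refine ⟨C + D, add_nonneg hC hD, fun ε hε => ?_⟩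
    rw [Polynomial.eval_add, add_mul]
    exact (norm_add_le _ _).trans (add_le_add (h1 ε hε) (h2 ε hε))
  | monomial n a =>
    set t : ℝ := s / (n + 1) with ht
    have ht0 : 0 < t := by positivity
    refine ⟨‖a‖ * (1 / t) ^ n, by positivity, fun ε hε => ?_⟩
    have hε1 : ε ≤ 1 := by linarith [hε.2]
    have h1 : |Real.log ε| ≤ 1 / t * ε ^ (-t) := by
      have := (Real.abs_log_mul_self_rpow_lt ε t hε.1 hε1 ht0).le
      rw [abs_mul, abs_of_nonneg (Real.rpow_nonneg hε.1.le _)] at this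
      rw [Real.rpow_neg hε.1.le, ← div_eq_mul_inv, le_div_iff₀ (Real.rpow_pos_of_pos hε.1 _)]
      exact this
    rw [Polynomial.eval_monomial, norm_mul, norm_pow, Complex.norm_real, Real.norm_eq_abs,
      mul_assoc]
    refine mul_le_mul_of_nonneg_left ?_ (norm_nonneg a)
    refine (pow_le_pow_left₀ (abs_nonneg _) h1 n).trans ?_
    rw [mul_pow]
    refine mul_le_mul_of_nonneg_left ?_ (by positivity)
    rw [← Real.rpow_natCast, ← Real.rpow_mul hε.1.le]
    refine rpow_le_rpow_of_mem hε ?_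
    rw [neg_mul, neg_le_neg_iff, ht, div_mul_eq_mul_div, div_le_iff₀ (by positivity)]
    nlinarith

theorem logAsymp_const (c : ℂ) : LogAsymp fun _ => c :=
  ⟨continuousOn_const, Polynomial.C c, 1, 0, one_pos, fun ε _ => by simp⟩

theorem LogAsymp.add {f g : ℝ → ℂ} (hf : LogAsymp f) (hg : LogAsymp g) :
    LogAsymp fun ε => f ε + g ε := by
  obtain ⟨c1, P, δ, C, hδ, h1⟩ := hf
  obtain ⟨c2, Q, η, D, hη, h2⟩ := hg
  refine ⟨c1.add c2, P + Q, min δ η, |C| + |D|, lt_min hδ hη, fun ε hε => ?_⟩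
  rw [Polynomial.eval_add, show f ε + g ε - (P.eval (Real.log ε : ℂ) + Q.eval (Real.log ε : ℂ))
    = (f ε - P.eval (Real.log ε : ℂ)) + (g ε - Q.eval (Real.log ε : ℂ)) by ring, add_mul]
  refine (norm_add_le _ _).trans (add_le_add ((h1 ε hε).trans ?_) ((h2 ε hε).trans ?_))
  · exact mul_le_mul (le_abs_self C) (rpow_le_rpow_of_mem hε (min_le_left _ _))
      (Real.rpow_nonneg hε.1.le _) (abs_nonneg C)
  · exact mul_le_mul (le_abs_self D) (rpow_le_rpow_of_mem hε (min_le_right _ _))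
      (Real.rpow_nonneg hε.1.le _) (abs_nonneg D)

theorem LogAsymp.mul {f g : ℝ → ℂ} (hf : LogAsymp f) (hg : LogAsymp g) :
    LogAsymp fun ε => f ε * g ε := by
  obtain ⟨c1, P, δ, C, hδ, h1⟩ := hf
  obtain ⟨c2, Q, η, D, hη, h2⟩ := hg
  set s := min δ η / 2 with hs
  have hm : 0 < min δ η := lt_min hδ hη
  have hs0 : 0 < s := half_pos hm
  obtain ⟨A, hA, hP⟩ := exists_norm_eval_log_le P hs0
  obtain ⟨B, hB, hQ⟩ := exists_norm_eval_log_le Q hs0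
  refine ⟨c1.mul c2, P * Q, s, |C| * B + A * |D| + |C| * |D|, hs0, fun ε hε => ?_⟩
  have hp := fun {a b : ℝ} (h : a ≤ b) => rpow_le_rpow_of_mem (ε := ε) hε h
  have hpos : ∀ a : ℝ, 0 ≤ ε ^ a := fun a => Real.rpow_nonneg hε.1.le a
  have h2s : min δ η = s + s := by rw [hs]; ring
  have h1' : ‖f ε - P.eval (Real.log ε : ℂ)‖ ≤ |C| * ε ^ (s + s) :=
    (h1 ε hε).trans (mul_le_mul (le_abs_self C) (hp (h2s ▸ min_le_left _ _)) (hpos _)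
      (abs_nonneg C))
  have h2' : ‖g ε - Q.eval (Real.log ε : ℂ)‖ ≤ |D| * ε ^ (s + s) :=
    (h2 ε hε).trans (mul_le_mul (le_abs_self D) (hp (h2s ▸ min_le_right _ _)) (hpos _)
      (abs_nonneg D))
  have hsplit : ε ^ (s + s) * ε ^ (-s) = ε ^ s := by
    rw [← Real.rpow_add hε.1]; ring_nf
  have hsq : ε ^ (s + s) * ε ^ (s + s) ≤ ε ^ s := by
    rw [← Real.rpow_add hε.1]
    exact hp (by linarith)
  rw [Polynomial.eval_mul, show f ε * g ε - P.eval (Real.log ε : ℂ) * Q.eval (Real.log ε : ℂ)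
    = (f ε - P.eval (Real.log ε : ℂ)) * Q.eval (Real.log ε : ℂ)
      + P.eval (Real.log ε : ℂ) * (g ε - Q.eval (Real.log ε : ℂ))
      + (f ε - P.eval (Real.log ε : ℂ)) * (g ε - Q.eval (Real.log ε : ℂ)) by ring]
  refine (norm_add₃_le).trans ?_
  rw [norm_mul, norm_mul, norm_mul, add_mul, add_mul]
  refine add_le_add (add_le_add ?_ ?_) ?_
  · calc _ ≤ (|C| * ε ^ (s + s)) * (B * ε ^ (-s)) :=
          mul_le_mul h1' (hQ ε hε) (norm_nonneg _) (mul_nonneg (abs_nonneg C) (hpos _))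
      _ = |C| * B * (ε ^ (s + s) * ε ^ (-s)) := by ring
      _ = _ := by rw [hsplit]
  · calc _ ≤ (A * ε ^ (-s)) * (|D| * ε ^ (s + s)) :=
          mul_le_mul (hP ε hε) h2' (norm_nonneg _) (mul_nonneg hA (hpos _))
      _ = A * |D| * (ε ^ (s + s) * ε ^ (-s)) := by ring
      _ = _ := by rw [hsplit]
  · calc _ ≤ (|C| * ε ^ (s + s)) * (|D| * ε ^ (s + s)) :=
          mul_le_mul h1' h2' (norm_nonneg _) (mul_nonneg (abs_nonneg C) (hpos _))
      _ = |C| * |D| * (ε ^ (s + s) * ε ^ (s + s)) := by ring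
      _ ≤ _ := mul_le_mul_of_nonneg_left hsq (by positivity)

theorem LogAsymp.sum {ι : Type*} (s : Finset ι) {f : ι → ℝ → ℂ} (h : ∀ i ∈ s, LogAsymp (f i)) :
    LogAsymp fun ε => ∑ i ∈ s, f i ε := by
  classical
  induction s using Finset.induction_on with
  | empty => simpa using logAsymp_const 0
  | insert a s ha ih =>
    simp only [Finset.sum_insert ha]
    exact (h a (Finset.mem_insert_self _ _)).add
      (ih fun i hi => h i (Finset.mem_insert_of_mem hi))

theorem LogAsymp.neg {f : ℝ → ℂ} (hf : LogAsymp f) : LogAsymp fun ε => -f ε := by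
  simpa using (logAsymp_const (-1)).mul hf

theorem LogAsymp.congr {f g : ℝ → ℂ} (hf : LogAsymp f)
    (h : ∀ ε ∈ Set.Ioc (0 : ℝ) (1 / 2), g ε = f ε) : LogAsymp g := by
  obtain ⟨hc, P, δ, C, hδ, hb⟩ := hf
  exact ⟨hc.congr h, P, δ, C, hδ, fun ε hε => by rw [h ε hε]; exact hb ε hε⟩

theorem exists_derivative_eq (P : Polynomial ℂ) : ∃ Q : Polynomial ℂ, Q.derivative = P := by
  induction P using Polynomial.induction_on' with
  | add p q hp hq =>
    obtain ⟨A, rfl⟩ := hp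
    obtain ⟨B, rfl⟩ := hq
    exact ⟨A + B, Polynomial.derivative_add⟩
  | monomial n a =>
    refine ⟨Polynomial.monomial (n + 1) (a / (n + 1)), ?_⟩
    rw [Polynomial.derivative_monomial, Nat.add_sub_cancel]
    congr 1
    have : (n : ℂ) + 1 ≠ 0 := by exact_mod_cast n.succ_ne_zero
    push_cast
    field_simp

theorem intervalIntegrable_of_continuousOn_Ioc {h : ℝ → ℂ}
    (hc : ContinuousOn h (Set.Ioc 0 (1 / 2))) {a b : ℝ} (ha : a ∈ Set.Ioc (0 : ℝ) (1 / 2))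
    (hb : b ∈ Set.Ioc (0 : ℝ) (1 / 2)) : IntervalIntegrable h MeasureTheory.volume a b :=
  (hc.mono (Set.ordConnected_Ioc.uIcc_subset ha hb)).intervalIntegrable

/-- The polynomial part integrates to a polynomial in `log ε`; the error term is integrable at `0`,
so it contributes a constant and a smaller error. -/
theorem LogAsymp.integral {g k : ℝ → ℂ} (hg : LogAsymp g)
    (hk : ContinuousOn k (Set.Ioc 0 (1 / 2))) (c : ℂ) (M : ℝ)
    (hkM : ∀ s ∈ Set.Ioc (0 : ℝ) (1 / 2), ‖k s - c / s‖ ≤ M) :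
    LogAsymp fun ε => ∫ s in ε..(1 / 2), g s * k s := by
  have half_mem : (1 / 2 : ℝ) ∈ Set.Ioc (0 : ℝ) (1 / 2) := by constructor <;> norm_num
  obtain ⟨hgc, P, δ', C, hδ', h1⟩ := hg
  have hM : 0 ≤ M := (norm_nonneg _).trans (hkM _ half_mem)
  -- the powers of the logarithm are bounded by multiples of `ε^{-1/2}`, whence the bound `1 / 2`
  set δ := min δ' (1 / 2) with hδ
  have hδ0 : 0 < δ := lt_min hδ' (by norm_num)
  have hδ1 : δ ≤ 1 / 2 := min_le_right _ _
  obtain ⟨A, hA, hP⟩ := exists_norm_eval_log_le P (show (0 : ℝ) < 1 / 2 by norm_num)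
  obtain ⟨Q, hQ⟩ := exists_derivative_eq (Polynomial.C c * P)
  have hne : ∀ s ∈ Set.Ioc (0 : ℝ) (1 / 2), (s : ℂ) ≠ 0 := fun s hs =>
    Complex.ofReal_ne_zero.2 hs.1.ne'
  -- the polynomial part `p` and the error `e` of the integrand
  set p : ℝ → ℂ := fun s => c * P.eval (Real.log s : ℂ) * (s : ℂ)⁻¹ with hp
  set e : ℝ → ℂ := fun s => g s * k s - p s with he
  have hlogc : ContinuousOn (fun s : ℝ => (Real.log s : ℂ)) (Set.Ioc 0 (1 / 2)) :=
    Complex.continuous_ofReal.comp_continuousOn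
      (Real.continuousOn_log.mono fun s hs => hs.1.ne')
  have hpc : ContinuousOn p (Set.Ioc 0 (1 / 2)) :=
    (continuousOn_const.mul (P.continuous.comp_continuousOn hlogc)).mul
      (Complex.continuous_ofReal.continuousOn.inv₀ hne)
  have hgk : ContinuousOn (fun s => g s * k s) (Set.Ioc 0 (1 / 2)) := hgc.mul hk
  have hec : ContinuousOn e (Set.Ioc 0 (1 / 2)) := hgk.sub hpc
  set D : ℝ := ‖c‖ * |C| + (|C| + A) * M with hD
  have hebound : ∀ s ∈ Set.Ioc (0 : ℝ) (1 / 2), ‖e s‖ ≤ D * s ^ (δ - 1) := by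
    intro s hs
    have hpos : ∀ a : ℝ, 0 ≤ s ^ a := fun a => Real.rpow_nonneg hs.1.le a
    have hle := fun {a b : ℝ} (h : a ≤ b) => rpow_le_rpow_of_mem (ε := s) hs h
    have hgP : ‖g s - P.eval (Real.log s : ℂ)‖ ≤ |C| * s ^ δ :=
      (h1 s hs).trans (mul_le_mul (le_abs_self C) (hle (min_le_left _ _)) (hpos _)
        (abs_nonneg C))
    have hg' : ‖g s‖ ≤ (|C| + A) * s ^ (δ - 1) := by
      calc ‖g s‖ = ‖(g s - P.eval (Real.log s : ℂ)) + P.eval (Real.log s : ℂ)‖ := by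
            rw [sub_add_cancel]
        _ ≤ |C| * s ^ δ + A * s ^ (-(1 / 2 : ℝ)) :=
            (norm_add_le _ _).trans (add_le_add hgP (hP s hs))
        _ ≤ |C| * s ^ (δ - 1) + A * s ^ (δ - 1) := by
            refine add_le_add (mul_le_mul_of_nonneg_left (hle (by linarith)) (abs_nonneg C))
              (mul_le_mul_of_nonneg_left (hle (by linarith)) hA)
        _ = _ := by ring
    have hsplit : e s = c * (g s - P.eval (Real.log s : ℂ)) * (s : ℂ)⁻¹ + g s * (k s - c / s) := by
      simp only [he, hp]
      field_simp
      ring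
    have hinv : ‖(s : ℂ)⁻¹‖ = s ^ (-1 : ℝ) := by
      rw [norm_inv, Complex.norm_real, Real.norm_of_nonneg hs.1.le, Real.rpow_neg_one]
    rw [hsplit, hD, add_mul]
    refine (norm_add_le _ _).trans (add_le_add ?_ ?_)
    · rw [norm_mul, norm_mul, hinv, sub_eq_add_neg δ, Real.rpow_add hs.1, mul_assoc, mul_assoc]
      refine mul_le_mul_of_nonneg_left ?_ (norm_nonneg c)
      calc _ ≤ |C| * s ^ δ * s ^ (-1 : ℝ) := mul_le_mul_of_nonneg_right hgP (hpos _)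
        _ = _ := by ring
    · rw [norm_mul]
      calc _ ≤ (|C| + A) * s ^ (δ - 1) * M :=
            mul_le_mul hg' (hkM s hs) (norm_nonneg _) (mul_nonneg (by positivity) (hpos _))
        _ = _ := by ring
  have hrint : ∀ a b : ℝ, IntervalIntegrable (fun s : ℝ => D * s ^ (δ - 1))
      MeasureTheory.volume a b := fun a b =>
    (intervalIntegral.intervalIntegrable_rpow' (by linarith)).const_mul D
  have heint : ∀ b ∈ Set.Ioc (0 : ℝ) (1 / 2), IntervalIntegrable e MeasureTheory.volume 0 b := by
    intro b hb
    have hsub : Set.uIoc 0 b ⊆ Set.Ioc 0 (1 / 2) := by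
      rw [Set.uIoc_of_le hb.1.le]
      exact Set.Ioc_subset_Ioc_right hb.2
    refine (hrint 0 b).mono_fun' ((hec.mono hsub).aestronglyMeasurable measurableSet_uIoc) ?_
    refine (MeasureTheory.ae_restrict_iff' measurableSet_uIoc).2
      (Eventually.of_forall fun s hs => ?_)
    exact hebound s (hsub hs)
  have hpint : ∀ ε ∈ Set.Ioc (0 : ℝ) (1 / 2), ∫ s in ε..(1 / 2), p s
      = Q.eval (Real.log (1 / 2) : ℂ) - Q.eval (Real.log ε : ℂ) := by
    intro ε hε
    refine intervalIntegral.integral_eq_sub_of_hasDerivAt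
      (f := fun s : ℝ => Q.eval (Real.log s : ℂ)) (fun s hs => ?_)
      (intervalIntegrable_of_continuousOn_Ioc hpc hε half_mem)
    have hs' : s ∈ Set.Ioc (0 : ℝ) (1 / 2) := Set.ordConnected_Ioc.uIcc_subset hε half_mem hs
    have d1 : HasDerivAt (fun s : ℝ => (Real.log s : ℂ)) ((s⁻¹ : ℝ) : ℂ) s :=
      (Real.hasDerivAt_log hs'.1.ne').ofReal_comp
    have d2 := (Q.hasDerivAt (Real.log s : ℂ)).comp s d1
    rw [hQ, Polynomial.eval_mul, Polynomial.eval_C, Complex.ofReal_inv] at d2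
    exact d2
  refine ⟨?_, Polynomial.C (Q.eval (Real.log (1 / 2) : ℂ) + ∫ s in (0 : ℝ)..(1 / 2), e s) - Q,
    δ, D / δ, hδ0, fun ε hε => ?_⟩
  · intro ε hε
    have hd : HasDerivWithinAt (fun u => ∫ s in u..(1 / 2), g s * k s) (-(g ε * k ε))
        (Set.Ioc 0 (1 / 2)) ε := by
      rcases eq_or_lt_of_le hε.2 with h | h
      · rw [h]
        have hmeas : StronglyMeasurableAtFilter (fun s => g s * k s) (𝓝[Set.Iic (1 / 2)] (1 / 2 : ℝ))
            MeasureTheory.volume := by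
          refine ⟨Set.Ioc 0 (1 / 2), Ioc_mem_nhdsLE (by norm_num), ?_⟩
          exact hgk.aestronglyMeasurable measurableSet_Ioc
        have := intervalIntegral.integral_hasDerivWithinAt_left (s := Set.Iic (1 / 2))
          (t := Set.Iic (1 / 2)) (intervalIntegrable_of_continuousOn_Ioc hgk half_mem half_mem)
          hmeas ((hgk (1 / 2) half_mem).mono_of_mem_nhdsWithin (Ioc_mem_nhdsLE (by norm_num)))
        exact this.mono fun x hx => hx.2
      · have hmem : Set.Ioc (0 : ℝ) (1 / 2) ∈ 𝓝 ε :=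
          Filter.mem_of_superset (Ioo_mem_nhds hε.1 h) Set.Ioo_subset_Ioc_self
        have hmeas : StronglyMeasurableAtFilter (fun s => g s * k s) (𝓝 ε)
            MeasureTheory.volume :=
          ⟨_, hmem, hgk.aestronglyMeasurable measurableSet_Ioc⟩
        exact (intervalIntegral.integral_hasDerivAt_left
          (intervalIntegrable_of_continuousOn_Ioc hgk hε half_mem) hmeas
          (hgk.continuousAt hmem)).hasDerivWithinAt
    exact hd.continuousWithinAt
  · have e1 : ∫ s in ε..(1 / 2), g s * k s
        = (∫ s in ε..(1 / 2), p s) + ∫ s in ε..(1 / 2), e s := by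
      rw [← intervalIntegral.integral_add
        (intervalIntegrable_of_continuousOn_Ioc hpc hε half_mem)
        (intervalIntegrable_of_continuousOn_Ioc hec hε half_mem)]
      simp only [he, add_sub_cancel]
    have e2 : ∫ s in ε..(1 / 2), e s = (∫ s in (0 : ℝ)..(1 / 2), e s) - ∫ s in (0 : ℝ)..ε, e s :=
      (intervalIntegral.integral_interval_sub_left (heint _ half_mem) (heint _ hε)).symm
    change ‖(∫ s in ε..(1 / 2), g s * k s) - _‖ ≤ _
    rw [e1, e2, hpint ε hε, Polynomial.eval_sub, Polynomial.eval_C,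
      show ∀ a b c d : ℂ, a - b + (c - d) - (a + c - b) = -d from fun a b c d => by ring, norm_neg]
    refine (intervalIntegral.norm_integral_le_of_norm_le hε.1.le
      (Eventually.of_forall fun s hs => hebound s ⟨hs.1, hs.2.trans hε.2⟩) (hrint 0 ε)).trans ?_
    rw [intervalIntegral.integral_const_mul, integral_rpow (Or.inl (by linarith)),
      sub_add_cancel, Real.zero_rpow hδ0.ne', sub_zero]
    exact le_of_eq (by ring)

/-! ### Iterated integrals along the unit interval -/

theorem intervalIntegrable_of_continuousOn_Ioo {f : ℝ → ℂ} (hf : ContinuousOn f (Set.Ioo 0 1))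
    {a b : ℝ} (ha : a ∈ Set.Ioo (0 : ℝ) 1) (hb : b ∈ Set.Ioo (0 : ℝ) 1) :
    IntervalIntegrable f MeasureTheory.volume a b :=
  (hf.mono (Set.ordConnected_Ioo.uIcc_subset ha hb)).intervalIntegrable

theorem continuousOn_primitive_Ioo {f : ℝ → ℂ} (hf : ContinuousOn f (Set.Ioo 0 1))
    {a : ℝ} (ha : a ∈ Set.Ioo (0 : ℝ) 1) :
    ContinuousOn (fun x => ∫ t in a..x, f t) (Set.Ioo 0 1) := by
  intro x hx
  have hmem : Set.Ioo (0 : ℝ) 1 ∈ 𝓝 x := Ioo_mem_nhds hx.1 hx.2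
  exact (intervalIntegral.integral_hasDerivAt_right (intervalIntegrable_of_continuousOn_Ioo hf ha hx)
    ⟨_, hmem, hf.aestronglyMeasurable measurableSet_Ioo⟩
    (hf.continuousAt hmem)).continuousAt.continuousWithinAt

/-- The iterated integral `∫_{a < t_0 < ⋯ < t_{n-1} < x} ω_0(t_0) dt_0 ⋯ ω_{n-1}(t_{n-1}) dt_{n-1}`
of a sequence of functions. -/
def chenInt (ω : ℕ → ℝ → ℂ) (a : ℝ) : ℕ → ℝ → ℂ
  | 0, _ => 1
  | n + 1, x => ∫ t in a..x, chenInt ω a n t * ω n t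

theorem continuousOn_chenInt {ω : ℕ → ℝ → ℂ} (hω : ∀ m, ContinuousOn (ω m) (Set.Ioo 0 1))
    {a : ℝ} (ha : a ∈ Set.Ioo (0 : ℝ) 1) (n : ℕ) : ContinuousOn (chenInt ω a n) (Set.Ioo 0 1) := by
  induction n with
  | zero => exact continuousOn_const
  | succ n ih => exact continuousOn_primitive_Ioo (ih.mul (hω n)) ha

/-- Chen's path composition formula. -/
theorem chenInt_comp {ω : ℕ → ℝ → ℂ} (hω : ∀ m, ContinuousOn (ω m) (Set.Ioo 0 1)) {a b : ℝ}
    (ha : a ∈ Set.Ioo (0 : ℝ) 1) (hb : b ∈ Set.Ioo (0 : ℝ) 1) (n : ℕ) :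
    ∀ x ∈ Set.Ioo (0 : ℝ) 1, chenInt ω a n x
      = ∑ j ∈ Finset.range (n + 1), chenInt ω a j b * chenInt (fun m => ω (j + m)) b (n - j) x := by
  induction n with
  | zero => intro x _; simp [chenInt]
  | succ n ih =>
    intro x hx
    have hsh : ∀ j m, ContinuousOn (ω (j + m)) (Set.Ioo 0 1) := fun j m => hω _
    have hi : ∀ {y z}, y ∈ Set.Ioo (0 : ℝ) 1 → z ∈ Set.Ioo (0 : ℝ) 1 →
        IntervalIntegrable (fun t => chenInt ω a n t * ω n t) MeasureTheory.volume y z :=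
      fun hy hz => intervalIntegrable_of_continuousOn_Ioo
        ((continuousOn_chenInt hω ha n).mul (hω n)) hy hz
    have e1 : chenInt ω a (n + 1) x
        = chenInt ω a (n + 1) b + ∫ t in b..x, chenInt ω a n t * ω n t :=
      (intervalIntegral.integral_add_adjacent_intervals (hi ha hb) (hi hb hx)).symm
    have e2 : ∫ t in b..x, chenInt ω a n t * ω n t = ∫ t in b..x, ∑ j ∈ Finset.range (n + 1),
        chenInt ω a j b * (chenInt (fun m => ω (j + m)) b (n - j) t * ω n t) := by
      refine intervalIntegral.integral_congr fun t ht => ?_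
      have ht' : t ∈ Set.Ioo (0 : ℝ) 1 := Set.ordConnected_Ioo.uIcc_subset hb hx ht
      simp only [ih t ht', Finset.sum_mul, mul_assoc]
    rw [Finset.sum_range_succ, Nat.sub_self, e1, e2, intervalIntegral.integral_finsetSum, add_comm]
    · congr 1
      · refine Finset.sum_congr rfl fun j hj => ?_
        have hjn : j ≤ n := Nat.lt_succ_iff.1 (Finset.mem_range.1 hj)
        rw [intervalIntegral.integral_const_mul, Nat.succ_sub hjn]
        simp only [chenInt, Nat.add_sub_cancel' hjn]
      · simp [chenInt]
    · intro j _
      exact (intervalIntegrable_of_continuousOn_Ioo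
        ((continuousOn_chenInt (hsh j) hb (n - j)).mul (hω n)) hb hx).const_mul _

/-- A function on the unit interval with at most simple poles at both end points. -/
def SimplePoles (f : ℝ → ℂ) : Prop :=
  ContinuousOn f (Set.Ioo 0 1) ∧
    (∃ (c : ℂ) (M : ℝ), ∀ s ∈ Set.Ioc (0 : ℝ) (1 / 2), ‖f s - c / s‖ ≤ M) ∧
    ∃ (c : ℂ) (M : ℝ), ∀ s ∈ Set.Ioc (0 : ℝ) (1 / 2), ‖f (1 - s) - c / s‖ ≤ M

theorem half_mem_Ioo : (1 / 2 : ℝ) ∈ Set.Ioo (0 : ℝ) 1 := by constructor <;> norm_num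

theorem Ioc_half_subset : Set.Ioc (0 : ℝ) (1 / 2) ⊆ Set.Ioo 0 1 := fun x hx =>
  ⟨hx.1, by linarith [hx.2]⟩

theorem logAsymp_chenInt_from_half {ω : ℕ → ℝ → ℂ} (hω : ∀ m, SimplePoles (ω m)) (n : ℕ) :
    LogAsymp fun ε => chenInt ω (1 / 2) n ε := by
  induction n with
  | zero => exact logAsymp_const 1
  | succ n ih =>
    obtain ⟨hc, ⟨c, M, hM⟩, -⟩ := hω n
    refine (ih.integral (hc.mono Ioc_half_subset) c M hM).neg.congr fun ε _ => ?_
    rw [chenInt, intervalIntegral.integral_symm]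

theorem logAsymp_chenInt_half_one_sub {ω : ℕ → ℝ → ℂ} (hω : ∀ m, SimplePoles (ω m)) (n : ℕ) :
    LogAsymp fun ε => chenInt ω (1 / 2) n (1 - ε) := by
  induction n with
  | zero => exact logAsymp_const 1
  | succ n ih =>
    obtain ⟨hc, -, ⟨c, M, hM⟩⟩ := hω n
    have hc' : ContinuousOn (fun s => ω n (1 - s)) (Set.Ioc 0 (1 / 2)) :=
      hc.comp (by fun_prop) fun s hs => ⟨by linarith [hs.2], by linarith [hs.1]⟩
    refine (ih.integral hc' c M hM).congr fun ε _ => ?_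
    rw [chenInt, intervalIntegral.integral_comp_sub_left
      (fun t => chenInt ω (1 / 2) n t * ω n t)]
    norm_num

/-- Composing the path from `ε` to `1/2` with its inverse expresses the dependence on the lower end
point through the dependence on the upper one. -/
theorem logAsymp_chenInt_to_half (n : ℕ) : ∀ {ω : ℕ → ℝ → ℂ}, (∀ m, SimplePoles (ω m)) →
    LogAsymp fun ε => chenInt ω ε n (1 / 2) := by
  induction n using Nat.strong_induction_on with
  | _ n ih =>
    intro ω hω
    rcases n with _ | n
    · exact logAsymp_const 1
    · have h : LogAsymp fun ε => ∑ j ∈ Finset.range (n + 1), chenInt ω ε j (1 / 2)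
          * chenInt (fun m => ω (j + m)) (1 / 2) (n + 1 - j) ε :=
        LogAsymp.sum _ fun j hj => (ih j (Finset.mem_range.1 hj) hω).mul
          (logAsymp_chenInt_from_half (fun m => hω _) _)
      refine h.neg.congr fun ε hε => ?_
      have hε' := Ioc_half_subset hε
      have h0 := chenInt_comp (fun m => (hω m).1) hε' half_mem_Ioo (n + 1) ε hε'
      rw [chenInt, intervalIntegral.integral_same, Finset.sum_range_succ, Nat.sub_self] at h0
      simp only [chenInt, mul_one] at h0 ⊢
      linear_combination -h0

theorem exists_hasReg_chenInt {ω : ℕ → ℝ → ℂ} (hω : ∀ m, SimplePoles (ω m)) (n : ℕ) :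
    ∃ c, HasReg (fun ε => chenInt ω ε n (1 - ε)) c := by
  have h : LogAsymp fun ε => ∑ j ∈ Finset.range (n + 1), chenInt ω ε j (1 / 2)
      * chenInt (fun m => ω (j + m)) (1 / 2) (n - j) (1 - ε) :=
    LogAsymp.sum _ fun j _ => (logAsymp_chenInt_to_half j hω).mul
      (logAsymp_chenInt_half_one_sub (fun m => hω _) _)
  refine LogAsymp.exists_hasReg (h.congr fun ε hε => ?_)
  exact chenInt_comp (fun m => (hω m).1) (Ioc_half_subset hε) half_mem_Ioo n (1 - ε)
    ⟨by linarith [hε.2], by linarith [hε.1]⟩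

theorem simplePoles_kernelF {τ : ℂ} (hτ : 0 < τ.im) (n : ℕ) :
    SimplePoles fun t => kernelF τ n t := by
  obtain ⟨M, hM⟩ := exists_norm_kernelReg_le hτ n
  have h0 : ∀ s ∈ Set.Ioc (0 : ℝ) (1 / 2),
      ‖kernelF τ n s - (if n = 1 then 1 else 0) / (s : ℂ)‖ ≤ M := fun s hs => by
    rw [kernelF_eq_pole_add_kernelReg hτ n (theta_ofReal_ne_zero hτ (by linarith [hs.1])
      (by linarith [hs.2]) hs.1.ne'), add_sub_cancel_left]
    exact hM s ⟨hs.1.le, hs.2⟩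
  refine ⟨continuousOn_kernelF hτ n, ⟨_, M, h0⟩, (-1) ^ n * (if n = 1 then 1 else 0), M,
    fun s hs => ?_⟩
  simp only [kernelF_one_sub hτ n (Ioc_half_subset hs)]
  rw [mul_div_assoc, ← mul_sub, norm_mul, norm_pow,
    norm_neg, norm_one, one_pow, one_mul]
  exact h0 s hs

/-- A tuple, extended by zero to a sequence. -/
def extendZero {M : Type*} [Zero M] {r : ℕ} (k : Fin r → M) (m : ℕ) : M :=
  if h : m < r then k ⟨m, h⟩ else 0

theorem extendZero_coe {M : Type*} [Zero M] {r : ℕ} (k : Fin r → M) (j : Fin r) :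
    extendZero k j = k j := dif_pos j.2

theorem iterInt_eq_chenInt (τ : ℂ) (a : ℝ) (r : ℕ) (k : ℕ → ℕ) (x : ℝ) :
    iterInt τ a r (fun j => k j) x = chenInt (fun m t => kernelF τ (k m) t) a r x := by
  induction r generalizing x with
  | zero => rfl
  | succ r ih =>
    simp only [iterInt, chenInt]
    refine intervalIntegral.integral_congr fun t _ => ?_
    simp only [← ih t]
    rfl

theorem truncInt_eq_chenInt (τ : ℂ) {r : ℕ} (k : Fin r → ℕ) (ε : ℝ) :
    truncInt τ k ε = chenInt (fun m t => kernelF τ (extendZero k m) t) ε r (1 - ε) := by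
  rw [← iterInt_eq_chenInt, truncInt]
  congr 1
  exact funext fun j => (extendZero_coe k j).symm

theorem hasReg_Reg {f : ℝ → ℂ} (h : ∃ c, HasReg f c) : HasReg f (Reg f) := by
  rw [Reg, dif_pos h]
  exact h.choose_spec

theorem hasReg_truncInt (τ : UpperHalfPlane) {r : ℕ} (k : Fin r → ℕ) :
    HasReg (truncInt (τ : ℂ) k) (IA τ k) := by
  refine hasReg_Reg ?_
  rw [funext fun ε => truncInt_eq_chenInt (τ : ℂ) k ε]
  exact exists_hasReg_chenInt (fun m => simplePoles_kernelF τ.im_pos _) r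

/-! ### Convolution integrals over a triangle -/

theorem integral_triangle_swap {f : ℝ → ℝ → ℂ} (hf : Continuous (Function.uncurry f)) {p t : ℝ}
    (hpt : p ≤ t) :
    ∫ w in p..t, ∫ z in p..w, f z w = ∫ z in p..t, ∫ w in z..t, f z w := by
  set S : Set (ℝ × ℝ) := {x | x.2 ≤ x.1} with hS
  have hSm : MeasurableSet S := measurableSet_le measurable_snd measurable_fst
  set F : ℝ → ℝ → ℂ := fun w z => S.indicator (fun x => f x.2 x.1) (w, z) with hF
  have hint : MeasureTheory.Integrable (Function.uncurry F)
      ((MeasureTheory.volume.restrict (Set.Ioc p t)).prod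
        (MeasureTheory.volume.restrict (Set.Ioc p t))) := by
    have h1 : Continuous fun x : ℝ × ℝ => f x.2 x.1 := hf.comp continuous_swap
    rw [MeasureTheory.Measure.prod_restrict]
    have h2 : MeasureTheory.IntegrableOn (fun x : ℝ × ℝ => f x.2 x.1)
        (Set.Ioc p t ×ˢ Set.Ioc p t) (MeasureTheory.volume.prod MeasureTheory.volume) :=
      (h1.continuousOn.integrableOn_compact (isCompact_Icc.prod isCompact_Icc)).mono_set
        (Set.prod_mono Set.Ioc_subset_Icc_self Set.Ioc_subset_Icc_self)
    exact MeasureTheory.Integrable.indicator h2 hSm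
  rw [intervalIntegral.integral_of_le hpt, intervalIntegral.integral_of_le hpt]
  calc _ = ∫ w in Set.Ioc p t, ∫ z in Set.Ioc p t, F w z := by
        refine MeasureTheory.setIntegral_congr_fun measurableSet_Ioc fun w hw => ?_
        have e : F w = (Set.Iic w).indicator fun z => f z w := by
          funext z
          simp [hF, hS, Set.indicator_apply]
        rw [e, MeasureTheory.setIntegral_indicator measurableSet_Iic, Set.Ioc_inter_Iic,
          min_eq_right hw.2, intervalIntegral.integral_of_le hw.1.le]
    _ = ∫ z in Set.Ioc p t, ∫ w in Set.Ioc p t, F w z := MeasureTheory.integral_integral_swap hint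
    _ = _ := by
        refine MeasureTheory.setIntegral_congr_fun measurableSet_Ioc fun z hz => ?_
        have e : (fun w => F w z) = (Set.Ici z).indicator fun w => f z w := by
          funext w
          simp [hF, hS, Set.indicator_apply]
        have e2 : Set.Ioc p t ∩ Set.Ici z = Set.Icc z t := by
          ext w
          simp only [Set.mem_inter_iff, Set.mem_Ioc, Set.mem_Ici, Set.mem_Icc]
          exact ⟨fun h => ⟨h.2, h.1.2⟩, fun h => ⟨⟨hz.1.trans_le h.1, h.2⟩, h.1⟩⟩
        rw [e, MeasureTheory.setIntegral_indicator measurableSet_Ici, e2,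
          MeasureTheory.integral_Icc_eq_integral_Ioc, intervalIntegral.integral_of_le hz.2]

/-- After exchanging the order of integration, reflecting the variable `w` in the midpoint of
`[z, t]` moves the singular point of the kernel from `w = z` to `w = t`. -/
theorem integral_conv_of_continuous {a ρ : ℝ → ℂ} (ha : Continuous a) (hρ : Continuous ρ)
    {p t : ℝ} (hpt : p ≤ t) :
    ∫ w in p..t, ∫ z in p..w, a z * ρ (z - w) = ∫ w in p..t, (∫ z in p..w, a z) * ρ (w - t) := by
  rw [integral_triangle_swap (f := fun z w => a z * ρ (z - w)) (by fun_prop) hpt]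
  have h2 : ∫ w in p..t, (∫ z in p..w, a z) * ρ (w - t)
      = ∫ w in p..t, ∫ z in p..w, a z * ρ (w - t) := by
    refine intervalIntegral.integral_congr fun w _ => ?_
    exact (intervalIntegral.integral_mul_const _ _).symm
  rw [h2, integral_triangle_swap (f := fun z w => a z * ρ (w - t)) (by fun_prop) hpt]
  refine intervalIntegral.integral_congr fun z _ => ?_
  simp only [intervalIntegral.integral_const_mul]
  congr 1
  have := intervalIntegral.integral_comp_sub_left (fun w => ρ (w - t)) (a := z) (b := t) (z + t)
  rw [add_sub_cancel_right, add_sub_cancel_left] at this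
  rw [← this]
  refine intervalIntegral.integral_congr fun w _ => ?_
  congr 1
  ring

theorem exists_continuous_eqOn_Icc {a : ℝ → ℂ} {p q : ℝ} (hpq : p ≤ q)
    (ha : ContinuousOn a (Set.Icc p q)) : ∃ b : ℝ → ℂ, Continuous b ∧ Set.EqOn a b (Set.Icc p q) :=
  ⟨Set.IccExtend hpq ((Set.Icc p q).domRestrict a), ha.domRestrict.Icc_extend', fun x hx => by
    rw [Set.IccExtend_of_mem hpq _ hx, Set.domRestrict_apply]⟩

theorem uIcc_subset_of_mem {p q t : ℝ} (ht : t ∈ Set.Icc p q) : Set.uIcc p t ⊆ Set.Icc p q := by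
  rw [Set.uIcc_of_le ht.1]
  exact Set.Icc_subset_Icc_right ht.2

theorem integral_conv {a ρ : ℝ → ℂ} {p q t : ℝ} (ha : ContinuousOn a (Set.Icc p q))
    (hρ : Continuous ρ) (ht : t ∈ Set.Icc p q) :
    ∫ w in p..t, ∫ z in p..w, a z * ρ (z - w) = ∫ w in p..t, (∫ z in p..w, a z) * ρ (w - t) := by
  obtain ⟨b, hb, hab⟩ := exists_continuous_eqOn_Icc (ht.1.trans ht.2) ha
  have h := integral_conv_of_continuous hb hρ ht.1
  refine Eq.trans ?_ (h.trans ?_)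
  · refine intervalIntegral.integral_congr fun w hw =>
      intervalIntegral.integral_congr fun z hz => ?_
    have hw' := uIcc_subset_of_mem ht hw
    simp only [hab (uIcc_subset_of_mem hw' hz)]
  · refine intervalIntegral.integral_congr fun w hw => ?_
    have hw' := uIcc_subset_of_mem ht hw
    congr 1
    exact intervalIntegral.integral_congr fun z hz => (hab (uIcc_subset_of_mem hw' hz)).symm

theorem continuousOn_conv {a ρ : ℝ → ℂ} {p q : ℝ} (ha : ContinuousOn a (Set.Icc p q))
    (hρ : Continuous ρ) :
    ContinuousOn (fun t => ∫ w in p..t, a w * ρ (w - t)) (Set.Icc p q) := by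
  rcases le_or_gt p q with hpq | hpq
  · obtain ⟨b, hb, hab⟩ := exists_continuous_eqOn_Icc hpq ha
    have h : Continuous fun t => ∫ w in p..t, b w * ρ (w - t) :=
      intervalIntegral.continuous_parametric_intervalIntegral_of_continuous
        (f := fun t w => b w * ρ (w - t)) (by fun_prop) continuous_id
    refine h.continuousOn.congr fun t ht => ?_
    refine intervalIntegral.integral_congr fun w hw => ?_
    simp only [hab (uIcc_subset_of_mem ht hw)]
  · rw [Set.Icc_eq_empty (not_le.2 hpq)]
    exact continuousOn_empty _

/-! ### Coefficientwise integration of power series -/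

/-- Continuity of all the coefficients of a family of power series. -/
def CoeffContinuousOn (Ψ : ℝ → PowerSeries ℂ) (s : Set ℝ) : Prop :=
  ∀ n, ContinuousOn (fun t => PowerSeries.coeff n (Ψ t)) s

/-- The coefficientwise integral of a family of power series. -/
def psInt (a b : ℝ) (Ψ : ℝ → PowerSeries ℂ) : PowerSeries ℂ :=
  PowerSeries.mk fun n => ∫ t in a..b, PowerSeries.coeff n (Ψ t)

theorem coeff_psInt (a b : ℝ) (Ψ : ℝ → PowerSeries ℂ) (n : ℕ) :
    PowerSeries.coeff n (psInt a b Ψ) = ∫ t in a..b, PowerSeries.coeff n (Ψ t) :=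
  PowerSeries.coeff_mk _ _

section

variable {Ψ Φ : ℝ → PowerSeries ℂ} {s : Set ℝ} {p q t : ℝ}

theorem coeffContinuousOn_const (c : PowerSeries ℂ) : CoeffContinuousOn (fun _ => c) s :=
  fun _ => continuousOn_const

theorem CoeffContinuousOn.add (h1 : CoeffContinuousOn Ψ s) (h2 : CoeffContinuousOn Φ s) :
    CoeffContinuousOn (fun t => Ψ t + Φ t) s := fun n => by
  simp only [map_add]
  exact (h1 n).add (h2 n)

theorem CoeffContinuousOn.sub (h1 : CoeffContinuousOn Ψ s) (h2 : CoeffContinuousOn Φ s) :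
    CoeffContinuousOn (fun t => Ψ t - Φ t) s := fun n => by
  simp only [map_sub]
  exact (h1 n).sub (h2 n)

theorem CoeffContinuousOn.mul (h1 : CoeffContinuousOn Ψ s) (h2 : CoeffContinuousOn Φ s) :
    CoeffContinuousOn (fun t => Ψ t * Φ t) s := fun n => by
  simp only [PowerSeries.coeff_mul]
  exact continuousOn_finsetSum _ fun x _ => (h1 x.1).mul (h2 x.2)

theorem CoeffContinuousOn.sum {ι : Type*} (I : Finset ι) {Ψ : ι → ℝ → PowerSeries ℂ}
    (h : ∀ i ∈ I, CoeffContinuousOn (Ψ i) s) :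
    CoeffContinuousOn (fun t => ∑ i ∈ I, Ψ i t) s := fun n => by
  simp only [map_sum]
  exact continuousOn_finsetSum _ fun i hi => h i hi n

theorem CoeffContinuousOn.intervalIntegrable (h : CoeffContinuousOn Ψ (Set.Icc p q))
    (ht : t ∈ Set.Icc p q) (n : ℕ) :
    IntervalIntegrable (fun t => PowerSeries.coeff n (Ψ t)) MeasureTheory.volume p t :=
  ((h n).mono (uIcc_subset_of_mem ht)).intervalIntegrable

theorem CoeffContinuousOn.psInt (h : CoeffContinuousOn Ψ (Set.Icc p q)) :
    CoeffContinuousOn (fun x => psInt p x Ψ) (Set.Icc p q) := fun n => by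
  simp only [coeff_psInt]
  rcases le_or_gt p q with hpq | hpq
  · have := intervalIntegral.continuousOn_primitive_interval'
      (h.intervalIntegrable (Set.right_mem_Icc.2 hpq) n) Set.left_mem_uIcc
    rwa [Set.uIcc_of_le hpq] at this
  · rw [Set.Icc_eq_empty (not_le.2 hpq)]
    exact continuousOn_empty _

theorem psInt_add (h1 : CoeffContinuousOn Ψ (Set.Icc p q)) (h2 : CoeffContinuousOn Φ (Set.Icc p q))
    (ht : t ∈ Set.Icc p q) :
    psInt p t (fun x => Ψ x + Φ x) = psInt p t Ψ + psInt p t Φ := by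
  ext n
  simp only [map_add, coeff_psInt]
  exact intervalIntegral.integral_add (h1.intervalIntegrable ht n) (h2.intervalIntegrable ht n)

theorem psInt_sub (h1 : CoeffContinuousOn Ψ (Set.Icc p q)) (h2 : CoeffContinuousOn Φ (Set.Icc p q))
    (ht : t ∈ Set.Icc p q) :
    psInt p t (fun x => Ψ x - Φ x) = psInt p t Ψ - psInt p t Φ := by
  ext n
  simp only [map_sub, coeff_psInt]
  exact intervalIntegral.integral_sub (h1.intervalIntegrable ht n) (h2.intervalIntegrable ht n)

theorem psInt_neg (a b : ℝ) (Ψ : ℝ → PowerSeries ℂ) :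
    psInt a b (fun x => -Ψ x) = -psInt a b Ψ := by
  ext n
  simp only [map_neg, coeff_psInt, intervalIntegral.integral_neg]

theorem psInt_sum {ι : Type*} (I : Finset ι) {Ψ : ι → ℝ → PowerSeries ℂ}
    (h : ∀ i ∈ I, CoeffContinuousOn (Ψ i) (Set.Icc p q)) (ht : t ∈ Set.Icc p q) :
    psInt p t (fun x => ∑ i ∈ I, Ψ i x) = ∑ i ∈ I, psInt p t (Ψ i) := by
  ext n
  simp only [map_sum, coeff_psInt]
  exact intervalIntegral.integral_finsetSum fun i hi => (h i hi).intervalIntegrable ht n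

theorem psInt_mul_const (h : CoeffContinuousOn Ψ (Set.Icc p q)) (ht : t ∈ Set.Icc p q)
    (c : PowerSeries ℂ) : psInt p t (fun x => Ψ x * c) = psInt p t Ψ * c := by
  ext n
  simp only [coeff_psInt, PowerSeries.coeff_mul]
  rw [intervalIntegral.integral_finsetSum fun i _ => (h.intervalIntegrable ht i.1).mul_const _]
  exact Finset.sum_congr rfl fun i _ => intervalIntegral.integral_mul_const _ _

theorem psInt_congr (hpt : p ≤ t) (h : ∀ x ∈ Set.Ioo p t, Ψ x = Φ x) :
    psInt p t Ψ = psInt p t Φ := by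
  ext n
  simp only [coeff_psInt]
  exact intervalIntegral.integral_congr_Ioo_of_le hpt fun x hx => by simp only [h x hx]

theorem coeff_psInt_mul_shift {ρ : ℝ → PowerSeries ℂ} (h : CoeffContinuousOn Ψ (Set.Icc p q))
    (hρ : ∀ n, Continuous fun x => PowerSeries.coeff n (ρ x)) (n : ℕ) (ht : t ∈ Set.Icc p q) :
    PowerSeries.coeff n (psInt p t fun z => Ψ z * ρ (z - t))
      = ∑ x ∈ Finset.HasAntidiagonal.antidiagonal n, ∫ z in p..t,
        PowerSeries.coeff x.1 (Ψ z) * PowerSeries.coeff x.2 (ρ (z - t)) := by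
  simp only [coeff_psInt, PowerSeries.coeff_mul]
  refine intervalIntegral.integral_finsetSum fun x _ => ContinuousOn.intervalIntegrable ?_
  exact ((h x.1).mul ((hρ x.2).comp (continuous_id.sub continuous_const)).continuousOn).mono
    (uIcc_subset_of_mem ht)

theorem psInt_conv {ρ : ℝ → PowerSeries ℂ} (h : CoeffContinuousOn Ψ (Set.Icc p q))
    (hρ : ∀ n, Continuous fun x => PowerSeries.coeff n (ρ x)) (ht : t ∈ Set.Icc p q) :
    psInt p t (fun w => psInt p w fun z => Ψ z * ρ (z - w))
      = psInt p t fun w => psInt p w Ψ * ρ (w - t) := by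
  ext n
  have e1 : ∀ w ∈ Set.uIcc p t, PowerSeries.coeff n (psInt p w fun z => Ψ z * ρ (z - w))
      = ∑ x ∈ Finset.HasAntidiagonal.antidiagonal n, ∫ z in p..w,
        PowerSeries.coeff x.1 (Ψ z) * PowerSeries.coeff x.2 (ρ (z - w)) := fun w hw =>
    coeff_psInt_mul_shift h hρ n (uIcc_subset_of_mem ht hw)
  have e2 := coeff_psInt_mul_shift (Ψ := fun w => psInt p w Ψ) h.psInt hρ n ht
  rw [coeff_psInt, intervalIntegral.integral_congr e1, e2, intervalIntegral.integral_finsetSum]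
  · refine Finset.sum_congr rfl fun x _ => ?_
    simp only [coeff_psInt]
    exact integral_conv (h x.1) (hρ x.2) ht
  · intro x _
    have hc := continuousOn_conv (h x.1) (hρ x.2)
    exact (hc.mono (uIcc_subset_of_mem ht)).intervalIntegrable

theorem coeffContinuousOn_conv {ρ : ℝ → PowerSeries ℂ} (h : CoeffContinuousOn Ψ (Set.Icc p q))
    (hρ : ∀ n, Continuous fun x => PowerSeries.coeff n (ρ x)) :
    CoeffContinuousOn (fun t => psInt p t fun w => Ψ w * ρ (w - t)) (Set.Icc p q) := fun n => by
  have hc : ContinuousOn (fun t => ∑ x ∈ Finset.HasAntidiagonal.antidiagonal n, ∫ z in p..t,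
      PowerSeries.coeff x.1 (Ψ z) * PowerSeries.coeff x.2 (ρ (z - t))) (Set.Icc p q) := by
    refine continuousOn_finsetSum _ fun x _ => ?_
    exact continuousOn_conv (a := fun z => PowerSeries.coeff x.1 (Ψ z))
      (ρ := fun z => PowerSeries.coeff x.2 (ρ z)) (h x.1) (hρ x.2)
  exact hc.congr fun t ht => coeff_psInt_mul_shift h hρ n ht

end

/-- The iterated integral of a sequence of families of power series. -/
def chenSeries (φ : ℕ → ℝ → PowerSeries ℂ) (a : ℝ) : ℕ → ℝ → PowerSeries ℂ
  | 0, _ => 1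
  | n + 1, x => psInt a x fun t => chenSeries φ a n t * φ n t

theorem coeffContinuousOn_chenSeries {φ : ℕ → ℝ → PowerSeries ℂ} {p q : ℝ}
    (hφ : ∀ m, CoeffContinuousOn (φ m) (Set.Icc p q)) (n : ℕ) :
    CoeffContinuousOn (chenSeries φ p n) (Set.Icc p q) := by
  induction n with
  | zero => exact coeffContinuousOn_const 1
  | succ n ih => exact (ih.mul (hφ n)).psInt

theorem chenSeries_congr {φ φ' : ℕ → ℝ → PowerSeries ℂ} (a : ℝ) {n : ℕ}
    (h : ∀ m < n, φ m = φ' m) : chenSeries φ a n = chenSeries φ' a n := by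
  induction n with
  | zero => rfl
  | succ n ih =>
    funext x
    simp only [chenSeries, ih fun m hm => h m (hm.trans n.lt_succ_self), h n n.lt_succ_self]

/-! ### The telescoping sum -/

/-- The difference `X F_τ(a X; x) - X F_τ(b X; x)`. The polar terms at the integers cancel, so that
its coefficients extend continuously to all real `x`. -/
def kernelDiff (τ a b : ℂ) (x : ℝ) : PowerSeries ℂ :=
  PowerSeries.mk fun n => kernelExt τ n x * (a ^ ((n : ℤ) - 1) - b ^ ((n : ℤ) - 1))

theorem coeff_kernelDiff (τ a b : ℂ) (x : ℝ) (n : ℕ) : PowerSeries.coeff n (kernelDiff τ a b x)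
    = kernelExt τ n x * (a ^ ((n : ℤ) - 1) - b ^ ((n : ℤ) - 1)) :=
  PowerSeries.coeff_mk _ _

theorem contDiff_coeff_kernelDiff {τ : ℂ} (hτ : 0 < τ.im) (a b : ℂ) (n : ℕ) :
    ContDiff ℝ 1 fun x => PowerSeries.coeff n (kernelDiff τ a b x) := by
  simp only [coeff_kernelDiff]
  rcases eq_or_ne n 1 with rfl | hn
  · simpa using contDiff_const
  · exact (contDiff_kernelExt hτ hn).mul contDiff_const

theorem continuous_coeff_kernelDiff {τ : ℂ} (hτ : 0 < τ.im) (a b : ℂ) (n : ℕ) :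
    Continuous fun x => PowerSeries.coeff n (kernelDiff τ a b x) :=
  (contDiff_coeff_kernelDiff hτ a b n).continuous

theorem kernelDiff_eq_sub (τ a b : ℂ) {x : ℝ} (hx : theta τ x ≠ 0) :
    kernelDiff τ a b x = kernelSeries τ a x - kernelSeries τ b x := by
  ext n
  rw [coeff_kernelDiff, map_sub, coeff_kernelSeries, coeff_kernelSeries, kernelExt, if_neg hx,
    mul_sub]

theorem kernelDiff_add_one (τ a b : ℂ) (x : ℝ) :
    kernelDiff τ a b (x + 1) = kernelDiff τ a b x := by
  ext n
  rw [coeff_kernelDiff, coeff_kernelDiff, Complex.ofReal_add, Complex.ofReal_one,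
    kernelExt_add_one]

theorem coeffContinuousOn_kernelSeries {τ : ℂ} (hτ : 0 < τ.im) (a : ℂ) {p q : ℝ} (hp : 0 < p)
    (hq : q < 1) : CoeffContinuousOn (fun t => kernelSeries τ a t) (Set.Icc p q) := fun n => by
  simp only [coeff_kernelSeries]
  exact ((continuousOn_kernelF hτ n).mul continuousOn_const).mono fun x hx =>
    ⟨hp.trans_le hx.1, hx.2.trans_lt hq⟩

/-- The tail `u_m + ⋯ + u_{r-1}` of a sequence. -/
def tailSum (r : ℕ) (u : ℕ → ℂ) (m : ℕ) : ℂ := ∑ j ∈ Finset.Ico m r, u j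

theorem tailSum_eq_add {r : ℕ} (u : ℕ → ℂ) {m : ℕ} (hm : m < r) :
    tailSum r u m = u m + tailSum r u (m + 1) :=
  Finset.sum_eq_sum_Ico_succ_bot hm u

theorem tailSum_last {r : ℕ} (u : ℕ → ℂ) {m : ℕ} (hm : m + 1 = r) : tailSum r u m = u m := by
  rw [tailSum, ← hm, Nat.Ico_succ_singleton, Finset.sum_singleton]

/-- The iterated integral from `a` of `F(v_0 X; z_0) ⋯ F(v_{n-1} X; z_{n-1})`, multiplied by
`X^n`. -/
def genInt (τ : ℂ) (v : ℕ → ℂ) (a : ℝ) (n : ℕ) (t : ℝ) : PowerSeries ℂ :=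
  chenSeries (fun j x => kernelSeries τ (v j) x) a n t

/-- The sum, over all positions `i ≤ m`, of the generating integrals in which an additional variable
has been inserted behind the position `i`. -/
def fayInt (τ : ℂ) (r : ℕ) (u : ℕ → ℂ) (a : ℝ) (m : ℕ) (t : ℝ) : PowerSeries ℂ :=
  ∑ i ∈ Finset.range (m + 1), genInt τ (argAux r u i) a (m + 1) t

theorem genInt_succ (τ : ℂ) (v : ℕ → ℂ) (a : ℝ) (n : ℕ) (t : ℝ) :
    genInt τ v a (n + 1) t = psInt a t fun x => genInt τ v a n x * kernelSeries τ (v n) x :=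
  rfl

theorem genInt_congr (τ : ℂ) {v v' : ℕ → ℂ} (a : ℝ) {n : ℕ} (h : ∀ m < n, v m = v' m) :
    genInt τ v a n = genInt τ v' a n :=
  chenSeries_congr a fun m hm => by rw [h m hm]

section

variable {τ : ℂ} (hτ : 0 < τ.im) {p q t : ℝ} (hp : 0 < p) (hq : q < 1)

include hτ hp hq

theorem coeffContinuousOn_genInt (v : ℕ → ℂ) (n : ℕ) :
    CoeffContinuousOn (genInt τ v p n) (Set.Icc p q) :=
  coeffContinuousOn_chenSeries (fun _ => coeffContinuousOn_kernelSeries hτ _ hp hq) n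

theorem coeffContinuousOn_fayInt (r : ℕ) (u : ℕ → ℂ) (m : ℕ) :
    CoeffContinuousOn (fayInt τ r u p m) (Set.Icc p q) :=
  CoeffContinuousOn.sum _ fun _ _ => coeffContinuousOn_genInt hτ hp hq _ _

/-- Splitting off the last position, in which two neighbouring kernels have the arguments `U_m` and
`-U_{m+1}` (the tail sums); in all other positions the last kernel has the argument `u_m`. -/
theorem fayInt_succ (r : ℕ) (u : ℕ → ℂ) (m : ℕ) (ht : t ∈ Set.Icc p q) :
    fayInt τ r u p (m + 1) t
      = (psInt p t fun w => fayInt τ r u p m w * kernelSeries τ (u m) w)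
        + psInt p t fun w => (psInt p w fun z =>
            genInt τ u p m z * kernelSeries τ (tailSum r u m) z)
          * kernelSeries τ (-tailSum r u (m + 1)) w := by
  have h1 : (psInt p t fun w => fayInt τ r u p m w * kernelSeries τ (u m) w)
      = ∑ i ∈ Finset.range (m + 1), genInt τ (argAux r u i) p (m + 1 + 1) t := by
    simp only [fayInt, Finset.sum_mul]
    rw [psInt_sum (Ψ := fun i w => genInt τ (argAux r u i) p (m + 1) w * kernelSeries τ (u m) w)
      (Finset.range (m + 1)) (fun i _ => (coeffContinuousOn_genInt hτ hp hq (argAux r u i)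
        (m + 1)).mul (coeffContinuousOn_kernelSeries hτ (u m) hp hq)) ht]
    refine Finset.sum_congr rfl fun i hi => ?_
    have hi' : i < m + 1 := Finset.mem_range.1 hi
    have e : argAux r u i (m + 1) = u m := by
      rw [argAux, if_neg (by omega), if_neg (by omega), if_neg (by omega), Nat.add_sub_cancel]
    rw [genInt_succ τ _ p (m + 1), e]
  have e1 : argAux r u (m + 1) (m + 1) = -tailSum r u (m + 1) := by
    rw [argAux, if_neg (by omega), if_neg (by omega), if_pos rfl, tailSum]
  have e2 : argAux r u (m + 1) m = tailSum r u m := by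
    rw [argAux, if_neg (by omega), if_pos rfl, tailSum]
  have e3 : genInt τ (argAux r u (m + 1)) p m = genInt τ u p m :=
    genInt_congr τ p fun j hj => by rw [argAux, if_pos (by omega)]
  have h2 : genInt τ (argAux r u (m + 1)) p (m + 1 + 1) t
      = psInt p t fun w => (psInt p w fun z =>
            genInt τ u p m z * kernelSeries τ (tailSum r u m) z)
          * kernelSeries τ (-tailSum r u (m + 1)) w := by
    rw [genInt_succ τ _ p (m + 1), e1]
    simp only [genInt_succ τ _ p m, e2, e3]
  rw [h1, ← h2, fayInt, Finset.sum_range_succ]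

/-- Fay's identity under the integral sign: up to an exact telescoping term, inserting an additional
variable between two neighbouring variables produces the kernel of their difference. Subtracting the
same expression for `u'` removes the poles on the diagonal. -/
theorem fayInt_succ_sub (r : ℕ) {u u' : ℕ → ℂ} {m : ℕ} (hm : m + 1 < r)
    (huu : ∀ j, j + 1 < r → u' j = u j) (hu0 : u m ≠ 0)
    (hU : ∀ j < r, tailSum r u j ≠ 0) (hU' : ∀ j < r, tailSum r u' j ≠ 0)
    (ht : t ∈ Set.Icc p q) :
    (psInt p t fun w => (psInt p w fun z =>
        genInt τ u p m z * kernelSeries τ (tailSum r u m) z)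
          * kernelSeries τ (-tailSum r u (m + 1)) w)
      - (psInt p t fun w => (psInt p w fun z =>
        genInt τ u' p m z * kernelSeries τ (tailSum r u' m) z)
          * kernelSeries τ (-tailSum r u' (m + 1)) w)
      = (psInt p t fun w => (psInt p w fun z =>
          genInt τ u p m z * kernelDiff τ (tailSum r u m) (tailSum r u' m) (z - w))
            * kernelSeries τ (u m) w)
        - psInt p t fun w =>
          genInt τ u p (m + 1) w
            * kernelDiff τ (tailSum r u (m + 1)) (tailSum r u' (m + 1)) (w - t) := by
  have hk := fun a => coeffContinuousOn_kernelSeries hτ a hp hq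
  have hA := coeffContinuousOn_genInt hτ hp hq u m
  have hd := fun a b => continuous_coeff_kernelDiff hτ a b
  have hd' : ∀ (a b : ℂ) (w : ℝ),
      CoeffContinuousOn (fun z => kernelDiff τ a b (z - w)) (Set.Icc p q) := fun a b w n =>
    ((hd a b n).comp (continuous_id.sub continuous_const)).continuousOn
  have hgen : genInt τ u' p m = genInt τ u p m :=
    genInt_congr τ p fun j hj => huu j (by omega)
  have hum : u' m = u m := huu m hm
  have hsum := tailSum_eq_add u (show m < r by omega)
  have hsum' := tailSum_eq_add u' (show m < r by omega)
  rw [hum] at hsum'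
  have hUm := hU m (by omega)
  have hUm1 := hU (m + 1) hm
  have hUm' := hU' m (by omega)
  have hUm1' := hU' (m + 1) hm
  set U := tailSum r u m
  set V := tailSum r u (m + 1)
  set U' := tailSum r u' m
  set V' := tailSum r u' (m + 1)
  rw [hgen]
  have hsub : ∀ {w}, w ∈ Set.Ioo p t → w ∈ Set.Icc p q := fun hw => ⟨hw.1.le, hw.2.le.trans ht.2⟩
  -- Fay's identity with `a = U` and `b = -V`, where `U - V = u_m`
  have key : ∀ z w : ℝ, p < z → z < w → w < q →
      kernelSeries τ U z * kernelSeries τ (-V) w - kernelSeries τ U' z * kernelSeries τ (-V') w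
        = kernelDiff τ U U' (z - w) * kernelSeries τ (u m) w
          - kernelSeries τ (u m) z * kernelDiff τ V V' (z - w) := by
    intro z w h1 h2 h3
    have hz := theta_ofReal_ne_zero hτ (x := z) (by linarith) (by linarith) (by linarith)
    have hw := theta_ofReal_ne_zero hτ (x := w) (by linarith) (by linarith) (by linarith)
    have hzw := theta_ofReal_ne_zero hτ (x := z - w) (by linarith) (by linarith) (by linarith)
    have hzw' : theta τ ((z : ℂ) - w) ≠ 0 := by exact_mod_cast hzw
    have a1 : U + -V = u m := by rw [hsum]; ring
    have a2 : U' + -V' = u m := by rw [hsum']; ring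
    have f1 := kernelSeries_fay hτ hUm (neg_ne_zero.2 hUm1) (a1.symm ▸ hu0) hz hw hzw'
    have f2 := kernelSeries_fay hτ hUm' (neg_ne_zero.2 hUm1') (a2.symm ▸ hu0) hz hw hzw'
    rw [a1, ← neg_sub (z : ℂ) w, kernelSeries_neg_neg hτ hUm1 hzw'] at f1
    rw [a2, ← neg_sub (z : ℂ) w, kernelSeries_neg_neg hτ hUm1' hzw'] at f2
    rw [f1, f2, kernelDiff_eq_sub τ _ _ hzw, kernelDiff_eq_sub τ _ _ hzw, Complex.ofReal_sub]
    ring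
  rw [← psInt_sub ((hA.mul (hk U)).psInt.mul (hk _)) ((hA.mul (hk U')).psInt.mul (hk _)) ht,
    show genInt τ u p (m + 1) = fun w => psInt p w fun z => genInt τ u p m z * kernelSeries τ (u m) z
      from rfl,
    ← psInt_conv (hA.mul (hk (u m))) (hd V V') ht,
    ← psInt_sub ((coeffContinuousOn_conv hA (hd U U')).mul (hk _))
      (coeffContinuousOn_conv (hA.mul (hk (u m))) (hd V V')) ht]
  refine psInt_congr ht.1 fun w hw => ?_
  have hw' := hsub hw
  rw [← psInt_mul_const (hA.mul (hk U)) hw', ← psInt_mul_const (hA.mul (hk U')) hw',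
    ← psInt_mul_const (hA.mul (hd' U U' w)) hw',
    ← psInt_sub ((hA.mul (hk U)).mul (coeffContinuousOn_const _))
      ((hA.mul (hk U')).mul (coeffContinuousOn_const _)) hw',
    ← psInt_sub ((hA.mul (hd' U U' w)).mul (coeffContinuousOn_const _))
      ((hA.mul (hk (u m))).mul (hd' V V' w)) hw']
  refine psInt_congr hw.1.le fun z hz => ?_
  have := key z w hz.1 hz.2 (hw.2.trans_le ht.2)
  linear_combination genInt τ u p m z * this

end

/-- The difference between the sums `fayInt` for `u` and `u'`, corrected by the term left over by
the telescoping. -/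
def fayDefect (τ : ℂ) (r : ℕ) (u u' : ℕ → ℂ) (a : ℝ) (m : ℕ) (t : ℝ) : PowerSeries ℂ :=
  fayInt τ r u a m t - fayInt τ r u' a m t
    + psInt a t fun w => genInt τ u a m w * kernelDiff τ (tailSum r u m) (tailSum r u' m) (w - t)

section

variable {τ : ℂ} (hτ : 0 < τ.im) {p q t : ℝ} (hp : 0 < p) (hq : q < 1) (r : ℕ) {u u' : ℕ → ℂ}
  (huu : ∀ j, j + 1 < r → u' j = u j) (hu0 : ∀ j < r, u j ≠ 0)
  (hU : ∀ j < r, tailSum r u j ≠ 0) (hU' : ∀ j < r, tailSum r u' j ≠ 0)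

include hτ hp hq

theorem coeffContinuousOn_fayDefect (m : ℕ) :
    CoeffContinuousOn (fayDefect τ r u u' p m) (Set.Icc p q) :=
  ((coeffContinuousOn_fayInt hτ hp hq r u m).sub (coeffContinuousOn_fayInt hτ hp hq r u' m)).add
    (coeffContinuousOn_conv (coeffContinuousOn_genInt hτ hp hq u m)
      (continuous_coeff_kernelDiff hτ _ _))

include huu hu0 hU hU'

/-- The defect propagates by plain iterated integration. -/
theorem fayDefect_succ {m : ℕ} (hm : m + 1 < r) (ht : t ∈ Set.Icc p q) :
    fayDefect τ r u u' p (m + 1) t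
      = psInt p t fun w => fayDefect τ r u u' p m w * kernelSeries τ (u m) w := by
  have hk := fun a => coeffContinuousOn_kernelSeries hτ a hp hq
  have hC := coeffContinuousOn_fayInt hτ hp hq r u m
  have hC' := coeffContinuousOn_fayInt hτ hp hq r u' m
  have hD := coeffContinuousOn_conv (coeffContinuousOn_genInt hτ hp hq u m)
      (continuous_coeff_kernelDiff hτ (tailSum r u m) (tailSum r u' m))
  have hB := fayInt_succ_sub hτ hp hq r hm huu (hu0 m (by omega)) hU hU' ht
  simp only [fayDefect, add_mul, sub_mul]
  rw [psInt_add ((hC.mul (hk _)).sub (hC'.mul (hk _))) (hD.mul (hk _)) ht,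
    psInt_sub (hC.mul (hk _)) (hC'.mul (hk _)) ht, fayInt_succ hτ hp hq r u m ht,
    fayInt_succ hτ hp hq r u' m ht, huu m hm]
  linear_combination hB

omit huu hu0 in
/-- In depth one the defect is the integral of the increments over steps of length `p`, the lower
end point of the integration. -/
theorem fayDefect_zero (hr : 0 < r) (ht : t ∈ Set.Icc p q) :
    fayDefect τ r u u' p 0 t = psInt p t fun w =>
      kernelDiff τ (tailSum r u 0) (tailSum r u' 0) (p - w)
        - kernelDiff τ (tailSum r u 0) (tailSum r u' 0) (0 - w) := by
  have hk := fun a => coeffContinuousOn_kernelSeries hτ a hp hq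
  have hU0 := hU 0 hr
  have hU0' := hU' 0 hr
  have e0 : ∀ v, argAux r v 0 0 = -tailSum r v 0 := fun v => by
    rw [argAux, if_neg (by omega), if_neg (by omega), if_pos rfl, tailSum]
  simp only [fayDefect, fayInt, zero_add, Finset.range_one, Finset.sum_singleton, genInt_succ, e0]
  set U := tailSum r u 0
  set U' := tailSum r u' 0
  have hd := continuous_coeff_kernelDiff hτ U U'
  have hg : ∀ v x, genInt τ v p 0 x = 1 := fun v x => rfl
  have hd' : ∀ c : ℝ, CoeffContinuousOn (fun w => kernelDiff τ U U' (c - w)) (Set.Icc p q) :=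
    fun c n => ((hd n).comp (continuous_const.sub continuous_id)).continuousOn
  simp only [hg, one_mul]
  rw [psInt_sub (hd' p) (hd' 0) ht, ← psInt_sub (hk _) (hk _) ht]
  have h1 : (psInt p t fun w => kernelSeries τ (-U) w - kernelSeries τ (-U') w)
      = psInt p t fun w => -kernelDiff τ U U' (0 - w) := by
    refine psInt_congr ht.1 fun w hw => ?_
    have hw0 := theta_ofReal_ne_zero hτ (x := w) (by linarith [hw.1]) (by linarith [hw.2, ht.2])
      (by linarith [hw.1])
    have hw1 : theta τ ((0 - w : ℝ) : ℂ) ≠ 0 := by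
      rw [zero_sub, Complex.ofReal_neg, theta_neg]
      exact neg_ne_zero.2 hw0
    rw [kernelDiff_eq_sub _ _ _ hw1, Complex.ofReal_sub, Complex.ofReal_zero, zero_sub,
      ← neg_neg U, kernelSeries_neg_neg hτ (neg_ne_zero.2 hU0) hw0, ← neg_neg U',
      kernelSeries_neg_neg hτ (neg_ne_zero.2 hU0') hw0, neg_neg, neg_neg]
    ring
  have h2 : (psInt p t fun w => kernelDiff τ U U' (w - t))
      = psInt p t fun w => kernelDiff τ U U' (p - w) := by
    ext n
    have := intervalIntegral.integral_comp_sub_left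
      (fun w => PowerSeries.coeff n (kernelDiff τ U U' (w - t))) (a := p) (b := t) (p + t)
    rw [add_sub_cancel_right, add_sub_cancel_left] at this
    rw [coeff_psInt, coeff_psInt, ← this]
    refine intervalIntegral.integral_congr fun w _ => ?_
    congr 2
    ring
  rw [h1, h2, psInt_neg]
  ring

omit hu0 hU hU' in
/-- The dependence of the full Fay sum on the last variable, for truncated integrals. -/
theorem fayInt_add_genInt_sub {m : ℕ} (hm : m + 1 = r) (ht : t ∈ Set.Icc p q) :
    fayInt τ r u p m t + genInt τ u p (m + 1) t - (fayInt τ r u' p m t + genInt τ u' p (m + 1) t)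
      = fayDefect τ r u u' p m t + psInt p t fun w => genInt τ u p m w
          * (kernelDiff τ (u m) (u' m) w - kernelDiff τ (u m) (u' m) (w - t)) := by
  have hk := fun a => coeffContinuousOn_kernelSeries hτ a hp hq
  have hA := coeffContinuousOn_genInt hτ hp hq u m
  have hd := continuous_coeff_kernelDiff hτ (u m) (u' m)
  have hgen : genInt τ u' p m = genInt τ u p m :=
    genInt_congr τ p fun j hj => huu j (by omega)
  have hshift : ∀ c : ℝ, CoeffContinuousOn (fun w => kernelDiff τ (u m) (u' m) (w - c))
      (Set.Icc p q) :=
    fun c n => ((hd n).comp (continuous_id.sub continuous_const)).continuousOn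
  have hd0 : CoeffContinuousOn (fun w => kernelDiff τ (u m) (u' m) w) (Set.Icc p q) :=
    fun n => (hd n).continuousOn
  have h1 : (psInt p t fun w => genInt τ u p m w * kernelDiff τ (u m) (u' m) w)
      = genInt τ u p (m + 1) t - genInt τ u' p (m + 1) t := by
    rw [genInt_succ, genInt_succ, hgen, ← psInt_sub (hA.mul (hk _)) (hA.mul (hk _)) ht]
    refine psInt_congr ht.1 fun w hw => ?_
    rw [kernelDiff_eq_sub _ _ _ (theta_ofReal_ne_zero hτ (x := w) (by linarith [hw.1])
      (by linarith [hw.2, ht.2]) (by linarith [hw.1])), mul_sub]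
  simp only [mul_sub]
  rw [psInt_sub (hA.mul hd0) (hA.mul (hshift t)) ht, h1, fayDefect, tailSum_last u hm,
    tailSum_last u' hm]
  ring

end

/-! ### Estimates for truncated integrals -/

theorem SimplePoles.exists_norm_le {f : ℝ → ℂ} (hf : SimplePoles f) :
    ∃ M : ℝ, 0 ≤ M ∧ ∀ x ∈ Set.Ioo (0 : ℝ) 1, ‖f x‖ ≤ M * (x⁻¹ + (1 - x)⁻¹) := by
  obtain ⟨-, ⟨c, M, hM⟩, ⟨d, N, hN⟩⟩ := hf
  have aux : ∀ {g c : ℂ} {M s : ℝ}, s ∈ Set.Ioc (0 : ℝ) (1 / 2) → ‖g - c / s‖ ≤ M →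
      ‖g‖ ≤ (‖c‖ + |M|) * s⁻¹ := by
    intro g c M s hs h
    have h1 : 1 ≤ s⁻¹ := (one_le_inv₀ hs.1).2 (by linarith [hs.2])
    calc ‖g‖ = ‖c / s + (g - c / s)‖ := by rw [add_sub_cancel]
      _ ≤ ‖c / s‖ + |M| := (norm_add_le _ _).trans
          (add_le_add le_rfl (h.trans (le_abs_self M)))
      _ ≤ ‖c‖ * s⁻¹ + |M| * s⁻¹ := by
          refine add_le_add (le_of_eq ?_) (le_mul_of_one_le_right (abs_nonneg M) h1)
          rw [norm_div, Complex.norm_real, Real.norm_of_nonneg hs.1.le, div_eq_mul_inv]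
      _ = _ := by ring
  refine ⟨(‖c‖ + |M|) + (‖d‖ + |N|), by positivity, fun x hx => ?_⟩
  have hx1 : 0 < 1 - x := by linarith [hx.2]
  have p1 : 0 ≤ x⁻¹ := inv_nonneg.2 hx.1.le
  have p2 : 0 ≤ (1 - x)⁻¹ := inv_nonneg.2 hx1.le
  have c1 : 0 ≤ ‖c‖ + |M| := by positivity
  have c2 : 0 ≤ ‖d‖ + |N| := by positivity
  rcases le_or_gt x (1 / 2) with h | h
  · refine (aux ⟨hx.1, h⟩ (hM x ⟨hx.1, h⟩)).trans ?_
    nlinarith [mul_nonneg c1 p2, mul_nonneg c2 p1, mul_nonneg c2 p2]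
  · have hmem : 1 - x ∈ Set.Ioc (0 : ℝ) (1 / 2) := ⟨hx1, by linarith⟩
    have := hN (1 - x) hmem
    rw [sub_sub_cancel] at this
    refine (aux hmem this).trans ?_
    nlinarith [mul_nonneg c1 p2, mul_nonneg c1 p1, mul_nonneg c2 p1]

/-- A function with simple poles has absolute integral `O(1 - log ε)` over `[ε, 1 - ε]`. -/
theorem SimplePoles.exists_integral_norm_le {f : ℝ → ℂ} (hf : SimplePoles f) :
    ∃ K : ℝ, 0 ≤ K ∧ ∀ ε ∈ Set.Ioc (0 : ℝ) (1 / 4), ∀ t ∈ Set.Icc ε (1 - ε),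
      ∫ x in ε..t, ‖f x‖ ≤ K * (1 - Real.log ε) := by
  obtain ⟨M, hM, hb⟩ := hf.exists_norm_le
  refine ⟨2 * M, by positivity, fun ε hε t ht => ?_⟩
  have hsub : ∀ x ∈ Set.uIcc ε t, x ∈ Set.Ioo (0 : ℝ) 1 := fun x hx => by
    rw [Set.uIcc_of_le ht.1] at hx
    exact ⟨hε.1.trans_le hx.1, by linarith [hx.2, ht.2, hε.1]⟩
  have ht' := hsub t Set.right_mem_uIcc
  have hcont : ContinuousOn (fun x : ℝ => M * (x⁻¹ + (1 - x)⁻¹)) (Set.uIcc ε t) :=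
    continuousOn_const.mul ((continuousOn_id.inv₀ fun x hx => (hsub x hx).1.ne').add
      ((continuousOn_const.sub continuousOn_id).inv₀ fun x hx => by
        change 1 - x ≠ 0
        exact sub_ne_zero.2 (hsub x hx).2.ne'))
  have h1 : ∫ x in ε..t, ‖f x‖ ≤ ∫ x in ε..t, M * (x⁻¹ + (1 - x)⁻¹) := by
    refine intervalIntegral.integral_mono_on ht.1
      ((hf.1.mono hsub).norm.intervalIntegrable) hcont.intervalIntegrable fun x hx => ?_
    exact hb x (hsub x (by rwa [Set.uIcc_of_le ht.1]))
  have h2 : ∫ x in ε..t, M * (x⁻¹ + (1 - x)⁻¹)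
      = M * (Real.log t - Real.log (1 - t)) - M * (Real.log ε - Real.log (1 - ε)) := by
    refine intervalIntegral.integral_eq_sub_of_hasDerivAt
      (f := fun x => M * (Real.log x - Real.log (1 - x))) (fun x hx => ?_) hcont.intervalIntegrable
    have hx' := hsub x hx
    have hx1 : 1 - x ≠ 0 := by linarith [hx'.2]
    have d1 := (Real.hasDerivAt_log hx'.1.ne')
    have d2 := ((hasDerivAt_id x).const_sub 1).log hx1
    refine ((d1.sub d2).const_mul M).congr_deriv ?_
    simp only [id_eq]
    rw [neg_div, sub_neg_eq_add, one_div]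
  have l1 : Real.log t ≤ 0 := Real.log_nonpos ht'.1.le ht'.2.le
  have l2 : Real.log ε ≤ Real.log (1 - t) :=
    Real.log_le_log hε.1 (by linarith [ht.2])
  have l3 : Real.log (1 - ε) ≤ 0 :=
    Real.log_nonpos (by linarith [hε.2]) (by linarith [hε.1])
  rw [h2] at h1
  refine h1.trans ?_
  nlinarith [mul_nonneg hM (show 0 ≤ -Real.log t by linarith),
    mul_nonneg hM (show 0 ≤ Real.log (1 - t) - Real.log ε by linarith),
    mul_nonneg hM (show 0 ≤ -Real.log (1 - ε) by linarith)]

theorem one_le_one_sub_log {ε : ℝ} (hε : ε ∈ Set.Ioc (0 : ℝ) (1 / 4)) : 1 ≤ 1 - Real.log ε := by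
  have := Real.log_nonpos hε.1.le (by linarith [hε.2])
  linarith

/-- All the coefficients of `F ε t` are bounded by multiples of `g ε`, uniformly in
`t ∈ [ε, 1 - ε]`. -/
def UniformBound (g : ℝ → ℝ) (F : ℝ → ℝ → PowerSeries ℂ) : Prop :=
  ∀ n, ∃ K : ℝ, 0 ≤ K ∧ ∀ ε ∈ Set.Ioc (0 : ℝ) (1 / 4), ∀ t ∈ Set.Icc ε (1 - ε),
    ‖PowerSeries.coeff n (F ε t)‖ ≤ K * g ε

theorem UniformBound.psInt_mul_kernelSeries {τ : ℂ} (hτ : 0 < τ.im) {g : ℝ → ℝ}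
    {F : ℝ → ℝ → PowerSeries ℂ} (h : UniformBound g F)
    (hg : ∀ ε ∈ Set.Ioc (0 : ℝ) (1 / 4), 0 ≤ g ε)
    (hF : ∀ ε ∈ Set.Ioc (0 : ℝ) (1 / 4), CoeffContinuousOn (F ε) (Set.Icc ε (1 - ε))) (a : ℂ) :
    UniformBound (fun ε => g ε * (1 - Real.log ε))
      fun ε t => psInt ε t fun w => F ε w * kernelSeries τ a w := by
  intro n
  choose K hK hb using h
  choose N hN hint using fun m => (simplePoles_kernelF hτ m).exists_integral_norm_le
  refine ⟨∑ x ∈ Finset.HasAntidiagonal.antidiagonal n,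
    K x.1 * (‖a ^ ((x.2 : ℤ) - 1)‖ * N x.2), Finset.sum_nonneg fun x _ =>
      mul_nonneg (hK _) (mul_nonneg (norm_nonneg _) (hN _)), fun ε hε t ht => ?_⟩
  have hk := coeffContinuousOn_kernelSeries hτ a hε.1 (show 1 - ε < 1 by linarith [hε.1])
  simp only [coeff_psInt, PowerSeries.coeff_mul]
  rw [intervalIntegral.integral_finsetSum fun x _ => (((hF ε hε x.1).mul (hk x.2)).mono
    (uIcc_subset_of_mem ht)).intervalIntegrable, Finset.sum_mul]
  refine (norm_sum_le _ _).trans (Finset.sum_le_sum fun x _ => ?_)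
  have hkc : ContinuousOn (fun s : ℝ => kernelF τ x.2 s) (Set.uIcc ε t) :=
    (continuousOn_kernelF hτ x.2).mono fun s hs => by
      have := uIcc_subset_of_mem ht hs
      exact ⟨hε.1.trans_le this.1, by linarith [this.2, hε.1]⟩
  calc _ ≤ ∫ s in ε..t, K x.1 * g ε * ‖a ^ ((x.2 : ℤ) - 1)‖ * ‖kernelF τ x.2 s‖ := by
        refine intervalIntegral.norm_integral_le_of_norm_le ht.1
          (Eventually.of_forall fun s hs => ?_) (hkc.norm.intervalIntegrable.const_mul _)
        rw [coeff_kernelSeries, norm_mul, norm_mul]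
        have := hb x.1 ε hε s ⟨hs.1.le, hs.2.trans ht.2⟩
        calc _ ≤ K x.1 * g ε * (‖kernelF τ x.2 s‖ * ‖a ^ ((x.2 : ℤ) - 1)‖) :=
              mul_le_mul_of_nonneg_right this (by positivity)
          _ = _ := by ring
    _ = K x.1 * g ε * ‖a ^ ((x.2 : ℤ) - 1)‖ * ∫ s in ε..t, ‖kernelF τ x.2 s‖ :=
        intervalIntegral.integral_const_mul _ _
    _ ≤ K x.1 * g ε * ‖a ^ ((x.2 : ℤ) - 1)‖ * (N x.2 * (1 - Real.log ε)) :=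
        mul_le_mul_of_nonneg_left (hint x.2 ε hε t ht)
          (mul_nonneg (mul_nonneg (hK _) (hg ε hε)) (norm_nonneg _))
    _ = _ := by ring

theorem uniformBound_genInt {τ : ℂ} (hτ : 0 < τ.im) (u : ℕ → ℂ) (m : ℕ) :
    UniformBound (fun ε => (1 - Real.log ε) ^ m) fun ε t => genInt τ u ε m t := by
  induction m with
  | zero =>
    intro n
    refine ⟨1, zero_le_one, fun ε _ t _ => ?_⟩
    beta_reduce
    rw [pow_zero, mul_one]
    change ‖PowerSeries.coeff n (1 : PowerSeries ℂ)‖ ≤ 1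
    rw [PowerSeries.coeff_one]
    split_ifs <;> simp
  | succ m ih =>
    simp only [pow_succ, genInt_succ]
    exact ih.psInt_mul_kernelSeries hτ
      (fun ε hε => pow_nonneg (zero_le_one.trans (one_le_one_sub_log hε)) m)
      (fun ε hε => coeffContinuousOn_genInt hτ hε.1 (by linarith [hε.1]) u m) (u m)

theorem exists_lipschitz_kernelDiff {τ : ℂ} (hτ : 0 < τ.im) (a b : ℂ) (n : ℕ) :
    ∃ L : ℝ, 0 ≤ L ∧ ∀ x ∈ Set.Icc (-2 : ℝ) 2, ∀ y ∈ Set.Icc (-2 : ℝ) 2,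
      ‖PowerSeries.coeff n (kernelDiff τ a b x - kernelDiff τ a b y)‖ ≤ L * |x - y| := by
  obtain ⟨L, hL⟩ := ((contDiff_coeff_kernelDiff hτ a b n).locallyLipschitz.locallyLipschitzOn
    (s := Set.Icc (-2 : ℝ) 2)).exists_lipschitzOnWith_of_compact isCompact_Icc
  refine ⟨L, L.2, fun x hx y hy => ?_⟩
  rw [map_sub, ← dist_eq_norm, ← Real.dist_eq]
  exact hL.dist_le_mul x hx y hy

/-- In depth one the defect is `O(ε)` by the Lipschitz continuity of `kernelDiff`, and each further
integration costs at most one logarithm. -/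
theorem uniformBound_fayDefect {τ : ℂ} (hτ : 0 < τ.im) {r : ℕ} {u u' : ℕ → ℂ}
    (huu : ∀ j, j + 1 < r → u' j = u j) (hu0 : ∀ j < r, u j ≠ 0)
    (hU : ∀ j < r, tailSum r u j ≠ 0) (hU' : ∀ j < r, tailSum r u' j ≠ 0) {m : ℕ} (hm : m < r) :
    UniformBound (fun ε => ε * (1 - Real.log ε) ^ m) fun ε t => fayDefect τ r u u' ε m t := by
  induction m with
  | zero =>
    intro n
    obtain ⟨L, hL, h⟩ := exists_lipschitz_kernelDiff hτ (tailSum r u 0) (tailSum r u' 0) n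
    refine ⟨L, hL, fun ε hε t ht => ?_⟩
    beta_reduce
    rw [fayDefect_zero hτ hε.1 (by linarith [hε.1]) r hU hU' hm ht, coeff_psInt, pow_zero, mul_one]
    refine (intervalIntegral.norm_integral_le_of_norm_le_const (C := L * ε) fun w hw => ?_).trans ?_
    · rw [Set.uIoc_of_le ht.1] at hw
      have := h (ε - w) ⟨by linarith [hw.2, ht.2, hε.1], by linarith [hw.1, hε.1]⟩ (0 - w)
        ⟨by linarith [hw.2, ht.2, hε.1], by linarith [hw.1, hε.1]⟩
      rwa [show ε - w - (0 - w) = ε by ring, abs_of_pos hε.1] at this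
    · rw [abs_of_nonneg (by linarith [ht.1])]
      exact mul_le_of_le_one_right (mul_nonneg hL hε.1.le) (by linarith [ht.2, hε.1])
  | succ m ih =>
    have h := (ih (by omega)).psInt_mul_kernelSeries hτ
      (fun ε hε => mul_nonneg hε.1.le
        (pow_nonneg (zero_le_one.trans (one_le_one_sub_log hε)) m))
      (fun ε hε => coeffContinuousOn_fayDefect hτ hε.1 (by linarith [hε.1]) r m) (u m)
    intro n
    obtain ⟨K, hK, hb⟩ := h n
    refine ⟨K, hK, fun ε hε t ht => ?_⟩
    beta_reduce
    rw [fayDefect_succ hτ hε.1 (show 1 - ε < 1 by linarith [hε.1]) r huu hu0 hU hU' hm ht]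
    refine (hb ε hε t ht).trans (le_of_eq ?_)
    ring

/-- Up to `O(ε^{1/2})`, the truncated Fay sum does not depend on the last variable. -/
theorem isBigO_fayInt_add_genInt_sub {τ : ℂ} (hτ : 0 < τ.im) {m : ℕ} {u u' : ℕ → ℂ}
    (huu : ∀ j < m, u' j = u j) (hu0 : ∀ j < m + 1, u j ≠ 0)
    (hU : ∀ j < m + 1, tailSum (m + 1) u j ≠ 0) (hU' : ∀ j < m + 1, tailSum (m + 1) u' j ≠ 0)
    (d : ℕ) :
    (fun ε : ℝ => PowerSeries.coeff d
        (fayInt τ (m + 1) u ε m (1 - ε) + genInt τ u ε (m + 1) (1 - ε)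
          - (fayInt τ (m + 1) u' ε m (1 - ε) + genInt τ u' ε (m + 1) (1 - ε))))
      =O[𝓝[>] (0 : ℝ)] (fun ε : ℝ => ε ^ (1 / 2 : ℝ)) := by
  have huu' : ∀ j, j + 1 < m + 1 → u' j = u j := fun j hj => huu j (by omega)
  obtain ⟨K, hK, hb⟩ := uniformBound_fayDefect hτ huu' hu0 hU hU' m.lt_succ_self d
  choose A hA hgen using uniformBound_genInt hτ u m
  choose L hL hlip using exists_lipschitz_kernelDiff hτ (u m) (u' m)
  obtain ⟨C, hC, hlog⟩ := exists_norm_eval_log_le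
    ((1 - Polynomial.X : Polynomial ℂ) ^ m) (show (0 : ℝ) < 1 / 2 by norm_num)
  set B := ∑ x ∈ Finset.HasAntidiagonal.antidiagonal d, A x.1 * L x.2 with hB
  have hB0 : 0 ≤ B := Finset.sum_nonneg fun x _ => mul_nonneg (hA _) (hL _)
  refine Asymptotics.IsBigO.of_bound ((K + B) * C) ?_
  filter_upwards [Ioc_mem_nhdsGT (show (0 : ℝ) < 1 / 4 by norm_num)] with ε hε
  have ht : 1 - ε ∈ Set.Icc ε (1 - ε) := ⟨by linarith [hε.2], le_rfl⟩
  have hH : 0 ≤ (1 - Real.log ε) ^ m := pow_nonneg (zero_le_one.trans (one_le_one_sub_log hε)) m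
  rw [fayInt_add_genInt_sub hτ hε.1 (show 1 - ε < 1 by linarith [hε.1]) (m + 1) huu' rfl ht,
    map_add]
  have h2 : ‖PowerSeries.coeff d (psInt ε (1 - ε) fun w => genInt τ u ε m w
      * (kernelDiff τ (u m) (u' m) w - kernelDiff τ (u m) (u' m) (w - (1 - ε))))‖
      ≤ B * (ε * (1 - Real.log ε) ^ m) := by
    rw [coeff_psInt]
    refine (intervalIntegral.norm_integral_le_of_norm_le_const
      (C := B * (ε * (1 - Real.log ε) ^ m)) fun w hw => ?_).trans ?_
    · rw [Set.uIoc_of_le ht.1] at hw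
      rw [PowerSeries.coeff_mul, hB, Finset.sum_mul]
      refine (norm_sum_le _ _).trans (Finset.sum_le_sum fun x _ => ?_)
      -- by periodicity the two arguments of `kernelDiff` differ by `ε` only
      have e : kernelDiff τ (u m) (u' m) (w - (1 - ε)) = kernelDiff τ (u m) (u' m) (w + ε) := by
        rw [← kernelDiff_add_one]
        congr 1
        ring
      have h3 := hlip x.2 w ⟨by linarith [hw.1, hε.1], by linarith [hw.2, hε.1]⟩ (w + ε)
        ⟨by linarith [hw.1, hε.1], by linarith [hw.2, hε.1]⟩
      rw [show w - (w + ε) = -ε by ring, abs_neg, abs_of_pos hε.1] at h3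
      rw [e, norm_mul]
      calc _ ≤ (A x.1 * (1 - Real.log ε) ^ m) * (L x.2 * ε) :=
            mul_le_mul (hgen x.1 ε hε w ⟨hw.1.le, hw.2⟩) h3 (norm_nonneg _)
              (mul_nonneg (hA _) hH)
        _ = _ := by ring
    · rw [abs_of_nonneg (by linarith [ht.1])]
      exact mul_le_of_le_one_right (mul_nonneg hB0 (mul_nonneg hε.1.le hH))
        (by linarith [hε.1])
  -- half of the power of `ε` absorbs the logarithms
  have h4 : ε * (1 - Real.log ε) ^ m ≤ C * ε ^ (1 / 2 : ℝ) := by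
    have h5 := hlog ε ⟨hε.1, by linarith [hε.2]⟩
    rw [Polynomial.eval_pow, Polynomial.eval_sub, Polynomial.eval_one, Polynomial.eval_X, norm_pow,
      ← Complex.ofReal_one, ← Complex.ofReal_sub, Complex.norm_real,
      Real.norm_of_nonneg (zero_le_one.trans (one_le_one_sub_log hε))] at h5
    calc _ ≤ ε * (C * ε ^ (-(1 / 2) : ℝ)) := mul_le_mul_of_nonneg_left h5 hε.1.le
      _ = C * (ε ^ (1 : ℝ) * ε ^ (-(1 / 2) : ℝ)) := by rw [Real.rpow_one]; ring
      _ = _ := by rw [← Real.rpow_add hε.1]; norm_num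
  rw [Real.norm_of_nonneg (Real.rpow_nonneg hε.1.le _)]
  calc _ ≤ K * (ε * (1 - Real.log ε) ^ m) + B * (ε * (1 - Real.log ε) ^ m) :=
        (norm_add_le _ _).trans (add_le_add (hb ε hε (1 - ε) ht) h2)
    _ = (K + B) * (ε * (1 - Real.log ε) ^ m) := by ring
    _ ≤ (K + B) * (C * ε ^ (1 / 2 : ℝ)) := mul_le_mul_of_nonneg_left h4 (by positivity)
    _ = _ := by ring

/-! ### Coefficients of the generating integrals -/

theorem sum_antidiagonalTuple_succ {M : Type*} [AddCommMonoid M] (r d : ℕ)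
    (G : (Fin (r + 1) → ℕ) → M) :
    ∑ l ∈ Finset.Nat.antidiagonalTuple (r + 1) d, G l
      = ∑ x ∈ Finset.HasAntidiagonal.antidiagonal d,
        ∑ l ∈ Finset.Nat.antidiagonalTuple r x.1, G (Fin.snoc l x.2) := by
  rw [Finset.sum_sigma']
  symm
  refine Finset.sum_bij' (fun x _ => Fin.snoc x.2 x.1.2)
    (fun l _ => ⟨(∑ i, Fin.init l i, l (Fin.last r)), Fin.init l⟩) ?_ ?_ ?_ ?_ ?_
  · rintro ⟨⟨a, b⟩, l⟩ h
    simp only [Finset.mem_sigma, Finset.HasAntidiagonal.mem_antidiagonal,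
      Finset.Nat.mem_antidiagonalTuple] at h ⊢
    rw [Fin.sum_univ_castSucc]
    simp only [Fin.snoc_castSucc, Fin.snoc_last, h.2, h.1]
  · intro l h
    simp only [Finset.mem_sigma, Finset.HasAntidiagonal.mem_antidiagonal,
      Finset.Nat.mem_antidiagonalTuple] at h ⊢
    rw [Fin.sum_univ_castSucc] at h
    exact ⟨h, trivial⟩
  · rintro ⟨⟨a, b⟩, l⟩ h
    simp only [Finset.mem_sigma, Finset.HasAntidiagonal.mem_antidiagonal,
      Finset.Nat.mem_antidiagonalTuple] at h
    simp only [Fin.init_snoc, Fin.snoc_last, h.2]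
  · intro l _
    exact Fin.snoc_init_self l
  · intro _ _
    rfl

theorem continuousOn_iterInt {τ : ℂ} (hτ : 0 < τ.im) {a : ℝ} (ha : a ∈ Set.Ioo (0 : ℝ) 1) {r : ℕ}
    (k : Fin r → ℕ) : ContinuousOn (iterInt τ a r k) (Set.Ioo 0 1) := by
  have h := continuousOn_chenInt (ω := fun m t => kernelF τ (extendZero k m) t)
    (fun m => continuousOn_kernelF hτ _) ha r
  have e : iterInt τ a r k = chenInt (fun m t => kernelF τ (extendZero k m) t) a r := by
    funext x
    rw [← iterInt_eq_chenInt, funext (extendZero_coe k)]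
  rwa [e]

theorem coeff_genInt {τ : ℂ} (hτ : 0 < τ.im) {p q : ℝ} (hp : 0 < p) (hq : q < 1) (v : ℕ → ℂ)
    (r d : ℕ) {t : ℝ} (ht : t ∈ Set.Icc p q) : PowerSeries.coeff d (genInt τ v p r t)
      = ∑ l ∈ Finset.Nat.antidiagonalTuple r d,
        iterInt τ p r l t * ∏ j : Fin r, v j ^ ((l j : ℤ) - 1) := by
  induction r generalizing d t with
  | zero =>
    change PowerSeries.coeff d (1 : PowerSeries ℂ) = _
    cases d <;> simp [iterInt, PowerSeries.coeff_one]
  | succ r ih =>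
    have hsub : ∀ s ∈ Set.uIcc p t, s ∈ Set.Icc p q := fun s hs => uIcc_subset_of_mem ht hs
    have hsub' : ∀ s ∈ Set.uIcc p t, s ∈ Set.Ioo (0 : ℝ) 1 := fun s hs =>
      ⟨hp.trans_le (hsub s hs).1, (hsub s hs).2.trans_lt hq⟩
    have hp' : p ∈ Set.Ioo (0 : ℝ) 1 := hsub' p Set.left_mem_uIcc
    have hint : ∀ x ∈ Finset.HasAntidiagonal.antidiagonal d,
        ∀ l ∈ Finset.Nat.antidiagonalTuple r x.1, IntervalIntegrable (fun s : ℝ =>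
          iterInt τ p r l s * kernelF τ x.2 s
            * ((∏ j : Fin r, v j ^ ((l j : ℤ) - 1)) * v r ^ ((x.2 : ℤ) - 1)))
          MeasureTheory.volume p t := fun x _ l _ =>
      ((((continuousOn_iterInt hτ hp' l).mul (continuousOn_kernelF hτ x.2)).mono
        hsub').mul continuousOn_const).intervalIntegrable
    rw [genInt_succ, coeff_psInt, sum_antidiagonalTuple_succ]
    calc _ = ∫ s in p..t, ∑ x ∈ Finset.HasAntidiagonal.antidiagonal d,
          ∑ l ∈ Finset.Nat.antidiagonalTuple r x.1, iterInt τ p r l s * kernelF τ x.2 s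
            * ((∏ j : Fin r, v j ^ ((l j : ℤ) - 1)) * v r ^ ((x.2 : ℤ) - 1)) := by
          refine intervalIntegral.integral_congr fun s hs => ?_
          simp only [PowerSeries.coeff_mul, coeff_kernelSeries]
          refine Finset.sum_congr rfl fun x _ => ?_
          rw [ih x.1 (hsub s hs), Finset.sum_mul]
          refine Finset.sum_congr rfl fun l _ => ?_
          ring
      _ = _ := by
          rw [intervalIntegral.integral_finsetSum fun x hx => by
            simpa only [Finset.sum_fn] using IntervalIntegrable.sum _ fun l hl => hint x hx l hl]
          refine Finset.sum_congr rfl fun x hx => ?_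
          rw [intervalIntegral.integral_finsetSum (hint x hx)]
          refine Finset.sum_congr rfl fun l _ => ?_
          rw [intervalIntegral.integral_mul_const, Fin.prod_univ_castSucc]
          simp only [iterInt, Fin.init_snoc, Fin.snoc_last, Fin.snoc_castSucc, Fin.val_castSucc,
            Fin.val_last]

theorem tailSum_extendZero {r : ℕ} (u : Fin r → ℂ) (j : Fin r) :
    tailSum r (extendZero u) j = ∑ m ∈ Finset.Ici j, u m := by
  symm
  refine Finset.sum_bij (fun m _ => (m : ℕ)) (fun m hm => ?_) (fun a _ b _ h => Fin.ext h)
    (fun b hb => ?_) fun m _ => (extendZero_coe u m).symm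
  · exact Finset.mem_Ico.2 ⟨(Finset.mem_Ici.1 hm : j ≤ m), m.2⟩
  · have := Finset.mem_Ico.1 hb
    exact ⟨⟨b, this.2⟩, Finset.mem_Ici.2 this.1, rfl⟩

theorem argAux_extendZero {r : ℕ} (u : Fin r → ℂ) (i j : Fin r) :
    argAux r (extendZero u) i j = fayArg u i j := by
  have h := tailSum_extendZero u j
  rw [tailSum] at h
  have h4 : extendZero u ((j : ℕ) - 1) = u ⟨(j : ℕ) - 1, by omega⟩ := dif_pos _
  simp only [argAux, fayArg, h, h4, extendZero_coe, Fin.ext_iff]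

/-- The combination of truncated integrals occurring in the Fay relation, in generating form. -/
theorem coeff_fayInt_add_genInt {τ : ℂ} (hτ : 0 < τ.im) {m : ℕ} (u : Fin (m + 1) → ℂ) (d : ℕ)
    {ε : ℝ} (hε : ε ∈ Set.Ioc (0 : ℝ) (1 / 4)) :
    PowerSeries.coeff d (fayInt τ (m + 1) (extendZero u) ε m (1 - ε)
        + genInt τ (extendZero u) ε (m + 1) (1 - ε))
      = ∑ l ∈ Finset.Nat.antidiagonalTuple (m + 1) d,
        (fayP l u + ∏ j, u j ^ ((l j : ℤ) - 1)) * truncInt τ l ε := by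
  have ht : 1 - ε ∈ Set.Icc ε (1 - ε) := ⟨by linarith [hε.2], le_rfl⟩
  have hq : 1 - ε < 1 := by linarith [hε.1]
  simp only [map_add, fayInt, map_sum, coeff_genInt hτ hε.1 hq _ _ _ ht]
  rw [Finset.sum_comm, ← Finset.sum_add_distrib]
  refine Finset.sum_congr rfl fun l _ => ?_
  rw [← Finset.mul_sum, Finset.sum_range, fayP, truncInt]
  simp only [argAux_extendZero, extendZero_coe]
  ring

/-- The sum `∑ (P_l(u) + u_1^{l_1-1} ⋯ u_r^{l_r-1}) I(l)` over the `l` of weight `d`. -/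
def fayGen (τ : UpperHalfPlane) {r : ℕ} (d : ℕ) (u : Fin r → ℂ) : ℂ :=
  ∑ l ∈ Finset.Nat.antidiagonalTuple r d, (fayP l u + ∏ j, u j ^ ((l j : ℤ) - 1)) * IA τ l

theorem hasReg_fayGen (τ : UpperHalfPlane) {m : ℕ} (u : Fin (m + 1) → ℂ) (d : ℕ) :
    HasReg (fun ε => ∑ l ∈ Finset.Nat.antidiagonalTuple (m + 1) d,
      (fayP l u + ∏ j, u j ^ ((l j : ℤ) - 1)) * truncInt (τ : ℂ) l ε) (fayGen τ d u) :=
  HasReg.sum _ fun l _ => (hasReg_truncInt τ l).const_mul _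

/-- The regularized Fay sum does not depend on the last variable. -/
theorem fayGen_eq_of_eq_init (τ : UpperHalfPlane) {m : ℕ} {u u' : Fin (m + 1) → ℂ}
    (huu : ∀ j : Fin (m + 1), (j : ℕ) < m → u' j = u j) (hu0 : ∀ j, u j ≠ 0)
    (hU : ∀ j, ∑ i ∈ Finset.Ici j, u i ≠ 0) (hU' : ∀ j, ∑ i ∈ Finset.Ici j, u' i ≠ 0) (d : ℕ) :
    fayGen τ d u = fayGen τ d u' := by
  have h := isBigO_fayInt_add_genInt_sub τ.im_pos (m := m) (u := extendZero u)
    (u' := extendZero u') (fun j hj => by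
      have h1 := extendZero_coe u ⟨j, by omega⟩
      have h2 := extendZero_coe u' ⟨j, by omega⟩
      exact h2.trans ((huu ⟨j, by omega⟩ hj).trans h1.symm))
    (fun j hj => by
      rw [show j = ((⟨j, hj⟩ : Fin (m + 1)) : ℕ) from rfl, extendZero_coe]
      exact hu0 _)
    (fun j hj => by
      rw [show j = ((⟨j, hj⟩ : Fin (m + 1)) : ℕ) from rfl, tailSum_extendZero]
      exact hU _)
    (fun j hj => by
      rw [show j = ((⟨j, hj⟩ : Fin (m + 1)) : ℕ) from rfl, tailSum_extendZero]
      exact hU' _) d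
  have h0 := hasReg_zero_of_isBigO (show (0 : ℝ) < 1 / 2 by norm_num) h
  have h1 := (hasReg_fayGen τ u' d).add h0
  refine (hasReg_fayGen τ u d).unique ?_
  rw [add_zero] at h1
  refine h1.congr ?_
  filter_upwards [Ioc_mem_nhdsGT (show (0 : ℝ) < 1 / 4 by norm_num)] with ε hε
  rw [map_sub, coeff_fayInt_add_genInt τ.im_pos u d hε, coeff_fayInt_add_genInt τ.im_pos u' d hε]
  ring

/-- In depth one, the relation expresses the antisymmetry of `F(α; z)` under `(α, z) ↦ (-α, -z)`,
and the periodicity in `z`. -/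
theorem fayGen_depth_one (τ : UpperHalfPlane) (u : Fin 1 → ℂ) (d : ℕ) :
    fayGen τ d u = 0 := by
  have h := hasReg_fayGen τ u d
  have h0 : HasReg (fun _ => 0) 0 := hasReg_zero_of_isBigO (δ := 1) one_pos
    (Asymptotics.isBigO_zero _ _)
  refine h.unique (h0.congr ?_)
  filter_upwards [Ioc_mem_nhdsGT (show (0 : ℝ) < 1 / 4 by norm_num)] with ε hε
  rw [← coeff_fayInt_add_genInt τ.im_pos u d hε]
  have e0 : extendZero u 0 = u 0 := extendZero_coe u 0
  have e1 : argAux (0 + 1) (extendZero u) 0 0 = -u 0 := by simp [argAux, e0]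
  have key : fayInt (τ : ℂ) (0 + 1) (extendZero u) ε 0 (1 - ε)
      = -genInt (τ : ℂ) (extendZero u) ε (0 + 1) (1 - ε) := by
    simp only [fayInt, zero_add, Finset.range_one, Finset.sum_singleton]
    ext n
    change PowerSeries.coeff n (psInt ε (1 - ε) fun x => 1 *
        kernelSeries (τ : ℂ) (argAux (0 + 1) (extendZero u) 0 0) x)
      = PowerSeries.coeff n (-psInt ε (1 - ε) fun x => 1 *
        kernelSeries (τ : ℂ) (extendZero u 0) x)
    rw [e1, e0]
    rw [map_neg]
    simp only [coeff_psInt, one_mul, coeff_kernelSeries]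
    have hs := intervalIntegral.integral_comp_sub_left (a := ε) (b := 1 - ε)
      (fun x : ℝ => kernelF (τ : ℂ) n x * (-u 0) ^ ((n : ℤ) - 1)) 1
    rw [sub_sub_cancel] at hs
    rw [← hs, ← intervalIntegral.integral_neg]
    refine intervalIntegral.integral_congr fun x hx => ?_
    rw [Set.uIcc_of_le (by linarith [hε.2])] at hx
    have hx' : x ∈ Set.Ioo (0 : ℝ) 1 := ⟨hε.1.trans_le hx.1, by linarith [hx.2, hε.1]⟩
    have hpow : (-u 0) ^ ((n : ℤ) - 1) = -((-1) ^ n * u 0 ^ ((n : ℤ) - 1)) := by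
      rw [neg_eq_neg_one_mul (u 0), mul_zpow, zpow_sub_one₀ (by norm_num), zpow_natCast]
      norm_num
    have hsq : ((-1 : ℂ) ^ n) * (-1) ^ n = 1 := by rw [← mul_pow]; norm_num
    simp only [kernelF_one_sub τ.im_pos n hx', hpow]
    linear_combination (-(kernelF (τ : ℂ) n x * u 0 ^ ((n : ℤ) - 1))) * hsq
  rw [key, neg_add_cancel, map_zero]

/-! ### Evaluating the integral polynomials at complex points -/

section Specialization

variable {A : Type*} [CommRing A] (φ : A →+* ℂ)

/-- `Specializes φ x y` says that the fraction `x` has no pole at the point `φ : A → ℂ`, and takes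
the value `y` there. -/
def Specializes (x : FractionRing A) (y : ℂ) : Prop :=
  ∃ p q : A, φ q ≠ 0 ∧ x * algebraMap A _ q = algebraMap A _ p ∧ y * φ q = φ p

variable {φ}

theorem specializes_algebraMap (p : A) : Specializes φ (algebraMap A _ p) (φ p) :=
  ⟨p, 1, by simp, by simp, by simp⟩

theorem Specializes.add {x x' : FractionRing A} {y y' : ℂ} (h : Specializes φ x y)
    (h' : Specializes φ x' y') : Specializes φ (x + x') (y + y') := by
  obtain ⟨p, q, hq, h1, h2⟩ := h
  obtain ⟨p', q', hq', h1', h2'⟩ := h'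
  refine ⟨p * q' + p' * q, q * q', by rw [map_mul]; exact mul_ne_zero hq hq', ?_, ?_⟩
  · simp only [map_add, map_mul, ← h1, ← h1']
    ring
  · simp only [map_add, map_mul, ← h2, ← h2']
    ring

theorem Specializes.mul {x x' : FractionRing A} {y y' : ℂ} (h : Specializes φ x y)
    (h' : Specializes φ x' y') : Specializes φ (x * x') (y * y') := by
  obtain ⟨p, q, hq, h1, h2⟩ := h
  obtain ⟨p', q', hq', h1', h2'⟩ := h'
  refine ⟨p * p', q * q', by rw [map_mul]; exact mul_ne_zero hq hq', ?_, ?_⟩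
  · simp only [map_mul, ← h1, ← h1']
    ring
  · simp only [map_mul, ← h2, ← h2']
    ring

theorem Specializes.neg {x : FractionRing A} {y : ℂ} (h : Specializes φ x y) :
    Specializes φ (-x) (-y) := by
  obtain ⟨p, q, hq, h1, h2⟩ := h
  exact ⟨-p, q, hq, by rw [neg_mul, h1, map_neg], by rw [neg_mul, h2, map_neg]⟩

theorem Specializes.unique {x : FractionRing A} {y y' : ℂ} (h : Specializes φ x y)
    (h' : Specializes φ x y') : y = y' := by
  obtain ⟨p, q, hq, h1, h2⟩ := h
  obtain ⟨p', q', hq', h1', h2'⟩ := h'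
  have e : algebraMap A (FractionRing A) (p * q') = algebraMap A _ (p' * q) := by
    simp only [map_mul, ← h1, ← h1']
    ring
  have e' := congrArg φ (IsFractionRing.injective A (FractionRing A) e)
  rw [map_mul, map_mul, ← h2, ← h2'] at e'
  refine mul_right_cancel₀ (mul_ne_zero hq hq') ?_
  linear_combination e'

theorem Specializes.inv [IsDomain A] {x : FractionRing A} {y : ℂ} (h : Specializes φ x y)
    (hy : y ≠ 0) : Specializes φ x⁻¹ y⁻¹ := by
  obtain ⟨p, q, hq, h1, h2⟩ := h
  have hp : φ p ≠ 0 := h2 ▸ mul_ne_zero hy hq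
  have hp' : algebraMap A (FractionRing A) p ≠ 0 := fun h0 => by
    rw [← map_zero (algebraMap A (FractionRing A))] at h0
    exact hp (by rw [IsFractionRing.injective A (FractionRing A) h0, map_zero])
  have hx : x ≠ 0 := fun h0 => hp' (by rw [← h1, h0, zero_mul])
  exact ⟨q, p, hp, by rw [← h1, inv_mul_cancel_left₀ hx], by rw [← h2, inv_mul_cancel_left₀ hy]⟩

theorem Specializes.sum {ι : Type*} (s : Finset ι) {x : ι → FractionRing A} {y : ι → ℂ}
    (h : ∀ i ∈ s, Specializes φ (x i) (y i)) :
    Specializes φ (∑ i ∈ s, x i) (∑ i ∈ s, y i) := by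
  classical
  induction s using Finset.induction_on with
  | empty => simpa using specializes_algebraMap (φ := φ) 0
  | insert a s ha ih =>
    rw [Finset.sum_insert ha, Finset.sum_insert ha]
    exact (h a (Finset.mem_insert_self a s)).add
      (ih fun i hi => h i (Finset.mem_insert_of_mem hi))

theorem Specializes.prod {ι : Type*} (s : Finset ι) {x : ι → FractionRing A} {y : ι → ℂ}
    (h : ∀ i ∈ s, Specializes φ (x i) (y i)) :
    Specializes φ (∏ i ∈ s, x i) (∏ i ∈ s, y i) := by
  classical
  induction s using Finset.induction_on with
  | empty => simpa using specializes_algebraMap (φ := φ) 1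
  | insert a s ha ih =>
    rw [Finset.prod_insert ha, Finset.prod_insert ha]
    exact (h a (Finset.mem_insert_self a s)).mul
      (ih fun i hi => h i (Finset.mem_insert_of_mem hi))

theorem Specializes.pow {x : FractionRing A} {y : ℂ} (h : Specializes φ x y) (n : ℕ) :
    Specializes φ (x ^ n) (y ^ n) := by
  simpa using Specializes.prod (Finset.range n) (fun _ _ => h)

theorem Specializes.zpow [IsDomain A] {x : FractionRing A} {y : ℂ} (h : Specializes φ x y)
    (hy : y ≠ 0) (n : ℤ) : Specializes φ (x ^ n) (y ^ n) := by
  cases n with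
  | ofNat n => simpa using h.pow n
  | negSucc n =>
    rw [zpow_negSucc, zpow_negSucc]
    exact (h.pow (n + 1)).inv (pow_ne_zero _ hy)

end Specialization

/-- The points at which none of the arguments occurring in `fayP` vanishes. -/
def FayGeneric {r : ℕ} (u : Fin r → ℂ) : Prop :=
  ∀ j, u j ≠ 0 ∧ ∑ m ∈ Finset.Ici j, u m ≠ 0

theorem FayGeneric.fayArg_ne_zero {r : ℕ} {u : Fin r → ℂ} (h : FayGeneric u) (i j : Fin r) :
    fayArg u i j ≠ 0 := by
  unfold fayArg
  split_ifs
  exacts [(h _).1, (h _).2, neg_ne_zero.2 (h _).2, (h _).1]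

theorem eval_map_fayPoly {r : ℕ} {u : Fin r → ℂ} (hu : FayGeneric u) (l : Fin r → ℕ) :
    MvPolynomial.eval u (MvPolynomial.map (Int.castRingHom ℂ) (fayPoly l))
      = (∏ j, u j) * fayP l u := by
  rw [MvPolynomial.eval_map]
  have hX : ∀ j, Specializes (MvPolynomial.eval₂Hom (Int.castRingHom ℂ) u) (ratVar r j) (u j) :=
    fun j => by
      have h := specializes_algebraMap (φ := MvPolynomial.eval₂Hom (Int.castRingHom ℂ) u)
        (MvPolynomial.X j)
      rwa [MvPolynomial.eval₂Hom_X'] at h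
  have harg : ∀ i j, Specializes (MvPolynomial.eval₂Hom (Int.castRingHom ℂ) u)
      (fayArg (ratVar r) i j) (fayArg u i j) := fun i j => by
    unfold fayArg
    split_ifs
    exacts [hX _, Specializes.sum _ fun m _ => hX m, (Specializes.sum _ fun m _ => hX m).neg, hX _]
  have h : Specializes (MvPolynomial.eval₂Hom (Int.castRingHom ℂ) u)
      ((∏ j, ratVar r j) * fayP l (ratVar r)) ((∏ j, u j) * fayP l u) :=
    (Specializes.prod _ fun j _ => hX j).mul (Specializes.sum _ fun i _ =>
      Specializes.prod _ fun j _ => (harg i j).zpow (hu.fayArg_ne_zero i j) _)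
  rw [← algebraMap_fayPoly] at h
  exact (specializes_algebraMap (φ := MvPolynomial.eval₂Hom (Int.castRingHom ℂ) u)
    (fayPoly l)).unique h

/-! ### Extracting coefficients by rescaling the variables -/

/-- The generic points are the complement of a hypersurface. -/
theorem exists_fayGeneric_poly (r : ℕ) : ∃ G : MvPolynomial (Fin r) ℂ,
    ∀ u, MvPolynomial.eval u G ≠ 0 ↔ FayGeneric u := by
  refine ⟨∏ j, (MvPolynomial.X j * ∑ m ∈ Finset.Ici j, MvPolynomial.X m), fun u => ?_⟩
  simp only [map_prod, map_mul, map_sum, MvPolynomial.eval_X, Finset.prod_ne_zero_iff,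
    Finset.mem_univ, true_imp_iff, mul_ne_zero_iff, FayGeneric]

theorem fayGeneric_natCast {r : ℕ} {w : Fin r → ℕ} (hw : ∀ j, 0 < w j) :
    FayGeneric fun j => (w j : ℂ) := fun j => by
  refine ⟨Nat.cast_ne_zero.2 (hw j).ne', ?_⟩
  rw [← Nat.cast_sum]
  exact Nat.cast_ne_zero.2 (Finset.sum_pos (fun m _ => hw m) ⟨j, Finset.mem_Ici.2 le_rfl⟩).ne'

theorem coeff_bind₁_C_mul_X {r : ℕ} (w : Fin r → ℂ) (p : MvPolynomial (Fin r) ℂ)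
    (k : Fin r →₀ ℕ) :
    MvPolynomial.coeff k (MvPolynomial.bind₁ (fun j => MvPolynomial.C (w j) * MvPolynomial.X j) p)
      = (∏ j, w j ^ k j) * MvPolynomial.coeff k p := by
  induction p using MvPolynomial.induction_on' with
  | monomial m a =>
    have h : MvPolynomial.bind₁ (fun j => MvPolynomial.C (w j) * MvPolynomial.X j)
        (MvPolynomial.monomial m a) = MvPolynomial.monomial m ((∏ j, w j ^ m j) * a) := by
      rw [MvPolynomial.bind₁_monomial, MvPolynomial.monomial_eq]
      rw [Finsupp.prod_fintype _ _ fun _ => pow_zero _]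
      simp only [mul_pow, Finset.prod_mul_distrib, map_mul, map_prod, map_pow]
      have hs : ∀ f : Fin r → MvPolynomial (Fin r) ℂ,
          ∏ j ∈ m.support, f j ^ m j = ∏ j, f j ^ m j := fun f =>
        Finset.prod_subset (Finset.subset_univ m.support) fun j _ hj => by
          rw [Finsupp.notMem_support_iff.1 hj, pow_zero]
      rw [hs, hs]
      ring
    rw [h, MvPolynomial.coeff_monomial, MvPolynomial.coeff_monomial]
    split_ifs with hm
    · rw [hm]
    · rw [mul_zero]
  | add p q hp hq => rw [map_add, MvPolynomial.coeff_add, hp, hq, MvPolynomial.coeff_add, mul_add]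

/-- If rescaling the variables by `w` multiplies a polynomial by `c`, only monomials of weight `c`
occur in it. -/
theorem coeff_eq_zero_of_rescale {r : ℕ} {p : MvPolynomial (Fin r) ℂ} {w : Fin r → ℕ}
    (hw : ∀ j, 0 < w j) {c : ℂ}
    (h : ∀ u, FayGeneric u → FayGeneric (fun j => (w j : ℂ) * u j) →
      MvPolynomial.eval (fun j => (w j : ℂ) * u j) p = c * MvPolynomial.eval u p)
    {k : Fin r →₀ ℕ} (hk : ∏ j, (w j : ℂ) ^ k j ≠ c) : MvPolynomial.coeff k p = 0 := by
  obtain ⟨G, hG⟩ := exists_fayGeneric_poly r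
  have hbind : ∀ (q : MvPolynomial (Fin r) ℂ) (u : Fin r → ℂ), MvPolynomial.eval u
      (MvPolynomial.bind₁ (fun j => MvPolynomial.C (w j : ℂ) * MvPolynomial.X j) q)
      = MvPolynomial.eval (fun j => (w j : ℂ) * u j) q := fun q u => by
    rw [MvPolynomial.eval, MvPolynomial.eval₂Hom_bind₁]
    simp
  set b := MvPolynomial.bind₁ (fun j : Fin r => MvPolynomial.C (w j : ℂ) * MvPolynomial.X j)
  -- the assumption holds outside of the zeros of `G` and `b G`
  have h0 : (b p - MvPolynomial.C c * p) * (G * b G) = 0 := by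
    refine MvPolynomial.funext fun u => ?_
    rw [map_mul, map_mul, map_sub, map_mul, MvPolynomial.eval_C, hbind, hbind, map_zero]
    by_cases h1 : MvPolynomial.eval u G = 0
    · rw [h1, zero_mul, mul_zero]
    by_cases h2 : MvPolynomial.eval (fun j => (w j : ℂ) * u j) G = 0
    · rw [h2, mul_zero, mul_zero]
    rw [h u ((hG _).1 h1) ((hG _).1 h2), sub_self, zero_mul]
  have h1 : ∀ {q : MvPolynomial (Fin r) ℂ} (u : Fin r → ℂ), MvPolynomial.eval u q ≠ 0 → q ≠ 0 :=
    fun u hu h0 => hu (by rw [h0, map_zero])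
  have hG1 : G ≠ 0 := h1 _ ((hG _).2 (fayGeneric_natCast hw))
  have hG2 : b G ≠ 0 := h1 (fun _ => 1) (by
    rw [hbind, hG]
    simpa using fayGeneric_natCast hw)
  have h2 := (mul_eq_zero.1 h0).resolve_right (mul_ne_zero hG1 hG2)
  have h3 := congrArg (MvPolynomial.coeff k) h2
  rw [MvPolynomial.coeff_sub, MvPolynomial.coeff_C_mul, coeff_bind₁_C_mul_X,
    MvPolynomial.coeff_zero, ← sub_mul] at h3
  exact (mul_eq_zero.1 h3).resolve_left (sub_ne_zero.2 hk)

/-! ### Homogeneity -/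

theorem fayArg_const_mul {r : ℕ} (c : ℂ) (u : Fin r → ℂ) (i j : Fin r) :
    fayArg (fun j => c * u j) i j = c * fayArg u i j := by
  unfold fayArg
  split_ifs <;> simp only [← Finset.mul_sum, mul_neg]

theorem prod_mul_fayP_const_mul {r : ℕ} {c : ℂ} (hc : c ≠ 0) (l : Fin r → ℕ) (u : Fin r → ℂ) :
    (∏ j, c * u j) * fayP l (fun j => c * u j) = c ^ (∑ j, l j) * ((∏ j, u j) * fayP l u) := by
  have h : ∀ j : Fin r, c * c ^ ((l j : ℤ) - 1) = c ^ l j := fun j => by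
    rw [← zpow_one_add₀ hc, add_sub_cancel, zpow_natCast]
  simp only [fayP, fayArg_const_mul, mul_zpow, Finset.prod_mul_distrib, ← Finset.mul_sum,
    ← Finset.prod_pow_eq_pow_sum, ← h]
  ring

/-- The polynomial `u_1 ⋯ u_r P_l` is homogeneous of degree `l_1 + ⋯ + l_r`. -/
theorem sum_eq_of_fayCoeff_ne_zero {r : ℕ} {l k : Fin r → ℕ} (h : fayCoeff l k ≠ 0) :
    ∑ j, l j = ∑ j, k j := by
  by_contra hne
  refine h (Int.cast_eq_zero (α := ℂ).1 ?_)
  have hc : (fayCoeff l k : ℂ) = MvPolynomial.coeff (Finsupp.equivFunOnFinite.symm k)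
      (MvPolynomial.map (Int.castRingHom ℂ) (fayPoly l)) := by
    rw [MvPolynomial.coeff_map, fayCoeff, eq_intCast]
  rw [hc]
  refine coeff_eq_zero_of_rescale (w := fun _ => 2) (fun _ => two_pos) (c := 2 ^ (∑ j, l j))
    (fun u hu hu' => ?_) ?_
  · rw [eval_map_fayPoly hu, eval_map_fayPoly hu', Nat.cast_ofNat,
      prod_mul_fayP_const_mul two_ne_zero]
  · simp only [Finsupp.equivFunOnFinite_symm_apply_apply, Finset.prod_pow_eq_pow_sum]
    rw [Nat.cast_ofNat]
    intro h2
    exact hne (Nat.pow_right_injective le_rfl (by exact_mod_cast h2.symm))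

theorem finite_setOf_fayCoeff_ne_zero {r : ℕ} (k : Fin r → ℕ) :
    {l : Fin r → ℕ | fayCoeff l k ≠ 0}.Finite :=
  (Finset.Nat.antidiagonalTuple r (∑ j, k j)).finite_toSet.subset fun _ hl =>
    Finset.mem_coe.2 (Finset.Nat.mem_antidiagonalTuple.2 (sum_eq_of_fayCoeff_ne_zero hl))

/-! ### The Fay relations -/

/-- The polynomial `u_1 ⋯ u_r · fayGen τ d u`. Its coefficient at `u^k`, for `k` of weight `d`, is
`I(k) + ∑_l c⟨l | k⟩ I(l)`. -/
def fayGenPoly (τ : UpperHalfPlane) (r d : ℕ) : MvPolynomial (Fin r) ℂ :=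
  ∑ l ∈ Finset.Nat.antidiagonalTuple r d,
    MvPolynomial.C (IA τ l) * (MvPolynomial.map (Int.castRingHom ℂ) (fayPoly l)
      + MvPolynomial.monomial (Finsupp.equivFunOnFinite.symm l) 1)

theorem eval_fayGenPoly (τ : UpperHalfPlane) {r : ℕ} (d : ℕ) {u : Fin r → ℂ} (hu : FayGeneric u) :
    MvPolynomial.eval u (fayGenPoly τ r d) = (∏ j, u j) * fayGen τ d u := by
  rw [fayGenPoly, map_sum, fayGen, Finset.mul_sum]
  refine Finset.sum_congr rfl fun l _ => ?_
  rw [map_mul, map_add, eval_map_fayPoly hu, MvPolynomial.eval_C, MvPolynomial.eval_monomial,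
    Finsupp.prod_fintype _ _ fun _ => pow_zero _]
  have h : ∏ j, u j ^ l j = (∏ j, u j) * ∏ j, u j ^ ((l j : ℤ) - 1) := by
    rw [← Finset.prod_mul_distrib]
    refine Finset.prod_congr rfl fun j _ => ?_
    rw [← zpow_one_add₀ (hu j).1, add_sub_cancel, zpow_natCast]
  simp only [Finsupp.equivFunOnFinite_symm_apply_apply, h]
  ring

theorem coeff_fayGenPoly (τ : UpperHalfPlane) {r : ℕ} (k : Fin r → ℕ) :
    MvPolynomial.coeff (Finsupp.equivFunOnFinite.symm k) (fayGenPoly τ r (∑ j, k j))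
      = IA τ k + ∑ᶠ l : Fin r → ℕ, (fayCoeff l k : ℂ) * IA τ l := by
  rw [finsum_eq_sum_of_support_subset (s := Finset.Nat.antidiagonalTuple r (∑ j, k j)) _ fun l hl =>
    Finset.mem_coe.2 (Finset.Nat.mem_antidiagonalTuple.2 (sum_eq_of_fayCoeff_ne_zero fun h => hl (by
      simp only [h, Int.cast_zero, zero_mul])))]
  have hk : k ∈ Finset.Nat.antidiagonalTuple r (∑ j, k j) :=
    Finset.Nat.mem_antidiagonalTuple.2 rfl
  simp only [fayGenPoly, MvPolynomial.coeff_sum, MvPolynomial.coeff_C_mul, MvPolynomial.coeff_add,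
    MvPolynomial.coeff_map, MvPolynomial.coeff_monomial, mul_add, Finset.sum_add_distrib,
    EmbeddingLike.apply_eq_iff_eq, mul_ite, mul_one, mul_zero, Finset.sum_ite_eq', hk, if_true]
  rw [add_comm]
  congr 1
  exact Finset.sum_congr rfl fun l _ => by rw [mul_comm, fayCoeff, eq_intCast]

theorem coeff_fayGenPoly_eq_zero (τ : UpperHalfPlane) {m : ℕ} (d : ℕ) {k : Fin (m + 1) → ℕ}
    (hk : m = 0 ∨ k (Fin.last m) ≠ 1) :
    MvPolynomial.coeff (Finsupp.equivFunOnFinite.symm k) (fayGenPoly τ (m + 1) d) = 0 := by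
  rcases Nat.eq_zero_or_pos m with rfl | hm
  · -- in depth one the polynomial vanishes identically, so that even `w = 1` multiplies it by `0`
    refine coeff_eq_zero_of_rescale (w := fun _ => 1) (fun _ => one_pos) (c := 0)
      (fun u hu hu' => ?_) ?_
    · rw [eval_fayGenPoly τ d hu', fayGen_depth_one, mul_zero, zero_mul]
    · simp
  -- The value of the polynomial is a function independent of the last variable, times the product
  -- of the variables: doubling the last variable doubles it.
  refine coeff_eq_zero_of_rescale (w := fun j => if j = Fin.last m then 2 else 1)
    (fun j => by split_ifs <;> norm_num) (c := 2) (fun u hu hu' => ?_) ?_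
  · rw [eval_fayGenPoly τ d hu, eval_fayGenPoly τ d hu', Finset.prod_mul_distrib,
      ← fayGen_eq_of_eq_init τ (fun j hj => ?_) (fun j => (hu j).1) (fun j => (hu j).2)
        (fun j => (hu' j).2) d]
    · simp [Finset.prod_ite_eq', mul_assoc]
    · rw [if_neg (by rintro rfl; exact absurd hj (by simp)), Nat.cast_one, one_mul]
  · simp only [Nat.cast_ite, Nat.cast_ofNat, Nat.cast_one, ite_pow, one_pow, Finset.prod_ite_eq',
      Finset.mem_univ, if_true, Finsupp.equivFunOnFinite_symm_apply_apply]
    intro h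
    refine hk.resolve_left hm.ne' (Nat.pow_right_injective le_rfl ?_)
    exact_mod_cast (h.trans (pow_one (2 : ℂ)).symm)

end EMZV

end

theorem mainTheorem2 (τ : UpperHalfPlane) (r : ℕ) (hr : 1 ≤ r) (k : Fin r → ℕ)
    (hk : r = 1 ∨ (1 < r ∧ k ⟨r - 1, by omega⟩ ≠ 1)) :
    (∀ (s : ℕ) (l : Fin s → ℕ), EMZV.HasReg (EMZV.truncInt (τ : ℂ) l) (EMZV.IA τ l)) ∧
    {l : Fin r → ℕ | EMZV.fayCoeff l k ≠ 0}.Finite ∧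
    EMZV.IA τ k
      = (∑ i ∈ Finset.Icc 2 r,
          (-1 : ℂ) ^ i
            * (∏ j : Fin r, if (j : ℕ) + 1 < i then (if k j = 1 then (1 : ℂ) else 0) else 1)
            * (if k ⟨r - 1, by omega⟩ = 1 then (1 : ℂ) else 0)
            * riemannZeta (i : ℂ)
            * EMZV.IA τ (fun m : Fin (r - i) => k ⟨i - 1 + (m : ℕ), by omega⟩))
        - ∑ᶠ l : Fin r → ℕ, (EMZV.fayCoeff l k : ℂ) * EMZV.IA τ l := by
  refine ⟨fun s l => EMZV.hasReg_truncInt τ l, EMZV.finite_setOf_fayCoeff_ne_zero k, ?_⟩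
  -- The sum over zeta values is empty for `r = 1`, and contains the factor `δ_{1, k_r} = 0`
  -- otherwise.
  rw [Finset.sum_eq_zero fun i hi => ?_, zero_sub]
  · obtain ⟨m, rfl⟩ : ∃ m, r = m + 1 := ⟨r - 1, by omega⟩
    rw [eq_neg_iff_add_eq_zero, ← EMZV.coeff_fayGenPoly]
    exact EMZV.coeff_fayGenPoly_eq_zero τ _ (hk.imp (by omega) fun h => h.2)
  · rcases hk with hk | hk
    · have := Finset.mem_Icc.1 hi
      omega
    · rw [if_neg hk.2, mul_zero, zero_mul, zero_mul]
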